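/- **Setting.** Computability is type-two computability: a *name* is a sequence in $\mathbb N^{\mathbb N}$, a *representation* of a set is a partial surjection from names onto it, a map between represented sets is *computable* if some type-two Turing machine turns every name of every $x$ into a name of $f(x)$, and two representations of one set are *computably equivalent* if names can be computably translated in both directions. For a represented metric space $X$, an open set $U\subseteq X$ is named by (a code of) a realizer of its characteristic function into the Sierpinski space. $X$ is a *computable metric space* if its metric is computable and, moreover, either the distance $(x,A)\mapsto d(x,A)=\inf_{y\in A}d(x,y)\in[0,\infty]$ from points to closed sets (named through their open complements) is computable from below, or the representation is equivalent to the Cauchy representation of a dense sequence in $X$. It is *effectively separable* if it has a computable dense sequence. Let $\Omega=\{0,1\}^\omega$ with the fair-coin measure $P$. A *lower-measurable set* is an equivalence class of decreasing sequences $(W_n)$ of open subsets of $\Omega$ with $P(W_n)\le P(W_m)+2^{-n}$ for $m>n$, where $(W_n)\sim(W'_n)$ if for every $\varepsilon>0$, $P(W_m\cap W'_m)\ge\max(P(W_m),P(W'_m))-\varepsilon$ for all large $m$; its measure is $\sup_n (P(W_n)-2^{-n})$, and a name of it lists names of the sets of a representing sequence. A *random variable* $Y$ in $X$ is a map $Y^{-1}$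 from open subsets of $X$ to lower-measurable sets that has a continuous realizer and preserves $\emptyset$, the whole space, binary intersections and binary unions. A *piecewise-continuous* random variable is a continuous function $F:\operatorname{dom}F\to X$ on an open set $\operatorname{dom} F\subseteq\Omega$ of measure $1$; it is *continuous* if $\operatorname{dom}F=\Omega$ and *simple* if it has finite range. It is named by a name of $\operatorname{dom}F$ together with a realizer of $F$. The Fan metric is $d_F(F,G)=\sup\{\varepsilon\in\mathbb Q^+ : P(d(F,G)>\varepsilon)>\varepsilon\}$ (with $\sup\emptyset=0$). A sequence $(F_n)$ is *fast Cauchy* if $d_F(F_m,F_n)<2^{-\min(m,n)}$ for all $m,n$, and $F_n\to Y$ means $\liminf_n P(F_n\in U\wedge Y\in U)\ge P(Y\in U)$ for every open $U\subseteq X$. **Theorem.** Let $X$ be an effectively separable computable metric space. 1. There is a type-two machine which, given any name of the preimage map $Y^{-1}$ of any random variable $Y$ in $X$, computes a name of a fast Cauchy sequence of simple continuous random variables $F_n$ with $F_n\to Y$. 2. The following are representations of the set of random variables in $X$, and they are computably equivalent: (a) names of the preimage map from open sets to lower-measurable sets; (b) names of fast Cauchy sequences of simple continuous random variables converging to the random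 variable; (c) the same with simple piecewise-continuous random variables. 3. If $X$ is complete, then every fast Cauchy sequence of simple (piecewise-)continuous random variables converges to a random variable. -/

import Mathlib

open MeasureTheory TopologicalSpace Filter
open scoped ENNReal

noncomputable section

namespace TTE

/-! ### Type-two computability -/

/-- Names: infinite sequences of symbols, on which type-two machines act. -/
abbrev Name : Type := ℕ → ℕ

/-- The code of the finite word `q 0, …, q (k - 1)`. -/
def wordCode (q : Name) (k : ℕ) : ℕ := Encodable.encode ((List.range k).map q)

/-- `Applies e q r`: the partial continuous function on names coded by `e`, on input `q`, outputs
the infinite sequence `r`. To output its `n`-th symbol the machine reads longer and longer initial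
words `w` of the input; `e ⟨n, w⟩ = 0` means "read on", and `e ⟨n, w⟩ = a + 1` means "write `a`".
The machine-computable partial functions are those coded by a computable `e`, and every continuous
partial function on names extends to one coded by some `e`. -/
def Applies (e q r : Name) : Prop :=
  ∀ n, ∃ k, e (Nat.pair n (wordCode q k)) = r n + 1 ∧
    ∀ j < k, e (Nat.pair n (wordCode q j)) = 0

/-- A naming relation on `X`: `δ p x` says that `p` is a name of `x`. -/
abbrev Naming (X : Type*) := Name → X → Prop

/-- A representation of `X` is (the graph of) a partial surjection from names onto `X`. -/
structure IsRepresentation {X : Type*} (δ : Naming X) : Prop where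
  functional : ∀ p x y, δ p x → δ p y → x = y
  surjective : ∀ x, ∃ p, δ p x

/-- `e` codes a realizer of `f`: it takes every name of every `x` to a name of `f x`. -/
def Realizes {X Y : Type*} (δ : Naming X) (δ' : Naming Y) (e : Name) (f : X → Y) : Prop :=
  ∀ q x, δ q x → ∃ r, Applies e q r ∧ δ' r (f x)

/-- `f` is `(δ, δ')`-computable. -/
def ComputableMap {X Y : Type*} (δ : Naming X) (δ' : Naming Y) (f : X → Y) : Prop :=
  ∃ e : Name, Computable e ∧ Realizes δ δ' e f

/-- Equivalence of two namings of the same set: names can be computably translated both ways. -/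
def Equivalent {X : Type*} (δ δ' : Naming X) : Prop :=
  ComputableMap δ δ' id ∧ ComputableMap δ' δ id

/-! ### Basic types -/

/-- The first component of a name of a pair. -/
def fstName (p : Name) : Name := fun k => p (2 * k)

/-- The second component of a name of a pair. -/
def sndName (p : Name) : Name := fun k => p (2 * k + 1)

/-- The `n`-th component of a name of a sequence. -/
def seqName (p : Name) (n : ℕ) : Name := fun k => p (Nat.pair n k)

/-- The product type. -/
def prodNaming {X Y : Type*} (δ : Naming X) (δ' : Naming Y) : Naming (X × Y) :=
  fun p z => δ (fstName p) z.1 ∧ δ' (sndName p) z.2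

/-- The type of natural numbers. -/
def natNaming : Naming ℕ := fun p n => p 0 = n

/-- The non-negative rational number with code `c`. -/
def ratOfCode (c : ℕ) : ℚ := (c.unpair.1 : ℚ) / ((c.unpair.2 : ℚ) + 1)

/-- The type of non-negative real numbers: a name is a sequence of rationals converging fast. -/
def realNaming : Naming ℝ := fun p x => 0 ≤ x ∧ ∀ n, |((ratOfCode (p n) : ℚ) : ℝ) - x| ≤ 2⁻¹ ^ n

/-- The type of non-negative extended reals with the topology of lower convergence: a name lists
non-negative rationals whose supremum is the given number. -/
def lowerRealNaming : Naming ℝ≥0∞ := fun p x =>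
  x = ⨆ n, ENNReal.ofReal ((ratOfCode (p n) : ℚ) : ℝ)

/-- The Sierpinski type: true is eventually confirmed, and otherwise nothing ever happens. -/
def sierpinskiNaming : Naming Prop := fun p b => b ↔ ∃ n, p n ≠ 0

/-- The type of open subsets `U`, identified with their characteristic functions into the
Sierpinski type. -/
def openNaming {X : Type*} [TopologicalSpace X] (δ : Naming X) : Naming (Opens X) :=
  fun p U => Realizes δ sierpinskiNaming p (fun x => x ∈ U)

/-! ### Computable metric spaces -/

/-- The Cauchy representation given by a sequence of points. -/
def cauchyNaming {X : Type*} [MetricSpace X] (ξ : ℕ → X) : Naming X :=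
  fun p x => ∀ n, dist (ξ (p n)) x ≤ 2⁻¹ ^ n

/-- The distance `d(x, A)` from a point to a closed set (infinite for empty `A`) is computable
from below; a closed set is given by a name of its open complement `U`. -/
def LowerDistanceComputable {X : Type*} [MetricSpace X] (δ : Naming X) : Prop :=
  ComputableMap (prodNaming δ (openNaming δ)) lowerRealNaming
    (fun z => Metric.infEDist z.1 ((z.2 : Set X)ᶜ))

/-- `X` carries the Cauchy representation of a dense sequence. -/
def HasCauchyRepresentation {X : Type*} [MetricSpace X] (δ : Naming X) : Prop :=
  ∃ ξ : ℕ → X, DenseRange ξ ∧ Equivalent δ (cauchyNaming ξ)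

/-- A computable metric space: a represented space with a computable metric, for which either the
distance to closed sets is computable from below, or the representation is (up to equivalence)
the Cauchy representation of a dense sequence. -/
structure IsComputableMetricSpace {X : Type*} [MetricSpace X] (δ : Naming X) : Prop where
  isRepresentation : IsRepresentation δ
  dist_computable : ComputableMap (prodNaming δ δ) realNaming (fun z => dist z.1 z.2)
  opens_metric : LowerDistanceComputable δ ∨ HasCauchyRepresentation δ

/-- There is a computable dense sequence of points. -/
def IsEffectivelySeparable {X : Type*} [MetricSpace X] (δ : Naming X) : Prop :=
  ∃ ξ : ℕ → X, DenseRange ξ ∧ ComputableMap natNaming δ ξ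

/-! ### The base space -/

/-- The base space `{0,1}^ω`. -/
abbrev Cantor : Type := ℕ → Bool

/-- The standard (fair coin) probability measure on `{0,1}^ω`. -/
def coin : Measure Cantor :=
  Measure.infinitePi (fun _ : ℕ => (PMF.uniformOfFintype Bool).toMeasure)

instance : IsProbabilityMeasure coin := by
  unfold coin
  infer_instance

/-- A point of `{0,1}^ω` is its own name. -/
def cantorNaming : Naming Cantor := fun p ω => ∀ n, p n = (ω n).toNat

/-! ### Lower-measurable sets -/

/-- Fast monotone lower-Cauchy sequences of open sets. -/
structure LowerSeq where
  set : ℕ → Opens Cantor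
  antitone : Antitone set
  fast : ∀ n m, n < m → coin (set n) ≤ coin (set m) + 2⁻¹ ^ n

namespace LowerSeq

/-- Equivalence of lower-Cauchy sequences. -/
def Equiv (S T : LowerSeq) : Prop :=
  ∀ ε : ℝ≥0∞, 0 < ε → ∃ n, ∀ m ≥ n,
    max (coin (S.set m)) (coin (T.set m)) ≤ coin (S.set m ∩ T.set m) + ε

/-- The intersection of the sets of the sequence. -/
def lim (S : LowerSeq) : Set Cantor := ⋂ n, (S.set n : Set Cantor)

theorem tendsto_pow : Tendsto (fun n : ℕ => (2⁻¹ : ℝ≥0∞) ^ n) atTop (nhds 0) :=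
  ENNReal.tendsto_pow_atTop_nhds_zero_of_lt_one (by simp)

theorem lim_subset (S : LowerSeq) (n : ℕ) : S.lim ⊆ S.set n := Set.iInter_subset _ n

theorem measurableSet_set (S : LowerSeq) (n : ℕ) : MeasurableSet (S.set n : Set Cantor) :=
  (S.set n).isOpen.measurableSet

theorem measurableSet_lim (S : LowerSeq) : MeasurableSet S.lim :=
  MeasurableSet.iInter S.measurableSet_set

theorem coin_lim (S : LowerSeq) : coin S.lim = ⨅ n, coin (S.set n) :=
  Antitone.measure_iInter (fun _ _ h => S.antitone h)
    (fun n => (S.measurableSet_set n).nullMeasurableSet) ⟨0, measure_ne_top _ _⟩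

theorem coin_set_le (S : LowerSeq) (n : ℕ) : coin (S.set n) ≤ coin S.lim + 2⁻¹ ^ n := by
  rw [coin_lim, ENNReal.iInf_add]
  refine le_iInf fun m => ?_
  rcases lt_or_ge n m with h | h
  · exact S.fast n m h
  · exact (measure_mono (S.antitone h)).trans le_self_add

theorem ae_le_of_forall {A B : ℕ → Set Cantor} (hB : Antitone B)
    (h : ∀ ε : ℝ≥0∞, 0 < ε → ∃ n, ∀ m ≥ n, coin (A m \ B m) ≤ ε) :
    coin ((⋂ n, A n) \ ⋂ n, B n) = 0 := by
  rw [Set.sdiff_iInter]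
  refine measure_iUnion_null fun k => ?_
  refine le_antisymm (le_of_forall_pos_le_add fun ε hε => ?_) bot_le
  obtain ⟨n, hn⟩ := h ε hε
  refine (measure_mono ?_).trans ((hn (max n k) (le_max_left _ _)).trans (by simp))
  exact Set.sdiff_subset_sdiff (Set.iInter_subset _ _) (hB (le_max_right _ _))

theorem equiv_iff (S T : LowerSeq) : S.Equiv T ↔ S.lim =ᵐ[coin] T.lim := by
  constructor
  · intro h
    have key : ∀ S T : LowerSeq, S.Equiv T → coin (S.lim \ T.lim) = 0 := by
      intro S T h
      refine ae_le_of_forall (fun _ _ h => T.antitone h) ?_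
      intro ε hε
      obtain ⟨n, hn⟩ := h ε hε
      refine ⟨n, fun m hm => ?_⟩
      have h1 := (le_max_left _ _).trans (hn m hm)
      rw [← measure_inter_add_sdiff (S.set m : Set Cantor) (T.measurableSet_set m)] at h1
      exact (ENNReal.add_le_add_iff_left (measure_ne_top _ _)).1 h1
    have symm : T.Equiv S := by
      intro ε hε
      obtain ⟨n, hn⟩ := h ε hε
      refine ⟨n, fun m hm => ?_⟩
      rw [max_comm, Set.inter_comm]
      exact hn m hm
    exact (ae_le_set.2 (key S T h)).antisymm (ae_le_set.2 (key T S symm))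
  · intro h ε hε
    obtain ⟨n, hn⟩ := (tendsto_pow.eventually (gt_mem_nhds hε)).exists_forall_of_atTop
    refine ⟨n, fun m hm => ?_⟩
    have hS : coin S.lim ≤ coin (S.set m ∩ T.set m) := by
      refine measure_mono_ae ?_
      filter_upwards [h.mem_iff] with ω hω hS
      exact ⟨S.lim_subset m hS, T.lim_subset m (hω.1 hS)⟩
    have hST : coin S.lim = coin T.lim := measure_congr h
    have hm' := (hn m hm).le
    refine max_le ?_ ?_
    · exact (S.coin_set_le m).trans (add_le_add hS hm')
    · exact (T.coin_set_le m).trans (add_le_add (hST ▸ hS) hm')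

instance setoid : Setoid LowerSeq where
  r := Equiv
  iseqv :=
    { refl := fun S => (equiv_iff S S).2 (ae_eq_refl _)
      symm := fun h => (equiv_iff _ _).2 ((equiv_iff _ _).1 h).symm
      trans := fun h h' => (equiv_iff _ _).2 (((equiv_iff _ _).1 h).trans ((equiv_iff _ _).1 h')) }

/-- The lower-measure of the limit. -/
def measure (S : LowerSeq) : ℝ≥0∞ := ⨆ n, (coin (S.set n) - 2⁻¹ ^ n)

theorem measure_eq (S : LowerSeq) : S.measure = coin S.lim := by
  refine le_antisymm (iSup_le fun n => tsub_le_iff_right.2 (S.coin_set_le n)) ?_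
  have h : Tendsto (fun n : ℕ => coin S.lim - (2⁻¹ : ℝ≥0∞) ^ n) atTop (nhds (coin S.lim - 0)) :=
    ENNReal.Tendsto.sub tendsto_const_nhds tendsto_pow (Or.inl (measure_ne_top _ _))
  rw [tsub_zero] at h
  refine le_of_tendsto h (Eventually.of_forall fun n => ?_)
  exact (tsub_le_tsub_right (measure_mono (S.lim_subset n)) _).trans
    (le_iSup (fun n => coin (S.set n) - 2⁻¹ ^ n) n)

theorem fast_of_diff {A B A' B' C D : Set Cantor} (n : ℕ) (hA' : MeasurableSet A')
    (hB' : MeasurableSet B') (hA : A' ⊆ A) (hB : B' ⊆ B)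
    (h1 : coin A ≤ coin A' + 2⁻¹ ^ (n + 1)) (h2 : coin B ≤ coin B' + 2⁻¹ ^ (n + 1))
    (hC : C ⊆ D ∪ ((A \ A') ∪ (B \ B'))) : coin C ≤ coin D + 2⁻¹ ^ n := by
  have e1 : coin (A \ A') ≤ 2⁻¹ ^ (n + 1) := by
    rw [measure_sdiff hA hA'.nullMeasurableSet (measure_ne_top _ _)]
    exact tsub_le_iff_left.2 h1
  have e2 : coin (B \ B') ≤ 2⁻¹ ^ (n + 1) := by
    rw [measure_sdiff hB hB'.nullMeasurableSet (measure_ne_top _ _)]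
    exact tsub_le_iff_left.2 h2
  have e3 : (2⁻¹ : ℝ≥0∞) ^ (n + 1) + 2⁻¹ ^ (n + 1) = 2⁻¹ ^ n := by
    rw [pow_succ, ← mul_add, ENNReal.inv_two_add_inv_two, mul_one]
  calc coin C ≤ coin D + (coin (A \ A') + coin (B \ B')) :=
        (measure_mono hC).trans ((measure_union_le _ _).trans
          (add_le_add le_rfl (measure_union_le _ _)))
    _ ≤ coin D + (2⁻¹ ^ (n + 1) + 2⁻¹ ^ (n + 1)) := by gcongr
    _ = _ := by rw [e3]

/-- Intersection; the index is shifted by one to keep the sequence fast. -/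
def inter (S T : LowerSeq) : LowerSeq where
  set n := S.set (n + 1) ⊓ T.set (n + 1)
  antitone _ _ h := inf_le_inf (S.antitone (by omega)) (T.antitone (by omega))
  fast n m h := by
    refine fast_of_diff n (S.measurableSet_set (m + 1)) (T.measurableSet_set (m + 1))
      (S.antitone (by omega : n + 1 ≤ m + 1)) (T.antitone (by omega : n + 1 ≤ m + 1))
      (S.fast _ _ (by omega)) (T.fast _ _ (by omega)) ?_
    rintro ω ⟨h1, h2⟩
    by_cases h3 : ω ∈ (S.set (m + 1) : Set Cantor)
    · by_cases h4 : ω ∈ (T.set (m + 1) : Set Cantor)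
      · exact Or.inl ⟨h3, h4⟩
      · exact Or.inr (Or.inr ⟨h2, h4⟩)
    · exact Or.inr (Or.inl ⟨h1, h3⟩)

/-- Union; the index is shifted by one to keep the sequence fast. -/
def union (S T : LowerSeq) : LowerSeq where
  set n := S.set (n + 1) ⊔ T.set (n + 1)
  antitone _ _ h := sup_le_sup (S.antitone (by omega)) (T.antitone (by omega))
  fast n m h := by
    refine fast_of_diff n (S.measurableSet_set (m + 1)) (T.measurableSet_set (m + 1))
      (S.antitone (by omega : n + 1 ≤ m + 1)) (T.antitone (by omega : n + 1 ≤ m + 1))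
      (S.fast _ _ (by omega)) (T.fast _ _ (by omega)) ?_
    rintro ω hω
    by_cases h3 : ω ∈ (S.set (m + 1) : Set Cantor)
    · exact Or.inl (Or.inl h3)
    · by_cases h4 : ω ∈ (T.set (m + 1) : Set Cantor)
      · exact Or.inl (Or.inr h4)
      · exact Or.inr (hω.imp (fun h => ⟨h, h3⟩) (fun h => ⟨h, h4⟩))

theorem lim_inter (S T : LowerSeq) : (S.inter T).lim = S.lim ∩ T.lim := by
  ext ω
  constructor
  · intro h
    have h' := fun n => Set.mem_iInter.1 h n
    exact ⟨Set.mem_iInter.2 fun n => S.antitone (Nat.le_succ n) (h' n).1,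
      Set.mem_iInter.2 fun n => T.antitone (Nat.le_succ n) (h' n).2⟩
  · rintro ⟨h1, h2⟩
    exact Set.mem_iInter.2 fun n => ⟨S.lim_subset _ h1, T.lim_subset _ h2⟩

theorem lim_union (S T : LowerSeq) : (S.union T).lim = S.lim ∪ T.lim := by
  ext ω
  constructor
  · intro h
    have h' : ∀ n, ω ∈ S.set (n + 1) ∨ ω ∈ T.set (n + 1) := fun n => Set.mem_iInter.1 h n
    by_contra hc
    simp only [Set.mem_union, not_or, lim, Set.mem_iInter, not_forall] at hc
    obtain ⟨⟨i, hi⟩, ⟨j, hj⟩⟩ := hc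
    rcases h' (max i j) with h1 | h1
    · exact hi (S.antitone (by omega) h1)
    · exact hj (T.antitone (by omega) h1)
  · rintro (h | h)
    · exact Set.mem_iInter.2 fun n => Or.inl (S.lim_subset _ h)
    · exact Set.mem_iInter.2 fun n => Or.inr (T.lim_subset _ h)

/-- An open set as a constant sequence. -/
def ofOpen (U : Opens Cantor) : LowerSeq where
  set _ := U
  antitone _ _ _ := le_rfl
  fast _ _ _ := le_self_add

end LowerSeq

/-- Lower-measurable sets: equivalence classes of fast monotone lower-Cauchy sequences. -/
def LowerMeasurable : Type := Quotient LowerSeq.setoid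

namespace LowerMeasurable

/-- Intersection of lower-measurable sets. -/
def inter : LowerMeasurable → LowerMeasurable → LowerMeasurable :=
  Quotient.map₂ LowerSeq.inter (by
    intro S S' h T T' h'
    refine (LowerSeq.equiv_iff _ _).2 ?_
    rw [LowerSeq.lim_inter, LowerSeq.lim_inter]
    exact ((LowerSeq.equiv_iff _ _).1 h).inter ((LowerSeq.equiv_iff _ _).1 h'))

/-- Union of lower-measurable sets. -/
def union : LowerMeasurable → LowerMeasurable → LowerMeasurable :=
  Quotient.map₂ LowerSeq.union (by
    intro S S' h T T' h'
    refine (LowerSeq.equiv_iff _ _).2 ?_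
    rw [LowerSeq.lim_union, LowerSeq.lim_union]
    exact ((LowerSeq.equiv_iff _ _).1 h).union ((LowerSeq.equiv_iff _ _).1 h'))

/-- The lower-measure of a lower-measurable set. -/
def measure : LowerMeasurable → ℝ≥0∞ :=
  Quotient.lift LowerSeq.measure (by
    intro S T h
    rw [LowerSeq.measure_eq, LowerSeq.measure_eq]
    exact measure_congr ((LowerSeq.equiv_iff _ _).1 h))

/-- Open sets are lower-measurable. -/
def ofOpen (U : Opens Cantor) : LowerMeasurable := Quotient.mk _ (LowerSeq.ofOpen U)

/-- A name of a lower-measurable set lists names of the open sets of a representing sequence. -/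
def naming : Naming LowerMeasurable := fun p W =>
  ∃ S : LowerSeq, Quotient.mk _ S = W ∧ ∀ n, openNaming cantorNaming (seqName p n) (S.set n)

end LowerMeasurable

/-! ### Random variables -/

/-- Random variables with values in `X`: continuous maps (maps with a continuous realizer) from
open subsets of `X` to lower-measurable subsets of `{0,1}^ω` that preserve `∅`, the whole space,
binary intersections and binary unions. -/
structure RandomVariable {X : Type*} [MetricSpace X] (δ : Naming X) where
  preimage : Opens X → LowerMeasurable
  continuous_preimage : ∃ p, Realizes (openNaming δ) LowerMeasurable.naming p preimage
  preimage_empty : preimage ⊥ = LowerMeasurable.ofOpen ⊥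
  preimage_univ : preimage ⊤ = LowerMeasurable.ofOpen ⊤
  preimage_inter : ∀ U V, preimage (U ⊓ V) = (preimage U).inter (preimage V)
  preimage_union : ∀ U V, preimage (U ⊔ V) = (preimage U).union (preimage V)

/-- The representation of random variables by their preimage maps. -/
def preimageNaming {X : Type*} [MetricSpace X] (δ : Naming X) : Naming (RandomVariable δ) :=
  fun p F => Realizes (openNaming δ) LowerMeasurable.naming p F.preimage

/-- Piecewise-continuous random variables: continuous functions on an open set of
probability one. They are continuous random variables if that set is the whole space. -/
structure PiecewiseContinuous (X : Type*) [MetricSpace X] where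
  dom : Opens Cantor
  coin_dom : coin dom = 1
  toFun : dom → X
  continuous_toFun : Continuous toFun

namespace PiecewiseContinuous

variable {X : Type*} [MetricSpace X]

/-- Simple random variables take finitely many values. -/
def IsSimple (F : PiecewiseContinuous X) : Prop := (Set.range F.toFun).Finite

/-- Continuous random variables are defined everywhere. -/
def IsContinuous (F : PiecewiseContinuous X) : Prop := F.dom = ⊤

/-- The preimage of an open set. -/
def preimage (F : PiecewiseContinuous X) (U : Opens X) : Opens Cantor where
  carrier := Subtype.val '' (F.toFun ⁻¹' U)
  is_open' := F.dom.isOpen.isOpenMap_subtype_val _ (U.isOpen.preimage F.continuous_toFun)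

/-- A name of `F` consists of a name of its domain and a realizer on the domain. -/
def naming (δ : Naming X) : Naming (PiecewiseContinuous X) := fun p F =>
  openNaming cantorNaming (fstName p) F.dom ∧
    Realizes (fun q (ω : F.dom) => cantorNaming q ω) δ (sndName p) F.toFun

/-- The Fan metric. -/
def fanDist (F G : PiecewiseContinuous X) : ℝ :=
  sSup {ε : ℝ | 0 < ε ∧ (∃ a : ℚ, (a : ℝ) = ε) ∧ ENNReal.ofReal ε <
    coin {ω | ∃ (h : ω ∈ F.dom) (h' : ω ∈ G.dom), ε < dist (F.toFun ⟨ω, h⟩) (G.toFun ⟨ω, h'⟩)}}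

/-- Fast Cauchy sequences in the Fan metric. -/
def FastCauchy (F : ℕ → PiecewiseContinuous X) : Prop :=
  ∀ m n, fanDist (F m) (F n) < 2⁻¹ ^ min m n

/-- Convergence to a random variable: for every open `U`, the probability that both `F n` and `G`
lie in `U` has lower limit at least the probability that `G` lies in `U`. -/
def ConvergesTo {δ : Naming X} (F : ℕ → PiecewiseContinuous X) (G : RandomVariable δ) : Prop :=
  ∀ U : Opens X, (G.preimage U).measure ≤
    liminf (fun n => ((LowerMeasurable.ofOpen ((F n).preimage U)).inter
      (G.preimage U)).measure) atTop

end PiecewiseContinuous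

/-- The representation of random variables as limits of fast Cauchy sequences of random variables
from a class `C` of piecewise-continuous ones. -/
def limitNaming {X : Type*} [MetricSpace X] (δ : Naming X) (C : Set (PiecewiseContinuous X)) :
    Naming (RandomVariable δ) := fun p G =>
  ∃ F : ℕ → PiecewiseContinuous X, (∀ n, F n ∈ C) ∧ PiecewiseContinuous.FastCauchy F ∧
    PiecewiseContinuous.ConvergesTo F G ∧
    ∀ n, PiecewiseContinuous.naming δ (seqName p n) (F n)

/-- The class of simple continuous random variables. -/
def simpleContinuous (X : Type*) [MetricSpace X] : Set (PiecewiseContinuous X) :=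
  {F | F.IsSimple ∧ F.IsContinuous}

/-- The class of simple piecewise-continuous random variables. -/
def simplePiecewise (X : Type*) [MetricSpace X] : Set (PiecewiseContinuous X) :=
  {F | F.IsSimple}

end TTE

end

/-! Everything effective is reduced to semidecidability. A predicate of a name is `SemiDec` if it
holds exactly when a primitive recursive test accepts some initial word. A machine can search for
solutions of such a relation (`exists_machine`), and parameters can be moved into codes
(`exists_curry`). Application of a code to a name is extended to a relation `App` between partially
known names. It stays semidecidable where the machine diverges, and each of its outputs depends on
finitely many entries.

The last property makes a random variable `G` continuous from below. A point accepted at stage `n`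
for an increasing union of open sets uses a finite part of a suitable name of the union, and that
part continues to a name of a member (`coin_event_iSup_le`). Hence `G` respects countable covers up
to null sets (`event_le_iUnion`).

From approximations to the preimage map (`exists_limit_machine`): by Borel-Cantelli, outside a set
of measure at most `2 * 2⁻¹ ^ n` a fast Cauchy sequence moves by less than `2 * 2⁻¹ ^ m` after any
index `m ≥ n`. For open `U`, the `n`-th open set collects the points at which some `F m` with `m ≥ n
+ 3` is certified to have distance more than `2 * 2⁻¹ ^ m` from the complement of `U`. Both
alternatives in the definition of a computable metric space provide such a certificate
(`exists_inner_test`). These sets decrease fast to the event that the limit lies in `U`, whether the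
limit is a given random variable (`ConvergesTo.isLimitEvent`) or the pointwise limit in a complete
space (`isLimitEvent_tendsto`). The former gives uniqueness of limits and one direction of the
equivalences, the latter the existence of limits.

From the preimage map to approximations (`exists_approximation_machine`): balls of radius `2⁻¹ ^ K`
around a dense sequence cover the space, so some function of finitely many coin tosses selects a
centre whose ball contains `G` with probability above `1 - 2⁻¹ ^ K` (`exists_goodCode`).
Lower-measurable sets are given from outside, but their `n`-th stage exceeds them by at most `2⁻¹ ^
n`. Counting accepted cylinders at a late stage therefore gives finite evidence for this probability
bound (`GoodCode.coin_le`). The machine searches for such evidence, and `convergesTo_of_good` shows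
that the functions found converge fast to `G`. -/

/-! ### Primitive recursive functions in compositional form -/

section PrimrecProp

attribute [fun_prop] Primrec
attribute [fun_prop] Primrec.id Primrec.const Primrec.comp Primrec.fst Primrec.snd Primrec.pair

variable {α β γ : Type*} [Primcodable α] [Primcodable β] [Primcodable γ]

namespace Primrec

@[fun_prop] theorem fst_apply {f : α → β × γ} (hf : Primrec f) : Primrec fun a => (f a).1 :=
  Primrec.fst.comp hf

@[fun_prop] theorem snd_apply {f : α → β × γ} (hf : Primrec f) : Primrec fun a => (f a).2 :=
  Primrec.snd.comp hf

@[fun_prop] theorem add_apply {f g : α → ℕ} (hf : Primrec f) (hg : Primrec g) :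
    Primrec fun a => f a + g a := Primrec.nat_add.comp hf hg

@[fun_prop] theorem mul_apply {f g : α → ℕ} (hf : Primrec f) (hg : Primrec g) :
    Primrec fun a => f a * g a := Primrec.nat_mul.comp hf hg

@[fun_prop] theorem div_apply {f g : α → ℕ} (hf : Primrec f) (hg : Primrec g) :
    Primrec fun a => f a / g a := Primrec.nat_div.comp hf hg

@[fun_prop] theorem mod_apply {f g : α → ℕ} (hf : Primrec f) (hg : Primrec g) :
    Primrec fun a => f a % g a := Primrec.nat_mod.comp hf hg

@[fun_prop] theorem pow_apply {f g : α → ℕ} (hf : Primrec f) (hg : Primrec g) :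
    Primrec fun a => f a ^ g a := (Primrec₂.unpaired'.1 Nat.Primrec.pow).comp hf hg

@[fun_prop] theorem natPair_apply {f g : α → ℕ} (hf : Primrec f) (hg : Primrec g) :
    Primrec fun a => Nat.pair (f a) (g a) := Primrec₂.natPair.comp hf hg

@[fun_prop] theorem unpair_apply {f : α → ℕ} (hf : Primrec f) :
    Primrec fun a => (f a).unpair := Primrec.unpair.comp hf

@[fun_prop] theorem take_apply {f : α → ℕ} {g : α → List β} (hf : Primrec f) (hg : Primrec g) :
    Primrec fun a => (g a).take (f a) := Primrec.list_take.comp hf hg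

@[fun_prop] theorem length_apply {g : α → List β} (hg : Primrec g) :
    Primrec fun a => (g a).length := Primrec.list_length.comp hg

@[fun_prop] theorem getElem?_apply {f : α → ℕ} {g : α → List β} (hf : Primrec f)
    (hg : Primrec g) : Primrec fun a => (g a)[f a]? := Primrec.list_getElem?.comp hg hf

@[fun_prop] theorem getD_apply {f : α → ℕ} {g : α → List β} {d : β} (hf : Primrec f)
    (hg : Primrec g) : Primrec fun a => (g a).getD (f a) d := (Primrec.list_getD d).comp hg hf

@[fun_prop] theorem range_apply {f : α → ℕ} (hf : Primrec f) :
    Primrec fun a => List.range (f a) := Primrec.list_range.comp hf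

@[fun_prop] theorem encode_apply {g : α → β} (hg : Primrec g) :
    Primrec fun a => Encodable.encode (g a) := Primrec.encode.comp hg

@[fun_prop] theorem decode_apply {g : α → ℕ} (hg : Primrec g) :
    Primrec fun a => (Encodable.decode (g a) : Option β) := Primrec.decode.comp hg

@[fun_prop] theorem optionGetD_apply {f : α → Option β} {g : α → β} (hf : Primrec f)
    (hg : Primrec g) : Primrec fun a => (f a).getD (g a) := Primrec.option_getD.comp hf hg

@[fun_prop] theorem some_apply {g : α → β} (hg : Primrec g) :
    Primrec fun a => some (g a) := Primrec.option_some.comp hg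

end Primrec

namespace PrimrecPred

theorem apply {P : β → Prop} (hP : PrimrecPred P) {g : α → β} (hg : Primrec g) :
    PrimrecPred fun a => P (g a) := hP.comp hg

theorem eq_apply {f g : α → β} (hf : Primrec f) (hg : Primrec g) :
    PrimrecPred fun a => f a = g a := Primrec.eq.comp hf hg

theorem lt_apply {f g : α → ℕ} (hf : Primrec f) (hg : Primrec g) :
    PrimrecPred fun a => f a < g a := Primrec.nat_lt.comp hf hg

theorem le_apply {f g : α → ℕ} (hf : Primrec f) (hg : Primrec g) :
    PrimrecPred fun a => f a ≤ g a := Primrec.nat_le.comp hf hg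

theorem exists_lt_apply {P : α × ℕ → Prop} (hP : PrimrecPred P) {g : α → ℕ} (hg : Primrec g) :
    PrimrecPred fun a => ∃ n < g a, P (a, n) := by
  have h : PrimrecRel fun (n : ℕ) (a : α) => P (a, n) :=
    (hP.comp (f := fun x : ℕ × α => (x.2, x.1)) (by fun_prop)).primrecRel
  exact (h.exists_mem_list.comp (f := fun a => List.range (g a)) (g := fun a => a)
    (by fun_prop) (by fun_prop)).of_eq fun a => by simp

theorem forall_lt_apply {P : α × ℕ → Prop} (hP : PrimrecPred P) {g : α → ℕ} (hg : Primrec g) :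
    PrimrecPred fun a => ∀ n < g a, P (a, n) := by
  have h : PrimrecRel fun (n : ℕ) (a : α) => P (a, n) :=
    (hP.comp (f := fun x : ℕ × α => (x.2, x.1)) (by fun_prop)).primrecRel
  exact (h.forall_mem_list.comp (f := fun a => List.range (g a)) (g := fun a => a)
    (by fun_prop) (by fun_prop)).of_eq fun a => by simp

end PrimrecPred

end PrimrecProp

noncomputable section

namespace TTE

/-! ### Initial words -/

/-- The initial word of length `k`. -/
def pre (p : Name) (k : ℕ) : List ℕ := (List.range k).map p

@[simp] theorem length_pre (p : Name) (k : ℕ) : (pre p k).length = k := by simp [pre]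

theorem wordCode_eq (p : Name) (k : ℕ) : wordCode p k = Encodable.encode (pre p k) := rfl

theorem getElem_pre (p : Name) (k i : ℕ) (h : i < (pre p k).length) : (pre p k)[i] = p i := by
  simp [pre]

theorem getElem?_pre (p : Name) (k i : ℕ) : (pre p k)[i]? = if i < k then some (p i) else none := by
  split_ifs with h
  · rw [List.getElem?_eq_getElem (by simpa using h), getElem_pre]
  · simpa using h

theorem getD_pre (p : Name) {k i : ℕ} (h : i < k) : (pre p k).getD i 0 = p i := by
  simp only [List.getD, getElem?_pre, if_pos h, Option.getD_some]

theorem take_pre (p : Name) (j k : ℕ) : (pre p k).take j = pre p (min j k) := by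
  rw [pre, ← List.map_take, List.take_range, pre]

theorem pre_eq_pre {p q : Name} {k : ℕ} : pre p k = pre q k ↔ ∀ i < k, p i = q i := by
  simp [pre]

theorem pre_eq_of_getD {p : Name} {l : List ℕ} (h : ∀ i < l.length, p i = l.getD i 0) :
    pre p l.length = l := by
  refine List.ext_getElem (by simp) fun i h1 h2 => ?_
  rw [getElem_pre, h i h2, List.getD_eq_getElem _ _ h2]

theorem pre_eq_pre_of_le {p q : Name} {j k : ℕ} (h : pre p k = pre q k) (hj : j ≤ k) :
    pre p j = pre q j :=
  pre_eq_pre.2 fun i hi => pre_eq_pre.1 h i (hi.trans_le hj)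

/-! ### Semidecidable predicates of a name -/

variable {α β γ : Type*} [Primcodable α] [Primcodable β] [Primcodable γ]

/-- `P p a` is semidecidable uniformly in the name `p` and the finite datum `a`. -/
def SemiDec (P : Name → α → Prop) : Prop :=
  ∃ R : List ℕ × α → Prop, PrimrecPred R ∧ ∀ p a, P p a ↔ ∃ k, R (pre p k, a)

namespace SemiDec

theorem of_iff {P Q : Name → α → Prop} (h : SemiDec P) (hPQ : ∀ p a, Q p a ↔ P p a) :
    SemiDec Q := by
  have : Q = P := funext fun p => funext fun a => propext (hPQ p a)
  rwa [this]

/-- Testing all prefixes of the word makes acceptance persistent, so that finitely many tests can be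
evaluated on one common word. -/
theorem exists_mono {P : Name → α → Prop} (h : SemiDec P) :
    ∃ R : List ℕ × α → Prop, PrimrecPred R ∧ (∀ p a, P p a ↔ ∃ k, R (pre p k, a)) ∧
      ∀ p a j k, j ≤ k → R (pre p j, a) → R (pre p k, a) := by
  obtain ⟨R, hR, hP⟩ := h
  refine ⟨fun x => ∃ i < x.1.length + 1, R (x.1.take i, x.2),
    PrimrecPred.exists_lt_apply (P := fun y : (List ℕ × α) × ℕ => R (y.1.1.take y.2, y.1.2))
      (hR.apply (by fun_prop)) (by fun_prop), fun p a => ?_, fun p a j k hjk => ?_⟩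
  · rw [hP]
    constructor
    · rintro ⟨k, hk⟩
      exact ⟨k, k, by simp, by simpa [take_pre] using hk⟩
    · rintro ⟨k, i, hi, h⟩
      rw [take_pre] at h
      exact ⟨_, h⟩
  · rintro ⟨i, hi, h⟩
    simp only [length_pre] at hi
    refine ⟨i, by simp only [length_pre]; omega, ?_⟩
    rw [take_pre, min_eq_left (by omega)] at h ⊢
    exact h

theorem of_primrec {P : α → Prop} (h : PrimrecPred P) : SemiDec fun _ a => P a :=
  ⟨fun x => P x.2, h.apply (by fun_prop), by simp⟩

theorem oracle {f g : α → ℕ} (hf : Primrec f) (hg : Primrec g) :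
    SemiDec fun p a => p (f a) = g a := by
  refine ⟨fun x => x.1[f x.2]? = some (g x.2),
    PrimrecPred.eq_apply (by fun_prop) (by fun_prop), fun p a => ⟨fun h => ⟨f a + 1, ?_⟩, ?_⟩⟩
  · simp only [getElem?_pre, if_pos (Nat.lt_succ_self _)]
    exact congrArg some h
  · rintro ⟨k, h⟩
    simp only [getElem?_pre] at h
    split_ifs at h with h'
    simpa using h

theorem comp {P : Name → β → Prop} (h : SemiDec P) {g : α → β} (hg : Primrec g) :
    SemiDec fun p a => P p (g a) := by
  obtain ⟨R, hR, hP⟩ := h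
  exact ⟨fun x => R (x.1, g x.2), hR.apply (by fun_prop), fun p a => hP p (g a)⟩

theorem and {P Q : Name → α → Prop} (hP : SemiDec P) (hQ : SemiDec Q) :
    SemiDec fun p a => P p a ∧ Q p a := by
  obtain ⟨R, hR, hP, mR⟩ := hP.exists_mono
  obtain ⟨S, hS, hQ, mS⟩ := hQ.exists_mono
  refine ⟨fun x => R x ∧ S x, hR.and hS, fun p a => ?_⟩
  simp only [hP, hQ]
  constructor
  · rintro ⟨⟨j, hj⟩, ⟨k, hk⟩⟩
    exact ⟨max j k, mR _ _ _ _ (le_max_left _ _) hj, mS _ _ _ _ (le_max_right _ _) hk⟩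
  · rintro ⟨k, h1, h2⟩
    exact ⟨⟨k, h1⟩, ⟨k, h2⟩⟩

theorem or {P Q : Name → α → Prop} (hP : SemiDec P) (hQ : SemiDec Q) :
    SemiDec fun p a => P p a ∨ Q p a := by
  obtain ⟨R, hR, hP⟩ := hP
  obtain ⟨S, hS, hQ⟩ := hQ
  refine ⟨fun x => R x ∨ S x, hR.or hS, fun p a => ?_⟩
  simp only [hP, hQ, exists_or]

theorem exists_nat {P : Name → α → ℕ → Prop} (hP : SemiDec fun p (x : α × ℕ) => P p x.1 x.2) :
    SemiDec fun p a => ∃ n, P p a n := by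
  obtain ⟨R, hR, hP, mR⟩ := hP.exists_mono
  refine ⟨fun x => ∃ n < x.1.length + 1, R (x.1, (x.2, n)),
    PrimrecPred.exists_lt_apply (P := fun y : (List ℕ × α) × ℕ => R (y.1.1, (y.1.2, y.2)))
      (hR.apply (by fun_prop)) (by fun_prop), fun p a => ?_⟩
  constructor
  · rintro ⟨n, h⟩
    obtain ⟨k, hk⟩ := (hP p (a, n)).1 h
    exact ⟨max n k, n, by simp only [length_pre]; omega, mR _ _ _ _ (le_max_right _ _) hk⟩
  · rintro ⟨k, n, -, h⟩
    exact ⟨n, (hP p (a, n)).2 ⟨k, h⟩⟩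

theorem exists_decode {P : Name → α × β → Prop} (hP : SemiDec P) :
    SemiDec fun p (x : α × ℕ) => ∃ b : β, Encodable.decode x.2 = some b ∧ P p (x.1, b) := by
  obtain ⟨R, hR, hP⟩ := hP
  refine ⟨fun x => ∃ b : β, Encodable.decode x.2.2 = some b ∧ R (x.1, (x.2.1, b)), ?_,
    fun p a => ?_⟩
  · obtain ⟨_, hR'⟩ := hR
    refine Primrec.primrecPred (p := fun x : List ℕ × α × ℕ =>
      ((Encodable.decode x.2.2 : Option β).map
        fun b => decide (R (x.1, (x.2.1, b)))).getD false = true) ?_ |>.of_eq ?_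
    · simp only [Bool.decide_eq_true]
      exact Primrec.option_getD.comp (Primrec.option_map (by fun_prop)
        (hR'.comp (f := fun a => decide (R a))
          (g := fun y : (List ℕ × α × ℕ) × β => (y.1.1, (y.1.2.1, y.2))) (by fun_prop)))
        (Primrec.const _)
    · intro x
      cases (Encodable.decode x.2.2 : Option β) <;> simp
  · simp only [hP]
    exact ⟨fun ⟨b, h, k, hk⟩ => ⟨k, b, h, hk⟩, fun ⟨k, b, h, hk⟩ => ⟨b, h, k, hk⟩⟩

theorem ex {P : Name → α → β → Prop} (hP : SemiDec fun p (x : α × β) => P p x.1 x.2) :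
    SemiDec fun p a => ∃ b, P p a b := by
  refine (exists_nat (P := fun p a n => ∃ b : β, Encodable.decode n = some b ∧ P p a b)
    hP.exists_decode).of_iff fun p a => ⟨fun ⟨b, h⟩ => ⟨Encodable.encode b, b, by simp, h⟩,
      fun ⟨_, b, _, h⟩ => ⟨b, h⟩⟩

theorem forall_lt {P : Name → α → ℕ → Prop} (hP : SemiDec fun p (x : α × ℕ) => P p x.1 x.2)
    {g : α → ℕ} (hg : Primrec g) : SemiDec fun p a => ∀ n < g a, P p a n := by
  obtain ⟨R, hR, hP, mR⟩ := hP.exists_mono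
  refine ⟨fun x => ∀ n < g x.2, R (x.1, (x.2, n)),
    PrimrecPred.forall_lt_apply (P := fun y : (List ℕ × α) × ℕ => R (y.1.1, (y.1.2, y.2)))
      (hR.apply (by fun_prop)) (by fun_prop), fun p a => ?_⟩
  constructor
  · intro h
    have h' : ∀ n, ∃ k, n < g a → R (pre p k, (a, n)) := fun n => by
      by_cases hn : n < g a
      · obtain ⟨k, hk⟩ := (hP p (a, n)).1 (h n hn)
        exact ⟨k, fun _ => hk⟩
      · exact ⟨0, fun h => absurd h hn⟩
    choose k hk using h'
    refine ⟨(Finset.range (g a)).sup k, fun n hn => mR _ _ _ _ ?_ (hk n hn)⟩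
    exact Finset.le_sup (f := k) (Finset.mem_range.2 hn)
  · rintro ⟨k, h⟩ n hn
    exact (hP p (a, n)).2 ⟨k, h n hn⟩

/-- Replacing the oracle by a total functional with semidecidable graph. -/
theorem subst {P : Name → α → Prop} (hP : SemiDec P) {H : Name → α → Name}
    (hH : SemiDec fun p (x : α × ℕ × ℕ) => H p x.1 x.2.1 = x.2.2) :
    SemiDec fun p a => P (H p a) a := by
  obtain ⟨R, hR, hP⟩ := hP
  -- Only a finite part `l` of the oracle `H p a` is inspected; it is guessed, and its entries are
  -- checked against the graph of `H`.
  have h : SemiDec fun p a => ∃ l : List ℕ, (∀ i < l.length, H p a i = l.getD i 0) ∧ R (l, a) :=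
    ex (((hH.comp (g := fun y : (α × List ℕ) × ℕ => (y.1.1, y.2, y.1.2.getD y.2 0))
      (by fun_prop)).forall_lt (P := fun p (x : α × List ℕ) i => H p x.1 i = x.2.getD i 0)
        (by fun_prop)).and (of_primrec (hR.apply (by fun_prop))))
  refine h.of_iff fun p a => (hP _ _).trans ?_
  constructor
  · rintro ⟨k, hk⟩
    exact ⟨pre (H p a) k, fun i hi => (getD_pre _ (by simpa using hi)).symm, hk⟩
  · rintro ⟨l, h1, h2⟩
    exact ⟨l.length, by rwa [pre_eq_of_getD h1]⟩

/-- Bounded evaluation `evaln` of a code is primitive recursive, and the number of steps is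
quantified existentially. -/
theorem graph_of_computable {f : α → β} (hf : Computable f) :
    SemiDec fun _ (x : α × β) => f x.1 = x.2 := by
  obtain ⟨c, hc⟩ := Nat.Partrec.Code.exists_code.1 hf
  have hc' : ∀ a, c.eval (Encodable.encode a) = Part.some (Encodable.encode (f a)) := by
    intro a; simp [hc]
  refine (exists_nat (P := fun _ (x : α × β) k => Nat.Partrec.Code.evaln k c
    (Encodable.encode x.1) = some (Encodable.encode x.2)) (of_primrec ?_)).of_iff ?_
  · refine PrimrecPred.eq_apply (Nat.Partrec.Code.primrec_evaln.comp
      (g := fun y : (α × β) × ℕ => ((y.2, c), Encodable.encode y.1.1)) (by fun_prop)) (by fun_prop)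
  · rintro - ⟨a, b⟩
    have := @Nat.Partrec.Code.evaln_complete c (Encodable.encode a) (Encodable.encode b)
    rw [hc', Part.mem_some_iff] at this
    simp only [Option.mem_def] at this
    rw [← this]
    exact ⟨fun h => by rw [h], fun h => (Encodable.encode_injective h).symm⟩

end SemiDec

/-! ### Searching machines -/

/-- The least `v` not exceeding the length of `l` such that `R` holds of some prefix of `l` and
`(a, v)`, increased by one; zero if there is none. -/
def search (R : List ℕ × α × ℕ → Prop) (l : List ℕ) (a : α) : ℕ :=
  open Classical in
  let i := (List.range (l.length + 1)).findIdx fun v =>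
    decide (∃ k < l.length + 1, R (l.take k, (a, v)))
  if i < l.length + 1 then i + 1 else 0

theorem primrec_search {R : List ℕ × α × ℕ → Prop} (hR : PrimrecPred R) :
    Primrec fun x : List ℕ × α => search R x.1 x.2 := by
  classical
  have h1 : PrimrecPred fun x : (List ℕ × α) × ℕ =>
      ∃ k < x.1.1.length + 1, R (x.1.1.take k, (x.1.2, x.2)) :=
    PrimrecPred.exists_lt_apply
      (P := fun y : ((List ℕ × α) × ℕ) × ℕ => R (y.1.1.1.take y.2, (y.1.1.2, y.1.2)))
      (hR.apply (by fun_prop)) (by fun_prop)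
  have h2 : Primrec fun x : List ℕ × α => (List.range (x.1.length + 1)).findIdx fun v =>
      decide (∃ k < x.1.length + 1, R (x.1.take k, (x.2, v))) := by
    refine Primrec.list_findIdx (by fun_prop) ?_
    exact primrecPred_iff_primrec_decide.1 h1
  exact Primrec.ite (PrimrecPred.lt_apply h2 (by fun_prop)) (Primrec.succ.comp h2)
    (Primrec.const 0)

theorem search_eq_succ {τ : Type*} {R : List ℕ × τ × ℕ → Prop} {l : List ℕ} {a : τ} {v : ℕ}
    (h : search R l a = v + 1) : ∃ k < l.length + 1, R (l.take k, (a, v)) := by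
  unfold search at h
  simp only at h
  split_ifs at h with h'
  have := List.findIdx_getElem (xs := List.range (l.length + 1)) (w := by
    rwa [List.length_range])
  simp only [List.getElem_range, decide_eq_true_eq] at this
  rwa [Nat.succ.inj h] at this

theorem search_ne_zero {τ : Type*} {R : List ℕ × τ × ℕ → Prop} {l : List ℕ} {a : τ} {v : ℕ}
    (hv : v < l.length + 1) (h : ∃ k < l.length + 1, R (l.take k, (a, v))) :
    search R l a ≠ 0 := by
  unfold search
  simp only
  rw [if_pos]
  · simp
  · have := List.findIdx_lt_length_of_exists (xs := List.range (l.length + 1))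
      (p := fun v => by classical exact decide (∃ k < l.length + 1, R (l.take k, (a, v))))
      ⟨v, by simpa using hv, by simpa using h⟩
    simpa using this

theorem exists_applies {e q : Name} (h : ∀ n, ∃ k, e (Nat.pair n (wordCode q k)) ≠ 0) :
    ∃ r, Applies e q r ∧ ∀ n, ∃ k, e (Nat.pair n (wordCode q k)) = r n + 1 := by
  classical
  have h' : ∀ n, e (Nat.pair n (wordCode q (Nat.find (h n)))) =
      e (Nat.pair n (wordCode q (Nat.find (h n)))) - 1 + 1 := fun n => by
    have := Nat.find_spec (h n); omega
  refine ⟨fun n => e (Nat.pair n (wordCode q (Nat.find (h n)))) - 1,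
    fun n => ⟨_, h' n, fun j hj => ?_⟩, fun n => ⟨_, h' n⟩⟩
  simpa using Nat.find_min (h n) hj

theorem Applies.unique {e q r r' : Name} (h : Applies e q r) (h' : Applies e q r') : r = r' := by
  funext n
  obtain ⟨k, hk, hk'⟩ := h n
  obtain ⟨j, hj, hj'⟩ := h' n
  rcases lt_trichotomy j k with hjk | rfl | hjk
  · rw [hk' j hjk] at hj; omega
  · omega
  · rw [hj' k hjk] at hk; omega

/-- A semidecidable relation with a solution has one that a machine finds. -/
theorem exists_machine {R : Name → ℕ × ℕ → Prop} (hR : SemiDec R) :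
    ∃ e : Name, Computable e ∧ ∀ p, (∀ n, ∃ a, R p (n, a)) →
      ∃ r, Applies e p r ∧ ∀ n, R p (n, r n) := by
  obtain ⟨S, hS, hR⟩ := hR
  refine ⟨fun x => search S ((Encodable.decode x.unpair.2).getD []) x.unpair.1,
    ((primrec_search hS).comp (g := fun x : ℕ =>
      ((Encodable.decode x.unpair.2).getD [], x.unpair.1)) (by fun_prop)).to_comp,
    fun p hp => ?_⟩
  obtain ⟨r, h1, h2⟩ := exists_applies (q := p)
    (e := fun x => search S ((Encodable.decode x.unpair.2).getD []) x.unpair.1) fun n => by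
      obtain ⟨a, ha⟩ := hp n
      obtain ⟨k, hk⟩ := (hR _ _).1 ha
      -- The word must contain the accepting prefix of length `k` and also be long enough for the
      -- candidate `a` to be in the range of the search.
      refine ⟨max a k, ?_⟩
      simp only [Nat.unpair_pair, wordCode_eq, Encodable.encodek, Option.getD_some]
      refine search_ne_zero (v := a) (by simp only [length_pre]; omega)
        ⟨k, by simp only [length_pre]; omega, ?_⟩
      rwa [take_pre, min_eq_left (le_max_right _ _)]
  refine ⟨r, h1, fun n => ?_⟩
  obtain ⟨k, hk⟩ := h2 n
  simp only [Nat.unpair_pair, wordCode_eq, Encodable.encodek, Option.getD_some] at hk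
  obtain ⟨j, -, hj⟩ := search_eq_succ hk
  rw [take_pre] at hj
  exact (hR _ _).2 ⟨_, hj⟩

theorem exists_machine_of_total {H : Name → Name}
    (hH : SemiDec fun p (x : ℕ × ℕ) => H p x.1 = x.2) :
    ∃ e : Name, Computable e ∧ ∀ p, Applies e p (H p) := by
  obtain ⟨e, he, h⟩ := exists_machine hH
  refine ⟨e, he, fun p => ?_⟩
  obtain ⟨r, h1, h2⟩ := h p fun n => ⟨_, rfl⟩
  rwa [← (funext h2 : H p = r)] at h1

/-! ### Pairing and currying -/

/-- The name of a pair. -/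
def joinName (p q : Name) : Name := fun n => if n % 2 = 0 then p (n / 2) else q (n / 2)

@[simp] theorem fstName_join (p q : Name) : fstName (joinName p q) = p := by
  funext k
  simp [fstName, joinName]

@[simp] theorem sndName_join (p q : Name) : sndName (joinName p q) = q := by
  funext k
  have h1 : (2 * k + 1) % 2 = 1 := by omega
  have h2 : (2 * k + 1) / 2 = k := by omega
  simp [sndName, joinName, h1, h2]

theorem SemiDec.fst {P : Name → α → Prop} (h : SemiDec P) : SemiDec fun p a => P (fstName p) a :=
  h.subst (H := fun p _ => fstName p)
    (oracle (f := fun x : α × ℕ × ℕ => 2 * x.2.1) (by fun_prop) (by fun_prop))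

theorem SemiDec.snd {P : Name → α → Prop} (h : SemiDec P) : SemiDec fun p a => P (sndName p) a :=
  h.subst (H := fun p _ => sndName p)
    (oracle (f := fun x : α × ℕ × ℕ => 2 * x.2.1 + 1) (by fun_prop) (by fun_prop))

/-- An s-m-n theorem for names. On a word `w` of the future input `u`, the code searches for the
output using the initial word of length `w.length` of the joined name. That word reads no entry of
`u` beyond `w`, so the padding by `0` is harmless. -/
theorem exists_curry {K : Name → α → Name}
    (hK : SemiDec fun p (x : α × ℕ × ℕ) => K p x.1 x.2.1 = x.2.2) :
    ∃ H : Name → α → Name, (SemiDec fun p (x : α × ℕ × ℕ) => H p x.1 x.2.1 = x.2.2) ∧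
      ∀ p a u, Applies (H p a) u (K (joinName p u) a) := by
  obtain ⟨R, hR, hK⟩ := hK
  let R' : List ℕ × (α × ℕ) × ℕ → Prop := fun x => R (x.1, (x.2.1.1, x.2.1.2, x.2.2))
  have hR' : PrimrecPred R' := hR.apply (by fun_prop)
  let w : ℕ → List ℕ := fun m => (Encodable.decode m.unpair.2).getD []
  have hw : Primrec w := by fun_prop
  let H : Name → α → Name := fun p a m =>
    search R' (pre (joinName p fun i => (w m).getD i 0) (w m).length) (a, m.unpair.1)
  refine ⟨H, ?_, fun p a u => ?_⟩
  · have key : SemiDec fun p (x : α × ℕ × ℕ) => ∃ l : List ℕ,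
        ((l.length = (w x.2.1).length ∧ search R' l (x.1, x.2.1.unpair.1) = x.2.2) ∧
        ∀ i < l.length, (i % 2 = 0 ∧ p (i / 2) = l.getD i 0) ∨
          (i % 2 = 1 ∧ (w x.2.1).getD (i / 2) 0 = l.getD i 0)) := by
      refine SemiDec.ex (SemiDec.and (SemiDec.of_primrec ?_) (SemiDec.forall_lt
        (P := fun p (y : (α × ℕ × ℕ) × List ℕ) i =>
          (i % 2 = 0 ∧ p (i / 2) = y.2.getD i 0) ∨
          (i % 2 = 1 ∧ (w y.1.2.1).getD (i / 2) 0 = y.2.getD i 0))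
        (SemiDec.or (SemiDec.and (SemiDec.of_primrec ?_) (SemiDec.oracle ?_ ?_))
          (SemiDec.of_primrec (PrimrecPred.and ?_ ?_))) (by fun_prop)))
      · exact (PrimrecPred.eq_apply (by fun_prop) (by fun_prop)).and
          (PrimrecPred.eq_apply ((primrec_search hR').comp
            (g := fun y : (α × ℕ × ℕ) × List ℕ => (y.2, (y.1.1, y.1.2.1.unpair.1)))
            (by fun_prop)) (by fun_prop))
      · exact PrimrecPred.eq_apply (by fun_prop) (by fun_prop)
      · fun_prop
      · fun_prop
      · exact PrimrecPred.eq_apply (by fun_prop) (by fun_prop)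
      · exact PrimrecPred.eq_apply (by fun_prop) (by fun_prop)
    refine key.of_iff fun p ⟨a, m, v⟩ => ?_
    have hjoin : ∀ i c, (joinName p (fun i => (w m).getD i 0) i = c ↔
        ((i % 2 = 0 ∧ p (i / 2) = c) ∨ (i % 2 = 1 ∧ (w m).getD (i / 2) 0 = c))) := by
      intro i c
      rcases Nat.mod_two_eq_zero_or_one i with h | h <;> simp [joinName, h]
    simp only [← hjoin]
    constructor
    · intro h
      refine ⟨pre (joinName p fun i => (w m).getD i 0) (w m).length, ⟨by simp, h⟩, fun i hi => ?_⟩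
      rw [getD_pre _ (by simpa using hi)]
    · rintro ⟨l, ⟨h1, h2⟩, h3⟩
      have := pre_eq_of_getD h3
      simp only [H]
      rw [← h1, this, h2]
  · have hpre : ∀ k, pre (joinName p fun i => (pre u k).getD i 0) k = pre (joinName p u) k := by
      intro k
      refine pre_eq_pre.2 fun i hi => ?_
      simp only [joinName]
      split_ifs with h
      · rfl
      · exact getD_pre _ (by omega)
    have hH : ∀ n k, H p a (Nat.pair n (wordCode u k)) =
        search R' (pre (joinName p u) k) (a, n) := by
      intro n k
      simp only [H, w, Nat.unpair_pair, wordCode_eq, Encodable.encodek, Option.getD_some,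
        length_pre, hpre]
    obtain ⟨r, h1, h2⟩ := exists_applies (e := H p a) (q := u) fun n => by
      obtain ⟨k, hk⟩ := (hK (joinName p u) (a, n, K (joinName p u) a n)).1 rfl
      refine ⟨max (K (joinName p u) a n) k, ?_⟩
      rw [hH]
      refine search_ne_zero (v := K (joinName p u) a n) (by simp only [length_pre]; omega)
        ⟨k, by simp only [length_pre]; omega, ?_⟩
      rw [take_pre, min_eq_left (le_max_right _ _)]
      exact hk
    have : K (joinName p u) a = r := by
      funext n
      obtain ⟨k, hk⟩ := h2 n
      rw [hH] at hk
      obtain ⟨j, -, hj⟩ := search_eq_succ hk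
      rw [take_pre] at hj
      exact (hK _ (a, n, r n)).2 ⟨_, hj⟩
    rwa [this]

/-- A semidecidable predicate has a realizer into the Sierpinski type. -/
theorem exists_sierpinski {P : Name → α → Prop} (hP : SemiDec P) :
    ∃ H : Name → α → Name, (SemiDec fun p (x : α × ℕ × ℕ) => H p x.1 x.2.1 = x.2.2) ∧
      ∀ p a u, ∃ r, Applies (H p a) u r ∧ ((∃ n, r n ≠ 0) ↔ P (joinName p u) a) := by
  classical
  obtain ⟨R, hR, hP⟩ := hP
  let K : Name → α → Name := fun p a n => if R (pre p n, a) then 1 else 0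
  have hK : SemiDec fun p (x : α × ℕ × ℕ) => K p x.1 x.2.1 = x.2.2 := by
    have hF : Primrec fun x : List ℕ × α => if R x then 1 else 0 :=
      Primrec.ite hR (Primrec.const 1) (Primrec.const 0)
    have key : SemiDec fun p (x : α × ℕ × ℕ) => ∃ l : List ℕ,
        (l.length = x.2.1 ∧ (if R (l, x.1) then 1 else 0) = x.2.2) ∧
        ∀ i < l.length, p i = l.getD i 0 := by
      refine SemiDec.ex (SemiDec.and (SemiDec.of_primrec (PrimrecPred.and
        (PrimrecPred.eq_apply (by fun_prop) (by fun_prop)) (PrimrecPred.eq_apply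
          (hF.comp (g := fun y : (α × ℕ × ℕ) × List ℕ => (y.2, y.1.1)) (by fun_prop))
          (by fun_prop)))) (SemiDec.forall_lt
        (P := fun p (y : (α × ℕ × ℕ) × List ℕ) i => p i = y.2.getD i 0)
          (SemiDec.oracle (by fun_prop) (by fun_prop)) (by fun_prop)))
    refine key.of_iff fun p ⟨a, m, v⟩ => ⟨fun h => ⟨pre p m, ⟨by simp, h⟩, fun i hi => ?_⟩, ?_⟩
    · exact (getD_pre _ (by simpa using hi)).symm
    · rintro ⟨l, ⟨h1, h2⟩, h3⟩
      simp only at h1 h2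
      simp only [K]
      rw [← h1, pre_eq_of_getD h3, h2]
  obtain ⟨H, hH, happ⟩ := exists_curry hK
  refine ⟨H, hH, fun p a u => ⟨_, happ p a u, ?_⟩⟩
  rw [hP]
  simp [K]

/-! ### Partial names -/

/-- `Fits Q w`: the word `w` consists of values of the relation `Q`. -/
def Fits (Q : ℕ → ℕ → Prop) (w : List ℕ) : Prop := ∀ j < w.length, Q j (w.getD j 0)

/-- `Outs E w n c`: the function coded by `E` outputs `c` at `n` after reading part of `w`. -/
def Outs (E : ℕ → ℕ → Prop) (w : List ℕ) (n c : ℕ) : Prop :=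
  ∃ k < w.length + 1, E (Nat.pair n (Encodable.encode (w.take k))) (c + 1) ∧
    ∀ j < k, E (Nat.pair n (Encodable.encode (w.take j))) 0

/-- The application of a partially known code to a partially known name. -/
def App (E Q : ℕ → ℕ → Prop) (n c : ℕ) : Prop := ∃ w, Fits Q w ∧ Outs E w n c

/-- The graph of a name. -/
def graph (p : Name) : ℕ → ℕ → Prop := fun n c => p n = c

theorem fits_graph {q : Name} {w : List ℕ} : Fits (graph q) w ↔ pre q w.length = w := by
  refine ⟨pre_eq_of_getD, fun h j hj => ?_⟩
  rw [← h, getD_pre _ hj, graph]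

theorem outs_pre {e q r : Name} (h : Applies e q r) {k n c : ℕ}
    (ho : Outs (graph e) (pre q k) n c) : r n = c := by
  obtain ⟨i, hi, h1, h2⟩ := ho
  simp only [length_pre] at hi
  obtain ⟨j, h3, h4⟩ := h n
  simp only [graph, take_pre] at h1 h2
  rw [min_eq_left (by omega)] at h1
  rcases lt_trichotomy i j with hij | rfl | hij
  · have := h4 i hij
    rw [wordCode_eq, h1] at this; omega
  · rw [wordCode_eq, h1] at h3; omega
  · have := h2 j hij
    rw [min_eq_left (by omega), ← wordCode_eq, h3] at this; omega

/-- The words fitting a graph are the initial words of the name, so relational application agrees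
with `Applies` wherever the latter is defined. Predicates can thus be shown semidecidable through
`App` before convergence is known. -/
theorem app_graph {e q r : Name} (h : Applies e q r) : App (graph e) (graph q) = graph r := by
  funext n c
  refine propext ⟨?_, ?_⟩
  · rintro ⟨w, hw, ho⟩
    rw [← fits_graph.1 hw] at ho
    exact outs_pre h ho
  · rintro rfl
    obtain ⟨k, h1, h2⟩ := h n
    refine ⟨pre q k, fits_graph.2 (by simp), k, by simp, ?_, fun j hj => ?_⟩
    · simpa [graph, take_pre, wordCode_eq] using h1
    · simpa [graph, take_pre, wordCode_eq, min_eq_left hj.le] using h2 j hj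

theorem app_iff {E : ℕ → ℕ → Prop} {q : Name} {n c : ℕ} :
    App E (graph q) n c ↔ ∃ k, Outs E (pre q k) n c := by
  constructor
  · rintro ⟨w, hw, ho⟩
    rw [← fits_graph.1 hw] at ho
    exact ⟨_, ho⟩
  · rintro ⟨k, h⟩
    exact ⟨pre q k, fits_graph.2 (by simp), h⟩

theorem Outs.mono {E E' : ℕ → ℕ → Prop} (h : ∀ i v, E i v → E' i v) {w : List ℕ} {n c : ℕ} :
    Outs E w n c → Outs E' w n c :=
  fun ⟨k, hk, h1, h2⟩ => ⟨k, hk, h _ _ h1, fun j hj => h _ _ (h2 j hj)⟩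

theorem App.mono {E E' Q Q' : ℕ → ℕ → Prop} (h : ∀ i v, E i v → E' i v)
    (h' : ∀ i v, Q i v → Q' i v) {n c : ℕ} : App E Q n c → App E' Q' n c :=
  fun ⟨w, hw, ho⟩ => ⟨w, fun j hj => h' _ _ (hw j hj), ho.mono h⟩

/-- Finitely many instances of an increasing family of relations hold simultaneously. -/
theorem exists_forall_lt_of_mono {P : ℕ → ℕ → Prop} (hP : ∀ j k n, j ≤ k → P j n → P k n) {N : ℕ}
    (h : ∀ n < N, ∃ k, P k n) : ∃ k, ∀ n < N, P k n := by
  choose! k hk using h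
  exact ⟨(Finset.range N).sup k, fun n hn =>
    hP _ _ _ (Finset.le_sup (f := k) (Finset.mem_range.2 hn)) (hk n hn)⟩

/-- Compactness: a single output uses only finitely many entries of the code and of the input. -/
theorem App.exists_of_iUnion {E Q : ℕ → ℕ → ℕ → Prop}
    (hE : ∀ j k i v, j ≤ k → E j i v → E k i v) (hQ : ∀ j k i v, j ≤ k → Q j i v → Q k i v)
    {n c : ℕ} (h : App (fun i v => ∃ k, E k i v) (fun i v => ∃ k, Q k i v) n c) :
    ∃ k, App (E k) (Q k) n c := by
  obtain ⟨w, hw, i, hi, ⟨k1, h1⟩, h2⟩ := h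
  obtain ⟨k2, h2⟩ := exists_forall_lt_of_mono
    (P := fun k j => E k (Nat.pair n (Encodable.encode (w.take j))) 0)
    (fun _ _ _ h => hE _ _ _ _ h) h2
  obtain ⟨k3, h3⟩ := exists_forall_lt_of_mono
    (P := fun k j => Q k j (w.getD j 0)) (fun _ _ _ h => hQ _ _ _ _ h) hw
  refine ⟨max k1 (max k2 k3), w, fun j hj => hQ _ _ _ _ (by omega) (h3 j hj), i, hi,
    hE _ _ _ _ (by omega) h1, fun j hj => hE _ _ _ _ (by omega) (h2 j hj)⟩

/-- The relation given by a finite word. -/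
def wordRel (w : List ℕ) : ℕ → ℕ → Prop := fun j c => w[j]? = some c

theorem wordRel_pre {q : Name} {k j c : ℕ} : wordRel (pre q k) j c ↔ j < k ∧ q j = c := by
  simp only [wordRel, getElem?_pre]
  split_ifs with h <;> simp [h]

theorem graph_eq_iUnion_pre (q : Name) : graph q = fun j c => ∃ k, wordRel (pre q k) j c := by
  funext j c
  simp only [wordRel_pre, graph, eq_iff_iff]
  exact ⟨fun h => ⟨j + 1, by omega, h⟩, fun ⟨_, _, h⟩ => h⟩

theorem wordRel_pre_mono {q : Name} {j k i v : ℕ} (h : j ≤ k) :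
    wordRel (pre q j) i v → wordRel (pre q k) i v := by
  rw [wordRel_pre, wordRel_pre]
  exact fun ⟨h1, h2⟩ => ⟨by omega, h2⟩

/-- The relation given by a pair. -/
def joinRel (P Q : ℕ → ℕ → Prop) : ℕ → ℕ → Prop := fun n c =>
  (n % 2 = 0 ∧ P (n / 2) c) ∨ (n % 2 = 1 ∧ Q (n / 2) c)

theorem joinRel_graph (p q : Name) : joinRel (graph p) (graph q) = graph (joinName p q) := by
  funext n c
  rcases Nat.mod_two_eq_zero_or_one n with h | h <;> simp [joinRel, joinName, graph, h]

namespace SemiDec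

theorem app {E Q : Name → α → ℕ → ℕ → Prop}
    (hE : SemiDec fun p (x : α × ℕ × ℕ) => E p x.1 x.2.1 x.2.2)
    (hQ : SemiDec fun p (x : α × ℕ × ℕ) => Q p x.1 x.2.1 x.2.2) :
    SemiDec fun p (x : α × ℕ × ℕ) => App (E p x.1) (Q p x.1) x.2.1 x.2.2 := by
  refine ex (and (forall_lt (P := fun p (y : (α × ℕ × ℕ) × List ℕ) j =>
      Q p y.1.1 j (y.2.getD j 0))
    (hQ.comp (g := fun z : ((α × ℕ × ℕ) × List ℕ) × ℕ => (z.1.1.1, z.2, z.1.2.getD z.2 0))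
      (by fun_prop)) (by fun_prop)) (exists_nat (P := fun p (y : (α × ℕ × ℕ) × List ℕ) k =>
    k < y.2.length + 1 ∧ E p y.1.1 (Nat.pair y.1.2.1 (Encodable.encode (y.2.take k)))
      (y.1.2.2 + 1) ∧ ∀ j < k, E p y.1.1 (Nat.pair y.1.2.1 (Encodable.encode (y.2.take j))) 0)
    (and (of_primrec (PrimrecPred.lt_apply (by fun_prop) (by fun_prop))) (and ?_ ?_))))
  · exact hE.comp (g := fun z : ((α × ℕ × ℕ) × List ℕ) × ℕ =>
      (z.1.1.1, Nat.pair z.1.1.2.1 (Encodable.encode (z.1.2.take z.2)), z.1.1.2.2 + 1))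
      (by fun_prop)
  · exact forall_lt (P := fun p (z : ((α × ℕ × ℕ) × List ℕ) × ℕ) j =>
      E p z.1.1.1 (Nat.pair z.1.1.2.1 (Encodable.encode (z.1.2.take j))) 0)
      (hE.comp (g := fun t : (((α × ℕ × ℕ) × List ℕ) × ℕ) × ℕ =>
        (t.1.1.1.1, Nat.pair t.1.1.1.2.1 (Encodable.encode (t.1.1.2.take t.2)), 0))
        (by fun_prop)) (by fun_prop)

theorem join {P Q : Name → α → ℕ → ℕ → Prop}
    (hP : SemiDec fun p (x : α × ℕ × ℕ) => P p x.1 x.2.1 x.2.2)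
    (hQ : SemiDec fun p (x : α × ℕ × ℕ) => Q p x.1 x.2.1 x.2.2) :
    SemiDec fun p (x : α × ℕ × ℕ) => joinRel (P p x.1) (Q p x.1) x.2.1 x.2.2 :=
  or (and (of_primrec (PrimrecPred.eq_apply (by fun_prop) (by fun_prop)))
      (hP.comp (g := fun x : α × ℕ × ℕ => (x.1, x.2.1 / 2, x.2.2)) (by fun_prop)))
    (and (of_primrec (PrimrecPred.eq_apply (by fun_prop) (by fun_prop)))
      (hQ.comp (g := fun x : α × ℕ × ℕ => (x.1, x.2.1 / 2, x.2.2)) (by fun_prop)))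

theorem word {w : α → List ℕ} (hw : Primrec w) :
    SemiDec fun _ (x : α × ℕ × ℕ) => wordRel (w x.1) x.2.1 x.2.2 :=
  of_primrec (PrimrecPred.eq_apply (by fun_prop) (by fun_prop))

theorem graph_const {e : Name} (he : Computable e) :
    SemiDec fun _ (x : α × ℕ × ℕ) => graph e x.2.1 x.2.2 :=
  (graph_of_computable he).comp (g := fun x : α × ℕ × ℕ => x.2) (by fun_prop)

end SemiDec

/-! ### Composition of machines -/

/-- The iterated relational application is semidecidable; where both machines converge it is the
graph of `r`, so a search can find nothing else. -/
theorem exists_comp {e e' : Name} (he : Computable e) (he' : Computable e') :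
    ∃ d : Name, Computable d ∧ ∀ p q r, Applies e p q → Applies e' q r → Applies d p r := by
  have h : SemiDec fun p (x : ℕ × ℕ) => App (graph e') (App (graph e) (graph p)) x.1 x.2 :=
    (SemiDec.app (E := fun _ (_ : Unit) => graph e')
      (Q := fun p (_ : Unit) => App (graph e) (graph p)) (SemiDec.graph_const he')
      (SemiDec.app (E := fun _ (_ : Unit) => graph e) (Q := fun p (_ : Unit) => graph p)
        (SemiDec.graph_const he) (SemiDec.oracle (f := fun x : Unit × ℕ × ℕ => x.2.1)
          (by fun_prop) (by fun_prop)))).comp (g := fun x : ℕ × ℕ => ((), x)) (by fun_prop)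
  obtain ⟨d, hd, hd'⟩ := exists_machine h
  refine ⟨d, hd, fun p q r h1 h2 => ?_⟩
  have := hd' p
  simp only [app_graph h1, app_graph h2] at this
  obtain ⟨r', h3, h4⟩ := this fun n => ⟨_, rfl⟩
  rwa [(funext h4 : r = r')]

/-! ### Continuity of namings -/

theorem Applies.eq_of_pre_eq {e q r : Name} (h : Applies e q r) (n : ℕ) :
    ∃ k, ∀ q' r', pre q' k = pre q k → Applies e q' r' → r' n = r n := by
  have h1 : App (graph e) (graph q) n (r n) := by rw [app_graph h]; rfl
  obtain ⟨k, hk⟩ := app_iff.1 h1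
  exact ⟨k, fun q' r' hq h' => outs_pre h' (hq ▸ hk)⟩

/-- Finite parts of names determine points up to arbitrarily small neighbourhoods. -/
def IsContinuousNaming {X : Type*} [TopologicalSpace X] (δ : Naming X) : Prop :=
  ∀ q x, δ q x → ∀ U : Opens X, x ∈ U → ∃ k, ∀ q' x', δ q' x' → pre q' k = pre q k → x' ∈ U

theorem pre_join_eq {p q p' q' : Name} {k : ℕ} (hp : pre p' k = pre p k) (hq : pre q' k = pre q k) :
    pre (joinName p' q') k = pre (joinName p q) k := by
  rw [pre_eq_pre] at *
  intro i hi
  simp only [joinName]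
  split_ifs with h
  · exact hp _ (by omega)
  · exact hq _ (by omega)

/-- The machine approximates `dist x x = 0` to within `2⁻¹ ^ n` after reading finitely many symbols.
A point `x'` with the same initial word yields the same approximation for `dist x' x`, which is
therefore at most `2 * 2⁻¹ ^ n`. -/
theorem isContinuousNaming_of_dist {X : Type*} [MetricSpace X] {δ : Naming X}
    (h : ComputableMap (prodNaming δ δ) realNaming (fun z => dist z.1 z.2)) :
    IsContinuousNaming δ := by
  obtain ⟨e, -, he⟩ := h
  intro q x hq U hx
  obtain ⟨ε, hε, hU⟩ := Metric.isOpen_iff.1 U.isOpen x hx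
  obtain ⟨n, hn⟩ := exists_pow_lt_of_lt_one (half_pos hε) (by norm_num : (2⁻¹ : ℝ) < 1)
  obtain ⟨r, hr, -, hr'⟩ := he (joinName q q) (x, x) (by simp [prodNaming, hq])
  obtain ⟨k, hk⟩ := hr.eq_of_pre_eq n
  refine ⟨k, fun q' x' hq' hpre => hU ?_⟩
  obtain ⟨s, hs, -, hs'⟩ := he (joinName q' q) (x', x) (by simp [prodNaming, hq, hq'])
  have h1 := hk _ _ (pre_join_eq hpre rfl) hs
  have h2 := hs' n
  have h3 := hr' n
  rw [h1] at h2
  simp only [dist_self] at h2 h3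
  rw [Metric.mem_ball]
  rw [abs_le] at h2 h3
  linarith [h2.1, h3.2]

/-- Every open set has a name; for an increasing union there is one whose initial words can be
continued to names of the members. -/
theorem exists_openName_iSup {X : Type*} [TopologicalSpace X] {δ : Naming X}
    (hδ : IsContinuousNaming δ) {V : ℕ → Opens X} (hV : Monotone V) :
    ∃ u, openNaming δ u (⨆ j, V j) ∧ ∀ j, ∃ v, openNaming δ v (V j) ∧ pre v j = pre u j := by
  classical
  let A : ℕ → List ℕ → Prop := fun i w => ∀ q x, δ q x → pre q w.length = w → x ∈ V i
  let w : ℕ → List ℕ := fun m => (Encodable.decode m.unpair.2).getD []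
  -- This code reads exactly `n` symbols before writing the `n`-th output. It writes `1` if the word
  -- read forces the point into some `V i` with `i` admitted by `I`, and `0` otherwise; the values
  -- are shifted by one as in `Applies`.
  let N : (List ℕ → ℕ → Prop) → Name := fun I m =>
    if (w m).length < m.unpair.1 then 0
    else if ∃ i, I (w m) i ∧ A i (w m) then 2 else 1
  let B : (List ℕ → ℕ → Prop) → Name → Name := fun I q n =>
    if ∃ i, I (pre q n) i ∧ A i (pre q n) then 1 else 0
  have hB : ∀ I q, (∃ n, B I q n ≠ 0) ↔ ∃ n i, I (pre q n) i ∧ A i (pre q n) := fun I q => by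
    simp [B]
  have happ : ∀ I q, Applies (N I) q (B I q) := by
    intro I q n
    refine ⟨n, ?_, fun j hj => ?_⟩
    · simp only [N, w, Nat.unpair_pair, wordCode_eq, Encodable.encodek, Option.getD_some,
        length_pre, lt_irrefl, if_false]
      simp only [B]
      split_ifs <;> rfl
    · simp only [N, w, Nat.unpair_pair, wordCode_eq, Encodable.encodek, Option.getD_some,
        length_pre, if_pos hj]
  have hacc : ∀ q x i, δ q x → x ∈ V i → ∃ k, ∀ n ≥ k, A i (pre q n) := by
    intro q x i hq hx
    obtain ⟨k, hk⟩ := hδ q x hq (V i) hx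
    refine ⟨k, fun n hn q' x' hq' h => hk q' x' hq' ?_⟩
    rw [length_pre] at h
    exact pre_eq_pre_of_le h hn
  have hname : ∀ (I : List ℕ → ℕ → Prop) (U : Opens X), (∀ q x, δ q x → (x ∈ U ↔
      ∃ n i, I (pre q n) i ∧ A i (pre q n))) → openNaming δ (N I) U :=
    fun I U h q x hq => ⟨B I q, happ I q, (h q x hq).trans (hB I q).symm⟩
  refine ⟨N fun l i => i ≤ l.length, hname (fun l i => i ≤ l.length) _ fun q x hq => ?_,
    fun j => ⟨N fun l i => i ≤ l.length ∧ i ≤ j,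
      hname (fun l i => i ≤ l.length ∧ i ≤ j) _ fun q x hq => ?_, ?_⟩⟩
  · simp only [Opens.mem_iSup, length_pre]
    constructor
    · rintro ⟨i, hi⟩
      obtain ⟨k, hk⟩ := hacc q x i hq hi
      exact ⟨max i k, i, le_max_left _ _, hk _ (le_max_right _ _)⟩
    · rintro ⟨n, i, -, hi⟩
      exact ⟨i, hi q x hq (by simp)⟩
  · simp only [length_pre]
    constructor
    · intro hi
      obtain ⟨k, hk⟩ := hacc q x j hq hi
      exact ⟨max j k, j, ⟨le_max_left _ _, le_rfl⟩, hk _ (le_max_right _ _)⟩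
    · rintro ⟨n, i, ⟨-, hij⟩, hi⟩
      exact hV hij (hi q x hq (by simp))
  -- A word encoded in `m` has length at most `m`; for `m < j` the restriction `i ≤ j` thus follows
  -- from `i ≤ (w m).length`, and the two codes agree.
  · refine pre_eq_pre.2 fun m hm => ?_
    have hlen : ∀ l : List ℕ, l.length ≤ Encodable.encode l := by
      intro l
      induction l with
      | nil => simp
      | cons a l ih =>
        simp only [List.length_cons, Encodable.encode_list_cons]
        exact Nat.succ_le_succ (ih.trans (Nat.right_le_pair _ _))
    have hw : (w m).length ≤ m := by
      simp only [w]
      cases hd : (Encodable.decode m.unpair.2 : Option (List ℕ)) with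
      | none => simp
      | some l =>
        have : Encodable.encode l = m.unpair.2 := by
          rw [Denumerable.decode_eq_ofNat, Option.some_inj] at hd
          rw [← hd, Denumerable.encode_ofNat]
        exact (hlen l).trans (this ▸ Nat.unpair_right_le m)
    have : ∀ i, (i ≤ (w m).length ∧ i ≤ j) ↔ i ≤ (w m).length :=
      fun i => ⟨fun h => h.1, fun h => ⟨h, by omega⟩⟩
    simp only [N, this]
    congr

theorem exists_openName {X : Type*} [TopologicalSpace X] {δ : Naming X}
    (hδ : IsContinuousNaming δ) (U : Opens X) : ∃ u, openNaming δ u U := by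
  obtain ⟨u, hu, -⟩ := exists_openName_iSup hδ (V := fun _ => U) monotone_const
  exact ⟨u, by simpa using hu⟩

theorem mem_iff_app {X : Type*} [TopologicalSpace X] {δ : Naming X} {u q : Name} {U : Opens X}
    {x : X} (hu : openNaming δ u U) (hq : δ q x) :
    x ∈ U ↔ ∃ n c, App (graph u) (graph q) n (c + 1) := by
  obtain ⟨r, h1, h2⟩ := hu q x hq
  rw [app_graph h1]
  refine Iff.trans h2 (exists_congr fun n => ?_)
  exact Nat.exists_eq_add_one_of_ne_zero |> fun h => ⟨h, fun ⟨c, hc⟩ => by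
    rw [graph] at hc; omega⟩

/-! ### Names of points of the base space -/

/-- The only name of `ω`. -/
def cantorName (ω : Cantor) : Name := fun n => (ω n).toNat

theorem cantorNaming_cantorName (ω : Cantor) : cantorNaming (cantorName ω) ω := fun _ => rfl

theorem cantorNaming_iff {p : Name} {ω : Cantor} : cantorNaming p ω ↔ p = cantorName ω :=
  ⟨fun h => funext h, fun h => h ▸ cantorNaming_cantorName ω⟩

theorem pre_cantorName_eq {ω ω' : Cantor} {k : ℕ} :
    pre (cantorName ω) k = pre (cantorName ω') k ↔ ∀ i < k, ω i = ω' i := by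
  rw [pre_eq_pre]
  refine forall₂_congr fun i _ => ?_
  simp only [cantorName]
  cases ω i <;> cases ω' i <;> simp

theorem exists_cylinder_subset {U : Opens Cantor} {ω : Cantor} (h : ω ∈ U) :
    ∃ k, ∀ ω' : Cantor, (∀ i < k, ω' i = ω i) → ω' ∈ U := by
  obtain ⟨_, ⟨x, n, rfl⟩, h1, h2⟩ :=
    (PiNat.isTopologicalBasis_cylinders (fun _ : ℕ => Bool)).exists_subset_of_mem_open h U.isOpen
  exact ⟨n, fun ω' h' => h2 fun i hi => (h' i hi).trans (h1 i hi)⟩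

theorem isContinuousNaming_cantor : IsContinuousNaming cantorNaming := by
  intro q x hq U hx
  obtain ⟨k, hk⟩ := exists_cylinder_subset hx
  refine ⟨k, fun q' x' hq' h => hk x' ?_⟩
  rw [cantorNaming_iff] at hq hq'
  subst hq hq'
  exact pre_cantorName_eq.1 h

/-! ### Functionality of namings -/

theorem openNaming_functional {X : Type*} [TopologicalSpace X] {δ : Naming X}
    (hδ : ∀ x, ∃ q, δ q x) {u : Name} {U V : Opens X} (hU : openNaming δ u U)
    (hV : openNaming δ u V) : U = V := by
  ext x
  obtain ⟨q, hq⟩ := hδ x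
  exact (mem_iff_app hU hq).trans (mem_iff_app hV hq).symm

theorem LowerMeasurable.naming_functional {s : Name} {W W' : LowerMeasurable}
    (h : LowerMeasurable.naming s W) (h' : LowerMeasurable.naming s W') : W = W' := by
  obtain ⟨S, rfl, hS⟩ := h
  obtain ⟨T, rfl, hT⟩ := h'
  have : S.set = T.set := funext fun n =>
    openNaming_functional (fun ω => ⟨_, cantorNaming_cantorName ω⟩) (hS n) (hT n)
  cases S; cases T; cases this; rfl

theorem isRepresentation_preimageNaming {X : Type*} [MetricSpace X] {δ : Naming X}
    (hδ : IsContinuousNaming δ) : IsRepresentation (preimageNaming δ) where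
  functional p F G hF hG := by
    have : F.preimage = G.preimage := funext fun U => by
      obtain ⟨u, hu⟩ := exists_openName hδ U
      obtain ⟨r, h1, h2⟩ := hF u U hu
      obtain ⟨r', h3, h4⟩ := hG u U hu
      rw [h3.unique h1] at h4
      exact LowerMeasurable.naming_functional h2 h4
    cases F; cases G; cases this; rfl
  surjective F := F.continuous_preimage

/-! ### Lower-measurable sets as sets modulo null sets -/

namespace LowerMeasurable

/-- A set representing a lower-measurable set. -/
def toSet (W : LowerMeasurable) : Set Cantor := (Quotient.out W).lim

theorem measurableSet_toSet (W : LowerMeasurable) : MeasurableSet W.toSet :=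
  LowerSeq.measurableSet_lim _

theorem mk_out (W : LowerMeasurable) : (Quotient.mk _ (Quotient.out W) : LowerMeasurable) = W :=
  Quotient.out_eq W

theorem mk_eq_mk {S T : LowerSeq} :
    (Quotient.mk _ S : LowerMeasurable) = Quotient.mk _ T ↔ S.lim =ᵐ[coin] T.lim :=
  Quotient.eq.trans (LowerSeq.equiv_iff S T)

theorem mk_eq_iff {S : LowerSeq} {W : LowerMeasurable} :
    Quotient.mk _ S = W ↔ S.lim =ᵐ[coin] W.toSet := by
  rw [toSet, ← mk_eq_mk, mk_out]

theorem toSet_mk (S : LowerSeq) : toSet (Quotient.mk _ S) =ᵐ[coin] S.lim :=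
  (mk_eq_iff.1 rfl).symm

theorem measure_eq (W : LowerMeasurable) : W.measure = coin W.toSet := by
  conv_lhs => rw [← mk_out W]
  exact LowerSeq.measure_eq _

theorem toSet_inter (W W' : LowerMeasurable) :
    (W.inter W').toSet =ᵐ[coin] (W.toSet ∩ W'.toSet : Set Cantor) := by
  conv_lhs => rw [← mk_out W, ← mk_out W']
  exact (toSet_mk _).trans (by rw [LowerSeq.lim_inter]; rfl)

theorem toSet_union (W W' : LowerMeasurable) :
    (W.union W').toSet =ᵐ[coin] (W.toSet ∪ W'.toSet : Set Cantor) := by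
  conv_lhs => rw [← mk_out W, ← mk_out W']
  exact (toSet_mk _).trans (by rw [LowerSeq.lim_union]; rfl)

theorem toSet_ofOpen (U : Opens Cantor) : (ofOpen U).toSet =ᵐ[coin] (U : Set Cantor) := by
  refine (toSet_mk _).trans (Eventually.of_forall fun ω => ?_)
  exact congrFun (Set.iInter_const (U : Set Cantor)) ω

end LowerMeasurable

/-! ### Continuity of random variables from below -/

namespace RandomVariable

variable {X : Type*} [MetricSpace X] {δ : Naming X} (G : RandomVariable δ)

/-- The event that a random variable lies in `U`. -/
def event (U : Opens X) : Set Cantor := (G.preimage U).toSet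

theorem measurableSet_event (U : Opens X) : MeasurableSet (G.event U) :=
  LowerMeasurable.measurableSet_toSet _

theorem event_bot : G.event ⊥ =ᵐ[coin] (∅ : Set Cantor) := by
  rw [event, G.preimage_empty]
  exact LowerMeasurable.toSet_ofOpen _

theorem event_top : G.event ⊤ =ᵐ[coin] (Set.univ : Set Cantor) := by
  rw [event, G.preimage_univ]
  exact LowerMeasurable.toSet_ofOpen _

theorem event_inter (U V : Opens X) :
    G.event (U ⊓ V) =ᵐ[coin] (G.event U ∩ G.event V : Set Cantor) := by
  rw [event, G.preimage_inter]
  exact LowerMeasurable.toSet_inter _ _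

theorem event_union (U V : Opens X) :
    G.event (U ⊔ V) =ᵐ[coin] (G.event U ∪ G.event V : Set Cantor) := by
  rw [event, G.preimage_union]
  exact LowerMeasurable.toSet_union _ _

theorem event_mono {U V : Opens X} (h : U ≤ V) : G.event U ≤ᵐ[coin] G.event V := by
  have h1 := G.event_inter U V
  rw [inf_eq_left.2 h] at h1
  filter_upwards [h1.mem_iff] with ω hω hU
  exact (hω.1 hU).2

end RandomVariable

/-- The points accepted at stage `n` by the lower-measurable set which the code `p` assigns to a
partially known open set. -/
def Accepts (p : Name) (U : ℕ → ℕ → Prop) (n : ℕ) (Q : ℕ → ℕ → Prop) : Prop :=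
  ∃ N c, App (fun i v => App (graph p) U (Nat.pair n i) v) Q N (c + 1)

theorem Accepts.mono {p : Name} {U U' Q Q' : ℕ → ℕ → Prop} (hU : ∀ i v, U i v → U' i v)
    (hQ : ∀ i v, Q i v → Q' i v) {n : ℕ} : Accepts p U n Q → Accepts p U' n Q' :=
  fun ⟨N, c, h⟩ => ⟨N, c, h.mono (fun _ _ h => h.mono (fun _ _ h => h) hU) hQ⟩

/-- Compactness is used twice: for computing the stage from `u`, and for running the resulting code
on `q`. -/
theorem Accepts.exists_pre {p u q : Name} {n : ℕ} (h : Accepts p (graph u) n (graph q)) :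
    ∃ k, Accepts p (wordRel (pre u k)) n (wordRel (pre q k)) := by
  obtain ⟨N, c, h⟩ := h
  have h1 : (fun i v => App (graph p) (graph u) (Nat.pair n i) v) =
      fun i v => ∃ k, App (graph p) (wordRel (pre u k)) (Nat.pair n i) v := by
    funext i v
    refine propext ⟨fun h => ?_, fun ⟨k, h⟩ => h.mono (fun _ _ h => h) fun _ _ h =>
      (wordRel_pre.1 h).2⟩
    rw [graph_eq_iUnion_pre u] at h
    exact App.exists_of_iUnion (E := fun _ => graph p) (Q := fun k => wordRel (pre u k))
      (fun _ _ _ _ _ h => h) (fun _ _ _ _ h => wordRel_pre_mono h)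
      (h.mono (fun _ _ h => ⟨0, h⟩) fun _ _ h => h)
  rw [h1, graph_eq_iUnion_pre q] at h
  obtain ⟨k, hk⟩ := App.exists_of_iUnion
    (E := fun k i v => App (graph p) (wordRel (pre u k)) (Nat.pair n i) v)
    (Q := fun k => wordRel (pre q k))
    (fun _ _ _ _ h h' => h'.mono (fun _ _ h => h) fun _ _ h' => wordRel_pre_mono h h')
    (fun _ _ _ _ h => wordRel_pre_mono h) h
  exact ⟨k, N, c, hk⟩

theorem RandomVariable.exists_lowerSeq {X : Type*} [MetricSpace X] {δ : Naming X}
    {G : RandomVariable δ} {p u : Name} {U : Opens X} (hp : preimageNaming δ p G)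
    (hu : openNaming δ u U) : ∃ S : LowerSeq, S.lim =ᵐ[coin] G.event U ∧
      ∀ n ω, ω ∈ S.set n ↔ Accepts p (graph u) n (graph (cantorName ω)) := by
  obtain ⟨s, h1, S, h2, h3⟩ := hp u U hu
  refine ⟨S, LowerMeasurable.mk_eq_iff.1 h2, fun n ω => ?_⟩
  rw [mem_iff_app (h3 n) (cantorNaming_cantorName ω), Accepts, app_graph h1]
  rfl

namespace RandomVariable

variable {X : Type*} [MetricSpace X] {δ : Naming X} (G : RandomVariable δ)

/-- Stage `n` for the union is covered by the sets `A k` accepted from the first `k` symbols of its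
name. Those symbols also begin a name of `V k`, so `A k` lies in the stage `n` obtained from that
name and exceeds `coin (G.event (V k))` by at most `2⁻¹ ^ n`. -/
theorem coin_event_iSup_le (hδ : IsContinuousNaming δ) {V : ℕ → Opens X} (hV : Monotone V) :
    coin (G.event (⨆ j, V j)) ≤ ⨆ j, coin (G.event (V j)) := by
  obtain ⟨p, hp⟩ := G.continuous_preimage
  obtain ⟨u, hu, huV⟩ := exists_openName_iSup hδ hV
  obtain ⟨S, hS, hS'⟩ := exists_lowerSeq (G := G) hp hu
  rw [← measure_congr hS, ← S.measure_eq]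
  refine iSup_le fun n => ?_
  let A : ℕ → Set Cantor := fun k =>
    {ω | Accepts p (wordRel (pre u k)) n (graph (cantorName ω))}
  have hA : (S.set n : Set Cantor) ⊆ ⋃ k, A k := fun ω hω => by
    obtain ⟨k, hk⟩ := ((hS' n ω).1 hω).exists_pre
    exact Set.mem_iUnion.2 ⟨k, hk.mono (fun _ _ h => h) fun _ _ h => (wordRel_pre.1 h).2⟩
  have hmono : Monotone A := fun j k hjk ω h =>
    Accepts.mono (fun _ _ h => wordRel_pre_mono hjk h) (fun _ _ h => h) h
  have h1 : coin (S.set n) - 2⁻¹ ^ n ≤ (⨆ k, coin (A k)) - 2⁻¹ ^ n :=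
    tsub_le_tsub_right ((measure_mono hA).trans hmono.measure_iUnion.le) _
  refine h1.trans (tsub_le_iff_right.2 (iSup_le fun k => ?_))
  obtain ⟨v, hv, hvu⟩ := huV k
  obtain ⟨T, hT, hT'⟩ := exists_lowerSeq (G := G) hp hv
  have h2 : A k ⊆ T.set n := fun ω hω => by
    refine (hT' n ω).2 (Accepts.mono (fun i v' h => ?_) (fun _ _ h => h) hω)
    rw [← hvu] at h
    exact (wordRel_pre.1 h).2
  calc coin (A k) ≤ coin T.lim + 2⁻¹ ^ n := (measure_mono h2).trans (T.coin_set_le n)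
    _ ≤ _ := by
      rw [measure_congr hT]
      gcongr
      exact le_iSup (fun j => coin (G.event (V j))) k

/-- Finite unions are preserved by definition. Continuity from below shows that the events of the
partial unions exhaust the event of the whole union in measure, hence almost everywhere. -/
theorem event_le_iUnion (hδ : IsContinuousNaming δ) {ι : Type*} [Countable ι] [Nonempty ι]
    {V : ι → Opens X} {U : Opens X} (hU : ∀ x ∈ U, ∃ i, x ∈ V i) :
    G.event U ≤ᵐ[coin] (⋃ i, G.event (V i) : Set Cantor) := by
  obtain ⟨f, hf⟩ := exists_surjective_nat ι
  let W : ℕ → Opens X := fun j => partialSups (fun j => V (f j)) j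
  have hW : Monotone W := (partialSups fun j => V (f j)).monotone
  have hle : ∀ j, G.event (W j) ≤ᵐ[coin] (⋃ i, G.event (V i) : Set Cantor) := by
    intro j
    induction j with
    | zero =>
      simp only [W, partialSups_zero]
      exact Eventually.of_forall fun ω hω => Set.mem_iUnion.2 ⟨_, hω⟩
    | succ j ih =>
      have : W (j + 1) = W j ⊔ V (f (j + 1)) := partialSups_add_one _ _
      rw [this]
      filter_upwards [ih, (G.event_union (W j) (V (f (j + 1)))).mem_iff] with ω h1 h2 h3
      rcases h2.1 h3 with h | h
      · exact h1 h
      · exact Set.mem_iUnion.2 ⟨_, h⟩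
  have hsup : U ≤ ⨆ j, W j := fun x hx => by
    obtain ⟨i, hi⟩ := hU x hx
    obtain ⟨j, rfl⟩ := hf i
    exact Opens.mem_iSup.2 ⟨j, le_partialSups (fun j => V (f j)) j hi⟩
  refine (G.event_mono hsup).trans ?_
  have hsub : (⋃ j, G.event (W j) : Set Cantor) ≤ᵐ[coin] G.event (⨆ j, W j) := by
    have := ae_all_iff.2 fun j => G.event_mono (le_iSup W j)
    filter_upwards [this] with ω h1 h2
    obtain ⟨j, hj⟩ := Set.mem_iUnion.1 h2
    exact h1 j hj
  have hmono : ∀ j, coin (G.event (W j)) ≤ coin (⋃ j, G.event (W j)) :=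
    fun j => measure_mono (Set.subset_iUnion (fun j => G.event (W j)) j)
  have heq := ae_eq_of_ae_subset_of_measure_ge hsub
    ((G.coin_event_iSup_le hδ hW).trans (iSup_le hmono))
    (MeasurableSet.iUnion fun j => G.measurableSet_event _).nullMeasurableSet (measure_ne_top _ _)
  refine heq.symm.le.trans ?_
  filter_upwards [ae_all_iff.2 hle] with ω h1 h2
  obtain ⟨j, hj⟩ := Set.mem_iUnion.1 h2
  exact h1 j hj

end RandomVariable

/-! ### Semidecidable comparisons of distances -/

/-- The names of a computable sequence of points have a semidecidable graph. -/
theorem exists_names {X : Type*} {δ : Naming X} {ξ : ℕ → X} {e : Name} (he : Computable e)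
    (h : ∀ i, ∃ r, Applies e (fun _ => i) r ∧ δ r (ξ i)) :
    ∃ t : ℕ → Name, (∀ i, δ (t i) (ξ i)) ∧
      SemiDec fun _ (x : ℕ × ℕ × ℕ) => graph (t x.1) x.2.1 x.2.2 := by
  choose t h1 h2 using h
  refine ⟨t, h2, ?_⟩
  refine (SemiDec.app (E := fun _ _ => graph e) (Q := fun _ i => graph fun _ => i)
    (SemiDec.graph_const he) (SemiDec.of_primrec ?_)).of_iff fun p x => by rw [app_graph (h1 x.1)]
  exact PrimrecPred.eq_apply (by fun_prop) (by fun_prop)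

theorem ratOfCode_cast (c : ℕ) :
    ((ratOfCode c : ℚ) : ℝ) = (c.unpair.1 : ℝ) / ((c.unpair.2 : ℝ) + 1) := by
  simp [ratOfCode]

/-- Clearing all denominators leaves a comparison of natural numbers. -/
theorem primrecPred_rat_add_lt : PrimrecPred fun x : ℕ × ℕ × ℕ × ℕ =>
    ((ratOfCode x.1 : ℚ) : ℝ) + 2⁻¹ ^ x.2.1 + 2 * 2⁻¹ ^ x.2.2.1 < 2⁻¹ ^ x.2.2.2 := by
  have h : PrimrecPred fun x : ℕ × ℕ × ℕ × ℕ =>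
      x.1.unpair.1 * 2 ^ x.2.1 * 2 ^ x.2.2.1 * 2 ^ x.2.2.2 +
        (x.1.unpair.2 + 1) * 2 ^ x.2.2.1 * 2 ^ x.2.2.2 +
        2 * (x.1.unpair.2 + 1) * 2 ^ x.2.1 * 2 ^ x.2.2.2 <
      (x.1.unpair.2 + 1) * 2 ^ x.2.1 * 2 ^ x.2.2.1 :=
    PrimrecPred.lt_apply (by fun_prop) (by fun_prop)
  refine h.of_eq fun ⟨c, N, m, j⟩ => ?_
  simp only [ratOfCode_cast]
  generalize c.unpair.1 = a
  generalize c.unpair.2 = b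
  rw [← Nat.cast_lt (α := ℝ)]
  push_cast
  have hb : (0 : ℝ) < (b : ℝ) + 1 := by positivity
  have hN : (0 : ℝ) < 2 ^ N := by positivity
  have hm : (0 : ℝ) < 2 ^ m := by positivity
  have hj : (0 : ℝ) < 2 ^ j := by positivity
  simp only [inv_pow]
  generalize (2 : ℝ) ^ N = N' at *
  generalize (2 : ℝ) ^ m = m' at *
  generalize (2 : ℝ) ^ j = j' at *
  generalize (b : ℝ) + 1 = b' at *
  have e1 : (a : ℝ) / b' + N'⁻¹ + 2 * m'⁻¹ =
      (a * N' * m' * j' + b' * m' * j' + 2 * b' * N' * j') / (b' * N' * m' * j') := by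
    field_simp
  have e2 : j'⁻¹ = (b' * N' * m') / (b' * N' * m' * j') := by field_simp
  rw [e1, e2, div_lt_div_iff_of_pos_right (by positivity)]

theorem primrecPred_lt_rat : PrimrecPred fun x : ℕ × ℕ =>
    2 * 2⁻¹ ^ x.2 < ((ratOfCode x.1 : ℚ) : ℝ) := by
  have h : PrimrecPred fun x : ℕ × ℕ => 2 * (x.1.unpair.2 + 1) < x.1.unpair.1 * 2 ^ x.2 :=
    PrimrecPred.lt_apply (by fun_prop) (by fun_prop)
  refine h.of_eq fun ⟨c, m⟩ => ?_
  simp only [ratOfCode_cast]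
  rw [← Nat.cast_lt (α := ℝ)]
  push_cast
  rw [lt_div_iff₀ (by positivity), inv_pow, mul_right_comm, ← div_eq_mul_inv,
    div_lt_iff₀ (by positivity)]

/-- A strict upper bound on a real is confirmed by a sufficiently good rational approximation. The
test takes a relation in place of a name, so it can be applied to outputs of machines that may
diverge. -/
theorem exists_dist_test {X : Type*} [MetricSpace X] {δ : Naming X}
    (h : ComputableMap (prodNaming δ δ) realNaming (fun z => dist z.1 z.2)) {ξ : ℕ → X}
    {t : ℕ → Name} (ht : ∀ i, δ (t i) (ξ i))
    (ht' : SemiDec fun _ (x : ℕ × ℕ × ℕ) => graph (t x.1) x.2.1 x.2.2) :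
    ∃ D : (ℕ → ℕ → Prop) → ℕ → ℕ → ℕ → Prop,
      (∀ (α : Type) [Primcodable α] (S : Name → α → ℕ → ℕ → Prop),
        (SemiDec fun p (x : α × ℕ × ℕ) => S p x.1 x.2.1 x.2.2) →
        SemiDec fun p (x : α × ℕ × ℕ × ℕ) => D (S p x.1) x.2.1 x.2.2.1 x.2.2.2) ∧
      ∀ s x i j m, δ s x →
        (D (graph s) i j m ↔ dist x (ξ i) + 2 * 2⁻¹ ^ m < (2⁻¹ : ℝ) ^ j) := by
  obtain ⟨e, he, hd⟩ := h
  refine ⟨fun S i j m => ∃ N c, App (graph e) (joinRel S (graph (t i))) N c ∧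
    ((ratOfCode c : ℚ) : ℝ) + 2⁻¹ ^ N + 2 * 2⁻¹ ^ m < 2⁻¹ ^ j, fun α _ S hS => ?_,
    fun s x i j m hs => ?_⟩
  · refine SemiDec.exists_nat (SemiDec.exists_nat (SemiDec.and ?_ (SemiDec.of_primrec
      (primrecPred_rat_add_lt.apply (g := fun z : ((α × ℕ × ℕ × ℕ) × ℕ) × ℕ =>
        (z.2, z.1.2, z.1.1.2.2.2, z.1.1.2.2.1)) (by fun_prop)))))
    exact (SemiDec.app (E := fun _ _ => graph e)
      (Q := fun p (y : α × ℕ) => joinRel (S p y.1) (graph (t y.2))) (SemiDec.graph_const he)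
      (SemiDec.join (P := fun p (y : α × ℕ) => S p y.1) (Q := fun _ (y : α × ℕ) => graph (t y.2))
        (hS.comp (g := fun z : (α × ℕ) × ℕ × ℕ => (z.1.1, z.2)) (by fun_prop))
        (ht'.comp (g := fun z : (α × ℕ) × ℕ × ℕ => (z.1.2, z.2)) (by fun_prop)))).comp
      (g := fun z : ((α × ℕ × ℕ × ℕ) × ℕ) × ℕ => ((z.1.1.1, z.1.1.2.1), z.1.2, z.2))
      (by fun_prop)
  · obtain ⟨r, h1, -, h2⟩ := hd (joinName s (t i)) (x, ξ i) (by simp [prodNaming, hs, ht])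
    simp only [joinRel_graph, app_graph h1]
    constructor
    · rintro ⟨N, c, rfl, hc⟩
      have := (abs_le.1 (h2 N)).1
      linarith
    · intro h
      obtain ⟨N, hN⟩ := exists_pow_lt_of_lt_one (half_pos (sub_pos.2 h))
        (by norm_num : (2⁻¹ : ℝ) < 1)
      refine ⟨N, r N, rfl, ?_⟩
      have := (abs_le.1 (h2 N)).2
      linarith

/-- The points of `U` whose distance to the complement exceeds `2⁻ˡ`. -/
def inner {X : Type*} [MetricSpace X] (U : Opens X) (l : ℕ) : Opens X where
  carrier := {x | ENNReal.ofReal (2⁻¹ ^ l) < Metric.infEDist x (U : Set X)ᶜ}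
  is_open' := isOpen_lt continuous_const Metric.continuous_infEDist

theorem mem_inner {X : Type*} [MetricSpace X] {U : Opens X} {l : ℕ} {x : X} :
    x ∈ inner U l ↔ ENNReal.ofReal (2⁻¹ ^ l) < Metric.infEDist x (U : Set X)ᶜ := Iff.rfl

theorem inner_le {X : Type*} [MetricSpace X] (U : Opens X) (l : ℕ) : inner U l ≤ U := by
  intro x hx
  by_contra h
  rw [mem_inner, Metric.infEDist_zero_of_mem h] at hx
  exact not_lt_bot hx

theorem exists_ofReal_pow_lt {a : ℝ≥0∞} (ha : 0 < a) : ∃ l : ℕ, ENNReal.ofReal (2⁻¹ ^ l) < a := by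
  obtain ⟨l, hl⟩ := ENNReal.exists_inv_two_pow_lt ha.ne'
  refine ⟨l, ?_⟩
  rwa [ENNReal.ofReal_pow (by norm_num), ENNReal.ofReal_inv_of_pos (by norm_num),
    ENNReal.ofReal_ofNat]

theorem exists_mem_inner {X : Type*} [MetricSpace X] {U : Opens X} {x : X} (hx : x ∈ U) :
    ∃ l, x ∈ inner U l := by
  refine exists_ofReal_pow_lt (pos_iff_ne_zero.2 fun h => ?_)
  rw [← Metric.mem_closure_iff_infEDist_zero, U.isOpen.isClosed_compl.closure_eq] at h
  exact h hx

/-- `T` certifies distance more than `2 * 2⁻¹ ^ m` from the complement. Completeness is stated in a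
form that suits a moving point: `U` is covered by open sets on each of which the test succeeds for
all large `m`, for every point and every name. Here the cover is `inner U`, because lower
approximations of the distance are available. -/
theorem exists_inner_test_of_lowerDistance {X : Type*} [MetricSpace X] {δ : Naming X}
    (h : LowerDistanceComputable δ) :
    ∃ T : (ℕ → ℕ → Prop) → (ℕ → ℕ → Prop) → ℕ → Prop,
      (∀ (α : Type) [Primcodable α] (S U : Name → α → ℕ → ℕ → Prop),
        (SemiDec fun p (x : α × ℕ × ℕ) => S p x.1 x.2.1 x.2.2) →
        (SemiDec fun p (x : α × ℕ × ℕ) => U p x.1 x.2.1 x.2.2) →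
        SemiDec fun p (x : α × ℕ) => T (S p x.1) (U p x.1) x.2) ∧
      ∀ u U, openNaming δ u U →
        (∀ s x m, δ s x → T (graph s) (graph u) m →
          ENNReal.ofReal (2 * 2⁻¹ ^ m) < Metric.infEDist x (U : Set X)ᶜ) ∧
        ∃ V : ℕ → Opens X, (∀ x ∈ U, ∃ j, x ∈ V j) ∧
          ∀ j, ∃ M, ∀ m ≥ M, ∀ s x, δ s x → x ∈ V j → T (graph s) (graph u) m := by
  obtain ⟨e, he, hd⟩ := h
  refine ⟨fun S U m => ∃ N c, App (graph e) (joinRel S U) N c ∧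
    2 * 2⁻¹ ^ m < ((ratOfCode c : ℚ) : ℝ), fun α _ S U hS hU => ?_, fun u U hu => ?_⟩
  · refine SemiDec.exists_nat (SemiDec.exists_nat (SemiDec.and ?_ (SemiDec.of_primrec
      (primrecPred_lt_rat.apply (g := fun z : ((α × ℕ) × ℕ) × ℕ => (z.2, z.1.1.2))
        (by fun_prop)))))
    exact (SemiDec.app (E := fun _ _ => graph e)
      (Q := fun p (y : α) => joinRel (S p y) (U p y)) (SemiDec.graph_const he)
      (SemiDec.join hS hU)).comp
      (g := fun z : ((α × ℕ) × ℕ) × ℕ => (z.1.1.1, z.1.2, z.2)) (by fun_prop)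
  · have key : ∀ s x, δ s x → ∃ r : Name, Metric.infEDist x (U : Set X)ᶜ =
        (⨆ n, ENNReal.ofReal ((ratOfCode (r n) : ℚ) : ℝ)) ∧
        App (graph e) (joinRel (graph s) (graph u)) = graph r := by
      intro s x hs
      obtain ⟨r, h1, h2⟩ := hd (joinName s u) (x, U) (by simp [prodNaming, hs, hu])
      exact ⟨r, h2, by rw [joinRel_graph, app_graph h1]⟩
    refine ⟨fun s x m hs => ?_, inner U, fun x => exists_mem_inner, fun j => ⟨j + 1, ?_⟩⟩
    · obtain ⟨r, h1, h2⟩ := key s x hs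
      rintro ⟨N, c, h3, h4⟩
      rw [h2] at h3
      rw [h1, lt_iSup_iff]
      refine ⟨N, ?_⟩
      rw [show r N = c from h3]
      exact (ENNReal.ofReal_lt_ofReal_iff_of_nonneg (by positivity)).2 h4
    · intro m hm s x hs hx
      obtain ⟨r, h1, h2⟩ := key s x hs
      rw [mem_inner, h1, lt_iSup_iff] at hx
      obtain ⟨N, hN⟩ := hx
      rw [ENNReal.ofReal_lt_ofReal_iff_of_nonneg (by positivity)] at hN
      refine ⟨N, r N, by rw [h2]; rfl, lt_of_le_of_lt ?_ hN⟩
      calc (2 : ℝ) * 2⁻¹ ^ m ≤ 2 * 2⁻¹ ^ (j + 1) := by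
            gcongr ?_ * ?_
            exact pow_le_pow_of_le_one (by norm_num) (by norm_num) hm
        _ = 2⁻¹ ^ j := by rw [pow_succ]; ring

/-- If the code of `U` accepts after seeing only a word `w` of a Cauchy name, then the intersection
of the balls described by `w` lies in `U`, since each of its points has a Cauchy name beginning with
`w`. The test looks for such a `w` with the point at depth more than `2 * 2⁻¹ ^ m` in each ball. The
cover consists of these smaller intersections, with `w` and the margin as indices. -/
theorem exists_inner_test_of_cauchy {X : Type*} [MetricSpace X] {δ : Naming X}
    (hdist : ComputableMap (prodNaming δ δ) realNaming (fun z => dist z.1 z.2))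
    (h : HasCauchyRepresentation δ) :
    ∃ T : (ℕ → ℕ → Prop) → (ℕ → ℕ → Prop) → ℕ → Prop,
      (∀ (α : Type) [Primcodable α] (S U : Name → α → ℕ → ℕ → Prop),
        (SemiDec fun p (x : α × ℕ × ℕ) => S p x.1 x.2.1 x.2.2) →
        (SemiDec fun p (x : α × ℕ × ℕ) => U p x.1 x.2.1 x.2.2) →
        SemiDec fun p (x : α × ℕ) => T (S p x.1) (U p x.1) x.2) ∧
      ∀ u U, openNaming δ u U →
        (∀ s x m, δ s x → T (graph s) (graph u) m →
          ENNReal.ofReal (2 * 2⁻¹ ^ m) < Metric.infEDist x (U : Set X)ᶜ) ∧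
        ∃ V : ℕ → Opens X, (∀ x ∈ U, ∃ j, x ∈ V j) ∧
          ∀ j, ∃ M, ∀ m ≥ M, ∀ s x, δ s x → x ∈ V j → T (graph s) (graph u) m := by
  obtain ⟨ξ, hξ, -, e, he, hed⟩ := h
  obtain ⟨t, ht, ht'⟩ := exists_names (δ := δ) (ξ := ξ) he fun i =>
    hed (fun _ => i) (ξ i) fun n => by simp
  obtain ⟨D, hD, hDd⟩ := exists_dist_test hdist ht ht'
  let B : (ℕ → ℕ → Prop) → List ℕ → Prop := fun U w =>
    ∃ N c, App U (App (graph e) (wordRel w)) N (c + 1)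
  refine ⟨fun S U m => ∃ w : List ℕ, B U w ∧ ∀ j < w.length, D S (w.getD j 0) j m,
    fun α _ S U hS hU => ?_, fun u U hu => ?_⟩
  · refine SemiDec.ex (SemiDec.and (SemiDec.exists_nat (SemiDec.exists_nat ?_))
      (SemiDec.forall_lt (P := fun p (y : (α × ℕ) × List ℕ) j =>
        D (S p y.1.1) (y.2.getD j 0) j y.1.2) ?_ (by fun_prop)))
    · exact (SemiDec.app (E := fun p (y : α × List ℕ) => U p y.1)
        (Q := fun _ (y : α × List ℕ) => App (graph e) (wordRel y.2))
        (hU.comp (g := fun z : (α × List ℕ) × ℕ × ℕ => (z.1.1, z.2)) (by fun_prop))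
        (SemiDec.app (E := fun _ _ => graph e) (Q := fun _ (y : α × List ℕ) => wordRel y.2)
          (SemiDec.graph_const he) (SemiDec.word (by fun_prop)))).comp
        (g := fun z : (((α × ℕ) × List ℕ) × ℕ) × ℕ => ((z.1.1.1.1, z.1.1.2), z.1.2, z.2 + 1))
        (by fun_prop)
    · exact (hD α S hS).comp (g := fun z : ((α × ℕ) × List ℕ) × ℕ =>
        (z.1.1.1, z.1.2.getD z.2 0, z.2, z.1.1.2)) (by fun_prop)
  · have hsound : ∀ w : List ℕ, B (graph u) w → ∀ y, (∀ j < w.length,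
        dist y (ξ (w.getD j 0)) < 2⁻¹ ^ j) → y ∈ U := by
      rintro w ⟨N, c, hw⟩ y hy
      have hq : ∀ j, ∃ i, (j < w.length → i = w.getD j 0) ∧ dist (ξ i) y ≤ (2⁻¹ : ℝ) ^ j := by
        intro j
        by_cases hj : j < w.length
        · exact ⟨w.getD j 0, fun _ => rfl, by rw [dist_comm]; exact (hy j hj).le⟩
        · obtain ⟨i, hi⟩ := hξ.exists_dist_lt y (ε := (2⁻¹ : ℝ) ^ j) (by positivity)
          exact ⟨i, fun h => absurd h hj, by rw [dist_comm]; exact hi.le⟩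
      choose q hq1 hq2 using hq
      obtain ⟨s, hs1, hs2⟩ := hed q y hq2
      refine (mem_iff_app hu hs2).2 ⟨N, c, ?_⟩
      rw [← app_graph hs1]
      refine hw.mono (fun _ _ h => h) fun _ _ h => h.mono (fun _ _ h => h) fun j v hv => ?_
      have hj : j < w.length := by
        by_contra hj
        simp [wordRel, List.getElem?_eq_none (not_lt.1 hj)] at hv
      rw [graph, hq1 j hj, List.getD, show w[j]? = some v from hv, Option.getD_some]
    refine ⟨fun s x m hs => ?_, ?_⟩
    · rintro ⟨w, hw, hj⟩
      have hj' : ∀ j < w.length, dist x (ξ (w.getD j 0)) + 2 * 2⁻¹ ^ m < (2⁻¹ : ℝ) ^ j :=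
        fun j h => (hDd s x _ j m hs).1 (hj j h)
      -- Finitely many strict inequalities leave a common margin, which keeps the bound on the
      -- infimum distance strict.
      obtain ⟨ε, hε, hε'⟩ : ∃ ε > 0, ∀ j < w.length,
          dist x (ξ (w.getD j 0)) + (2 * 2⁻¹ ^ m + ε) ≤ (2⁻¹ : ℝ) ^ j := by
        obtain ⟨k, hk⟩ := exists_forall_lt_of_mono (P := fun k j =>
          dist x (ξ (w.getD j 0)) + (2 * 2⁻¹ ^ m + 2⁻¹ ^ k) ≤ (2⁻¹ : ℝ) ^ j) (N := w.length)
          (fun j k n hjk h => by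
            have := pow_le_pow_of_le_one (by norm_num : (0 : ℝ) ≤ 2⁻¹) (by norm_num) hjk
            linarith) fun j h => by
            obtain ⟨k, hk⟩ := exists_pow_lt_of_lt_one (sub_pos.2 (hj' j h))
              (by norm_num : (2⁻¹ : ℝ) < 1)
            exact ⟨k, by linarith⟩
        exact ⟨2⁻¹ ^ k, by positivity, hk⟩
      refine ((ENNReal.ofReal_lt_ofReal_iff_of_nonneg (by positivity)).2
        (lt_add_of_pos_right _ hε)).trans_le (Metric.le_infEDist.2 fun y hy => ?_)
      rw [edist_dist]
      refine ENNReal.ofReal_le_ofReal (not_lt.1 fun hlt => hy (hsound w hw y fun j h => ?_))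
      have := hε' j h
      have := dist_triangle_left y (ξ (w.getD j 0)) x
      linarith
    · classical
      let O : List ℕ × ℕ → Opens X := fun z =>
        if B (graph u) z.1 then
          ⟨{x | ∀ j < z.1.length, dist x (ξ (z.1.getD j 0)) + 2 * 2⁻¹ ^ z.2 < (2⁻¹ : ℝ) ^ j}, by
            have : {x | ∀ j < z.1.length,
                dist x (ξ (z.1.getD j 0)) + 2 * 2⁻¹ ^ z.2 < (2⁻¹ : ℝ) ^ j} =
                ⋂ j ∈ Finset.range z.1.length,
                  {x | dist x (ξ (z.1.getD j 0)) + 2 * 2⁻¹ ^ z.2 < (2⁻¹ : ℝ) ^ j} := by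
              ext; simp
            rw [this]
            exact isOpen_biInter_finset fun j _ => isOpen_lt (by fun_prop) continuous_const⟩
        else ⊥
      refine ⟨fun n => O ((Encodable.decode n).getD ([], 0)), fun x hx => ?_, fun n => ?_⟩
      -- A Cauchy name with strict inequalities places `x` in the open balls, leaving room for the
      -- margin `2 * 2⁻¹ ^ m`.
      · have hq : ∀ j, ∃ i, dist x (ξ i) < (2⁻¹ : ℝ) ^ j := fun j =>
          hξ.exists_dist_lt x (by positivity)
        choose q hq using hq
        obtain ⟨s, hs1, hs2⟩ := hed q x fun j => by rw [dist_comm]; exact (hq j).le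
        obtain ⟨N, c, hc⟩ := (mem_iff_app hu hs2).1 hx
        have happ : graph s = fun i v => ∃ k, App (graph e) (wordRel (pre q k)) i v := by
          funext i v
          refine propext ⟨fun h => ?_, fun ⟨k, h⟩ => ?_⟩
          · rw [← app_graph hs1, graph_eq_iUnion_pre q] at h
            exact App.exists_of_iUnion (E := fun _ => graph e) (Q := fun k => wordRel (pre q k))
              (fun _ _ _ _ _ h => h) (fun _ _ _ _ h => wordRel_pre_mono h)
              (h.mono (fun _ _ h => ⟨0, h⟩) fun _ _ h => h)
          · rw [← app_graph hs1]
            exact h.mono (fun _ _ h => h) fun _ _ h => (wordRel_pre.1 h).2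
        rw [happ] at hc
        obtain ⟨k, hk⟩ := App.exists_of_iUnion (E := fun _ => graph u)
          (Q := fun k => App (graph e) (wordRel (pre q k)))
          (fun _ _ _ _ _ h => h) (fun _ _ _ _ h h' => h'.mono (fun _ _ h => h)
            fun _ _ h' => wordRel_pre_mono h h') (hc.mono (fun _ _ h => ⟨0, h⟩) fun _ _ h => h)
        obtain ⟨m, hm⟩ := exists_forall_lt_of_mono (P := fun m j =>
          dist x (ξ (q j)) + 2 * 2⁻¹ ^ m < (2⁻¹ : ℝ) ^ j) (N := k)
          (fun j k n hjk h => by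
            have := pow_le_pow_of_le_one (by norm_num : (0 : ℝ) ≤ 2⁻¹) (by norm_num) hjk
            linarith) fun j _ => by
            obtain ⟨m, hm⟩ := exists_pow_lt_of_lt_one (half_pos (sub_pos.2 (hq j)))
              (by norm_num : (2⁻¹ : ℝ) < 1)
            exact ⟨m, by linarith⟩
        refine ⟨Encodable.encode (pre q k, m), ?_⟩
        simp only [Encodable.encodek, Option.getD_some, O]
        rw [if_pos ⟨N, c, hk⟩]
        intro j hj
        simp only [length_pre] at hj
        rw [getD_pre _ hj]
        exact hm j hj
      · simp only
        generalize ((Encodable.decode n).getD ([], 0) : List ℕ × ℕ) = z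
        obtain ⟨w, M⟩ := z
        refine ⟨M, fun m hm s x hs hx => ?_⟩
        simp only [O] at hx
        split_ifs at hx with hw
        · refine ⟨w, hw, fun j hj => (hDd s x _ j m hs).2 ((hx j hj).trans_le' ?_)⟩
          have := pow_le_pow_of_le_one (by norm_num : (0 : ℝ) ≤ 2⁻¹) (by norm_num) hm
          linarith
        · exact absurd hx (Set.notMem_empty x)

theorem exists_inner_test {X : Type*} [MetricSpace X] {δ : Naming X}
    (hX : IsComputableMetricSpace δ) :
    ∃ T : (ℕ → ℕ → Prop) → (ℕ → ℕ → Prop) → ℕ → Prop,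
      (∀ (α : Type) [Primcodable α] (S U : Name → α → ℕ → ℕ → Prop),
        (SemiDec fun p (x : α × ℕ × ℕ) => S p x.1 x.2.1 x.2.2) →
        (SemiDec fun p (x : α × ℕ × ℕ) => U p x.1 x.2.1 x.2.2) →
        SemiDec fun p (x : α × ℕ) => T (S p x.1) (U p x.1) x.2) ∧
      ∀ u U, openNaming δ u U →
        (∀ s x m, δ s x → T (graph s) (graph u) m →
          ENNReal.ofReal (2 * 2⁻¹ ^ m) < Metric.infEDist x (U : Set X)ᶜ) ∧
        ∃ V : ℕ → Opens X, (∀ x ∈ U, ∃ j, x ∈ V j) ∧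
          ∀ j, ∃ M, ∀ m ≥ M, ∀ s x, δ s x → x ∈ V j → T (graph s) (graph u) m :=
  hX.opens_metric.elim exists_inner_test_of_lowerDistance
    (exists_inner_test_of_cauchy hX.dist_computable)

/-! ### Values of piecewise-continuous random variables -/

namespace PiecewiseContinuous

variable {X : Type*} [MetricSpace X]

/-- The value at `ω`, arbitrary outside the domain. -/
def eval [Nonempty X] (F : PiecewiseContinuous X) (ω : Cantor) : X :=
  open Classical in if h : ω ∈ F.dom then F.toFun ⟨ω, h⟩ else Classical.arbitrary X

theorem ae_mem_dom (F : ℕ → PiecewiseContinuous X) : ∀ᵐ ω ∂coin, ∀ m, ω ∈ (F m).dom := by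
  refine ae_all_iff.2 fun m => ?_
  exact (prob_compl_eq_zero_iff (F m).dom.isOpen.measurableSet).2 (F m).coin_dom

variable [Nonempty X]

theorem eval_eq (F : PiecewiseContinuous X) {ω : Cantor} (h : ω ∈ F.dom) :
    F.eval ω = F.toFun ⟨ω, h⟩ := dif_pos h

theorem mem_preimage (F : PiecewiseContinuous X) {U : Opens X} {ω : Cantor} :
    ω ∈ F.preimage U ↔ ω ∈ F.dom ∧ F.eval ω ∈ U := by
  constructor
  · rintro ⟨⟨ω', h⟩, h1, rfl⟩
    exact ⟨h, by rwa [eval_eq F h]⟩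
  · rintro ⟨h1, h2⟩
    rw [eval_eq F h1] at h2
    exact ⟨⟨ω, h1⟩, h2, rfl⟩

/-! ### The Fan metric -/

theorem coin_le_of_fanDist_lt {F G : PiecewiseContinuous X} {a : ℚ} (ha : 0 < a)
    (h : fanDist F G < a) :
    coin {ω | ω ∈ F.dom ∧ ω ∈ G.dom ∧ (a : ℝ) < dist (F.eval ω) (G.eval ω)} ≤
      ENNReal.ofReal a := by
  by_contra! hlt
  refine h.not_ge (le_csSup ⟨1, ?_⟩ ⟨by exact_mod_cast ha, ⟨a, rfl⟩, hlt.trans_le ?_⟩)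
  · rintro ε ⟨-, -, hε⟩
    exact (ENNReal.ofReal_lt_one.1 (hε.trans_le prob_le_one)).le
  · refine measure_mono ?_
    rintro ω ⟨h1, h2, h3⟩
    rw [eval_eq F h1, eval_eq G h2] at h3
    exact ⟨h1, h2, h3⟩

theorem fanDist_le {F G : PiecewiseContinuous X} {a : ℝ} (ha : 0 ≤ a)
    (h : coin {ω | a < dist (F.eval ω) (G.eval ω)} ≤ ENNReal.ofReal a) : fanDist F G ≤ a := by
  refine Real.sSup_le ?_ ha
  rintro ε ⟨hε, -, hlt⟩
  by_contra! hlt'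
  refine (hlt.trans_le ((measure_mono ?_).trans h)).not_ge (ENNReal.ofReal_le_ofReal hlt'.le)
  rintro ω ⟨h1, h2, h3⟩
  change a < dist _ _
  rw [eval_eq F h1, eval_eq G h2]
  exact hlt'.trans h3

/-- The event that the sequence takes an exceptionally large step at some index from `n` on. -/
def badEvent (F : ℕ → PiecewiseContinuous X) (n : ℕ) : Set Cantor :=
  ⋃ k, {ω | ω ∈ (F (n + k)).dom ∧ ω ∈ (F (n + k + 1)).dom ∧
    (2⁻¹ : ℝ) ^ (n + k) < dist ((F (n + k)).eval ω) ((F (n + k + 1)).eval ω)}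

variable {F : ℕ → PiecewiseContinuous X}

/-- The step at index `n + k` exceeds `2⁻¹ ^ (n + k)` with at most that probability; the bounds form
a geometric series. -/
theorem coin_badEvent (hF : FastCauchy F) (n : ℕ) : coin (badEvent F n) ≤ 2 * 2⁻¹ ^ n := by
  refine (measure_iUnion_le _).trans ?_
  have h : ∀ k, coin {ω | ω ∈ (F (n + k)).dom ∧ ω ∈ (F (n + k + 1)).dom ∧
      (2⁻¹ : ℝ) ^ (n + k) < dist ((F (n + k)).eval ω) ((F (n + k + 1)).eval ω)} ≤
      2⁻¹ ^ n * 2⁻¹ ^ k := by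
    intro k
    have h1 := hF (n + k) (n + k + 1)
    rw [min_eq_left (Nat.le_succ _)] at h1
    have h2 := coin_le_of_fanDist_lt (a := 2⁻¹ ^ (n + k)) (by positivity) (by simpa using h1)
    have h3 : ENNReal.ofReal (((2⁻¹ : ℚ) ^ (n + k) : ℚ) : ℝ) = 2⁻¹ ^ n * 2⁻¹ ^ k := by
      rw [← pow_add]
      push_cast
      rw [ENNReal.ofReal_pow (by norm_num), ENNReal.ofReal_inv_of_pos (by norm_num),
        ENNReal.ofReal_ofNat]
    rw [h3] at h2
    simpa using h2
  refine (ENNReal.tsum_le_tsum h).trans ?_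
  rw [ENNReal.tsum_mul_left, ENNReal.tsum_geometric_two, mul_comm]

theorem badEvent_antitone (F : ℕ → PiecewiseContinuous X) : Antitone (badEvent F) := by
  intro m n hmn ω hω
  obtain ⟨k, hk⟩ := Set.mem_iUnion.1 hω
  refine Set.mem_iUnion.2 ⟨n - m + k, ?_⟩
  rwa [show m + (n - m + k) = n + k by omega]

theorem ae_exists_notMem_badEvent (hF : FastCauchy F) :
    ∀ᵐ ω ∂coin, ∃ n, ω ∉ badEvent F n := by
  have h : coin (⋂ n, badEvent F n) = 0 := by
    refine le_antisymm (ge_of_tendsto' (x := atTop) (f := fun n : ℕ => 2 * (2⁻¹ : ℝ≥0∞) ^ n) ?_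
      fun n => (measure_mono (Set.iInter_subset _ n)).trans (coin_badEvent hF n)) bot_le
    simpa using ENNReal.Tendsto.const_mul LowerSeq.tendsto_pow (Or.inr ENNReal.ofNat_ne_top)
  refine (measure_eq_zero_iff_ae_notMem.1 h).mono fun ω hω => ?_
  simpa using hω

/-- Summation of the steps. Keeping the subtracted tail closes the induction and gives the strict
inequality of `dist_eval_lt`. -/
theorem dist_eval_le {ω : Cantor} (hdom : ∀ m, ω ∈ (F m).dom) {n : ℕ} (hω : ω ∉ badEvent F n)
    {m : ℕ} (hm : n ≤ m) (k : ℕ) :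
    dist ((F m).eval ω) ((F (m + k)).eval ω) ≤ 2 * 2⁻¹ ^ m - 2 * 2⁻¹ ^ (m + k) := by
  induction k with
  | zero => simp
  | succ k ih =>
    have h1 : dist ((F (m + k)).eval ω) ((F (m + k + 1)).eval ω) ≤ 2⁻¹ ^ (m + k) := by
      by_contra! h
      refine hω (Set.mem_iUnion.2 ⟨m - n + k, ?_⟩)
      rw [show n + (m - n + k) = m + k by omega]
      exact ⟨hdom _, hdom _, h⟩
    have h2 := dist_triangle ((F m).eval ω) ((F (m + k)).eval ω) ((F (m + k + 1)).eval ω)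
    have h3 : (2⁻¹ : ℝ) ^ (m + k) = 2 * 2⁻¹ ^ (m + (k + 1)) := by
      rw [← add_assoc, pow_succ]; ring
    rw [← add_assoc] at h3 ⊢
    linarith

theorem dist_eval_lt {ω : Cantor} (hdom : ∀ m, ω ∈ (F m).dom) {n : ℕ} (hω : ω ∉ badEvent F n)
    {m m' : ℕ} (hm : n ≤ m) (hm' : m ≤ m') :
    dist ((F m).eval ω) ((F m').eval ω) < 2 * 2⁻¹ ^ m := by
  obtain ⟨k, rfl⟩ := Nat.exists_eq_add_of_le hm'
  have := dist_eval_le hdom hω hm k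
  have : (0 : ℝ) < 2⁻¹ ^ (m + k) := by positivity
  linarith

theorem cauchySeq_eval {ω : Cantor} (hdom : ∀ m, ω ∈ (F m).dom) {n : ℕ} (hω : ω ∉ badEvent F n) :
    CauchySeq fun m => (F m).eval ω := by
  refine Metric.cauchySeq_iff'.2 fun ε hε => ?_
  obtain ⟨N, hN⟩ := exists_pow_lt_of_lt_one (half_pos hε) (by norm_num : (2⁻¹ : ℝ) < 1)
  refine ⟨max n N, fun m hm => ?_⟩
  rw [dist_comm]
  refine (dist_eval_lt hdom hω (le_max_left _ _) hm).trans ?_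
  have := pow_le_pow_of_le_one (by norm_num : (0 : ℝ) ≤ 2⁻¹) (by norm_num) (le_max_right n N)
  linarith

/-- The event that the sequence eventually stays in `V`. -/
def eventually (F : ℕ → PiecewiseContinuous X) (V : Opens X) : Set Cantor :=
  {ω | ∀ᶠ m in atTop, ω ∈ (F m).preimage V}

/-- If a point of a slowly varying sequence is well inside `U`, then the sequence stays in `U`. -/
theorem mem_eventually_of_lt {U : Opens X} {ω : Cantor} (hdom : ∀ m, ω ∈ (F m).dom) {n m : ℕ}
    (hω : ω ∉ badEvent F n) (hm : n ≤ m)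
    (h : ENNReal.ofReal (2 * 2⁻¹ ^ m) < Metric.infEDist ((F m).eval ω) (U : Set X)ᶜ) :
    ∃ l, ω ∈ eventually F (inner U l) := by
  obtain ⟨l, hl⟩ := exists_ofReal_pow_lt (tsub_pos_of_lt h)
  refine ⟨l, eventually_atTop.2 ⟨m, fun m' hm' => (mem_preimage _).2 ⟨hdom _, hl.trans_le ?_⟩⟩⟩
  refine tsub_le_iff_right.2 ((Metric.infEDist_le_infEDist_add_edist (y := (F m').eval ω)).trans ?_)
  gcongr
  rw [edist_dist]
  exact ENNReal.ofReal_le_ofReal (dist_eval_lt hdom hω hm hm').le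

/-- At a visit with index `m ≥ l + 1` the depth `2⁻¹ ^ l` is at least `2 * 2⁻¹ ^ m`, more than the
sequence can still move. -/
theorem exists_mem_eventually_of_frequently {V : Opens X} {ω : Cantor} {l : ℕ}
    (hdom : ∀ m, ω ∈ (F m).dom) {n : ℕ} (hω : ω ∉ badEvent F n)
    (h : ∃ᶠ m in atTop, ω ∈ (F m).preimage (inner V l)) : ω ∈ eventually F V := by
  obtain ⟨m, hm, hmem⟩ := (frequently_atTop.1 h) (max n (l + 1))
  have h1 := mem_inner.1 ((mem_preimage _).1 hmem).2
  obtain ⟨j, hj⟩ := mem_eventually_of_lt hdom hω ((le_max_left _ _).trans hm)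
    (h1.trans_le' (ENNReal.ofReal_le_ofReal (by
      calc (2 : ℝ) * 2⁻¹ ^ m ≤ 2 * 2⁻¹ ^ (l + 1) := by
            gcongr ?_ * ?_
            exact pow_le_pow_of_le_one (by norm_num) (by norm_num) ((le_max_right _ _).trans hm)
        _ = 2⁻¹ ^ l := by rw [pow_succ]; ring)))
  filter_upwards [hj] with m hm
  rw [mem_preimage] at hm ⊢
  exact ⟨hm.1, inner_le V j hm.2⟩

/-- The events `E U` describe the limit of the sequence `F`. -/
structure IsLimitEvent (F : ℕ → PiecewiseContinuous X) (E : Opens X → Set Cantor) : Prop where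
  of_eventually_inner : ∀ U l, ∀ᵐ ω ∂coin, ω ∈ eventually F (inner U l) → ω ∈ E U
  exists_eventually : ∀ (U : Opens X) (V : ℕ → Opens X), (∀ x ∈ U, ∃ j, x ∈ V j) →
    ∀ᵐ ω ∂coin, ω ∈ E U → ∃ j, ω ∈ eventually F (V j)

end PiecewiseContinuous

/-! ### From fast Cauchy sequences to preimage maps -/

open PiecewiseContinuous

theorem isOpen_setOf_semiDec {α : Type*} [Primcodable α] {P : Name → α → Prop} (hP : SemiDec P)
    (p : Name) (a : α) : IsOpen {ω : Cantor | P (joinName p (cantorName ω)) a} := by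
  obtain ⟨R, -, hR⟩ := hP
  refine isOpen_iff_forall_mem_open.2 fun ω hω => ?_
  obtain ⟨k, hk⟩ := (hR _ _).1 hω
  refine ⟨PiNat.cylinder ω k, fun ω' hω' => (hR _ _).2 ⟨k, ?_⟩, PiNat.isOpen_cylinder _ ω k,
    PiNat.self_mem_cylinder ω k⟩
  rwa [pre_join_eq rfl (pre_cantorName_eq.2 hω')]

/-- From names of a fast Cauchy sequence a machine computes the preimage map of its limit. -/
theorem exists_limit_machine {X : Type*} [MetricSpace X] [Nonempty X] {δ : Naming X}
    (hX : IsComputableMetricSpace δ) :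
    ∃ e : Name, Computable e ∧ ∀ (p : Name) (F : ℕ → PiecewiseContinuous X),
      (∀ n, PiecewiseContinuous.naming δ (seqName p n) (F n)) → FastCauchy F →
      ∃ r, Applies e p r ∧ ∀ E : Opens X → Set Cantor, IsLimitEvent F E →
        ∀ u U, openNaming δ u U → ∃ s, Applies r u s ∧ ∃ S : LowerSeq, S.lim =ᵐ[coin] E U ∧
          ∀ n, openNaming cantorNaming (seqName s n) (S.set n) := by
  obtain ⟨T, hT, hTU⟩ := exists_inner_test hX
  let D : Name → ℕ → ℕ → ℕ → Prop := fun O m => graph (fstName (seqName O m))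
  let R : Name → ℕ → ℕ → ℕ → Prop := fun O m => graph (sndName (seqName O m))
  -- The oracle `O` joins the names of the sequence, of the open set and of the point `ω`. The
  -- offset `3` makes the exceptional measure `2 * 2⁻¹ ^ (n + 3)` at most `2⁻¹ ^ n`.
  let P : Name → ℕ → Prop := fun O n => ∃ m, n + 3 ≤ m ∧
    (∃ N c, App (D (fstName (fstName O)) m) (graph (sndName O)) N (c + 1)) ∧
    T (App (R (fstName (fstName O)) m) (graph (sndName O))) (graph (sndName (fstName O))) m
  have hD : SemiDec fun O (x : ℕ × ℕ × ℕ) => D O x.1 x.2.1 x.2.2 :=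
    SemiDec.oracle (f := fun x : ℕ × ℕ × ℕ => Nat.pair x.1 (2 * x.2.1)) (by fun_prop) (by fun_prop)
  have hR : SemiDec fun O (x : ℕ × ℕ × ℕ) => R O x.1 x.2.1 x.2.2 :=
    SemiDec.oracle (f := fun x : ℕ × ℕ × ℕ => Nat.pair x.1 (2 * x.2.1 + 1)) (by fun_prop)
      (by fun_prop)
  have hg : SemiDec fun O (x : ℕ × ℕ × ℕ) => graph O x.2.1 x.2.2 :=
    SemiDec.oracle (by fun_prop) (by fun_prop)
  have hP : SemiDec P := by
    refine SemiDec.exists_nat (SemiDec.and (SemiDec.of_primrec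
      (PrimrecPred.le_apply (by fun_prop) (by fun_prop))) (SemiDec.and
        (SemiDec.exists_nat (SemiDec.exists_nat ?_)) ?_))
    · exact (SemiDec.app (Q := fun O _ => graph (sndName O)) hD.fst.fst hg.snd).comp
        (g := fun z : ((ℕ × ℕ) × ℕ) × ℕ => (z.1.1.2, z.1.2, z.2 + 1)) (by fun_prop)
    · exact (hT ℕ (fun O m => App (R (fstName (fstName O)) m) (graph (sndName O))) (fun O _ => graph (sndName (fstName O)))
        (SemiDec.app (Q := fun O _ => graph (sndName O)) hR.fst.fst hg.snd) hg.snd.fst).comp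
        (g := fun z : ℕ × ℕ => (z.2, z.2)) (by fun_prop)
  -- The arguments are abstracted one at a time: here the point `ω`, next the name of the open set,
  -- and finally the name of the sequence becomes the input of the machine.
  obtain ⟨H, hH, hHP⟩ := exists_sierpinski hP
  obtain ⟨C, hC, hCK⟩ := exists_curry (α := Unit)
    (K := fun O _ v => H O v.unpair.1 v.unpair.2)
    (hH.comp (g := fun x : Unit × ℕ × ℕ => (x.2.1.unpair.1, x.2.1.unpair.2, x.2.2))
      (by fun_prop))
  obtain ⟨e, he, heC⟩ := exists_machine_of_total (H := fun p => C p ())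
    (hC.comp (g := fun x : ℕ × ℕ => ((), x)) (by fun_prop))
  refine ⟨e, he, fun p F hp hF => ⟨_, heC p, fun E hE u U hu => ⟨_, hCK p () u, ?_⟩⟩⟩
  obtain ⟨hT1, V, hV, hT2⟩ := hTU u U hu
  let W : ℕ → Opens Cantor := fun n =>
    ⟨{ω | P (joinName (joinName p u) (cantorName ω)) n}, isOpen_setOf_semiDec hP _ n⟩
  have happ : ∀ m ω (hω : ω ∈ (F m).dom), ∃ s, δ s ((F m).eval ω) ∧
      App (graph (sndName (seqName p m))) (graph (cantorName ω)) = graph s := by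
    intro m ω hω
    obtain ⟨s, h1, h2⟩ := (hp m).2 (cantorName ω) ⟨ω, hω⟩ (cantorNaming_cantorName ω)
    rw [← eval_eq _ hω] at h2
    exact ⟨s, h2, app_graph h1⟩
  have hW : ∀ n ω, ω ∈ W n ↔ ∃ m, n + 3 ≤ m ∧ ω ∈ (F m).dom ∧
      T (App (graph (sndName (seqName p m))) (graph (cantorName ω))) (graph u) m := by
    intro n ω
    change P (joinName (joinName p u) (cantorName ω)) n ↔ _
    simp only [P, fstName_join, sndName_join, D, R, ←
      mem_iff_app (hp _).1 (cantorNaming_cantorName ω)]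
  -- If the limit lies in `U`, the sequence eventually stays in one member of the cover, where the
  -- test succeeds at all large indices.
  have hEW : ∀ᵐ ω ∂coin, ω ∈ E U → ∀ n, ω ∈ W n := by
    filter_upwards [hE.exists_eventually U V hV, ae_mem_dom F] with ω h1 hdom hωE n
    obtain ⟨j, hj⟩ := h1 hωE
    obtain ⟨M, hM⟩ := hT2 j
    obtain ⟨N, hN⟩ := eventually_atTop.1 hj
    let m := max (n + 3) (max M N)
    obtain ⟨s, h2, h3⟩ := happ m ω (hdom m)
    refine (hW n ω).2 ⟨m, le_max_left _ _, hdom _, ?_⟩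
    rw [h3]
    exact hM m (by omega) s _ h2 ((mem_preimage _).1 (hN m (by omega))).2
  -- Outside the bad event the certified depth is more than the sequence can still move.
  have hWE : ∀ᵐ ω ∂coin, ∀ n, ω ∈ W n → ω ∉ badEvent F (n + 3) → ω ∈ E U := by
    filter_upwards [ae_all_iff.2 (hE.of_eventually_inner U), ae_mem_dom F] with ω h1 hdom n hWn hbad
    obtain ⟨m, hm, hω, hTs⟩ := (hW n ω).1 hWn
    obtain ⟨s, hs, h3⟩ := happ m ω hω
    rw [h3] at hTs
    obtain ⟨l, hl⟩ := mem_eventually_of_lt hdom hbad hm (hT1 s _ m hs hTs)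
    exact h1 l hl
  have hcoin : ∀ n, coin (W n) ≤ coin (E U) + 2⁻¹ ^ n := by
    intro n
    have h1 : (W n : Set Cantor) ≤ᵐ[coin] (E U ∪ badEvent F (n + 3) : Set Cantor) := by
      filter_upwards [hWE] with ω h1 h2
      by_cases h3 : ω ∈ badEvent F (n + 3)
      · exact Or.inr h3
      · exact Or.inl (h1 n h2 h3)
    refine (measure_mono_ae h1).trans ((measure_union_le _ _).trans ?_)
    gcongr
    refine (coin_badEvent hF _).trans ?_
    calc (2 : ℝ≥0∞) * 2⁻¹ ^ (n + 3) = 2⁻¹ ^ n * 2⁻¹ ^ 2 * (2⁻¹ * 2) := by ring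
      _ ≤ 2⁻¹ ^ n * 1 * 1 := by
        gcongr
        · exact pow_le_one₀ bot_le (by simp)
        · rw [ENNReal.inv_mul_cancel (by simp) (by simp)]
      _ = _ := by simp
  refine ⟨⟨W, fun m n hmn ω hω => ?_, fun n m _ => (hcoin n).trans ?_⟩, ?_, fun n => ?_⟩
  · obtain ⟨i, hi, h⟩ := (hW n ω).1 hω
    exact (hW m ω).2 ⟨i, by omega, h⟩
  · gcongr ?_ + _
    refine measure_mono_ae ?_
    filter_upwards [hEW] with ω h hω using h hω m
  · filter_upwards [hEW, hWE, ae_exists_notMem_badEvent hF] with ω h1 h2 ⟨n, hn⟩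
    refine propext ⟨fun h => ?_, fun h => Set.mem_iInter.2 fun n => h1 h n⟩
    exact h2 n (Set.mem_iInter.1 h n) fun h => hn (badEvent_antitone F (by omega) h)
  · intro q ω hq
    rw [cantorNaming_iff] at hq
    subst hq
    have : seqName (fun v => H (joinName p u) v.unpair.1 v.unpair.2) n = H (joinName p u) n := by
      funext k
      simp [seqName]
    rw [this]
    obtain ⟨r, h1, h2⟩ := hHP (joinName p u) n (cantorName ω)
    exact ⟨r, h1, h2.symm⟩

namespace PiecewiseContinuous

variable {X : Type*} [MetricSpace X] {δ : Naming X} {F : ℕ → PiecewiseContinuous X}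
  {G : RandomVariable δ}

/-! ### Limit events of convergent sequences -/

theorem convergesTo_iff : ConvergesTo F G ↔ ∀ U : Opens X, coin (G.event U) ≤
    liminf (fun n => coin ((F n).preimage U ∩ G.event U)) atTop := by
  refine forall_congr' fun U => ?_
  simp only [LowerMeasurable.measure_eq]
  have h : ∀ n, coin ((LowerMeasurable.ofOpen ((F n).preimage U)).inter (G.preimage U)).toSet =
      coin ((F n).preimage U ∩ G.event U) := fun n =>
    measure_congr ((LowerMeasurable.toSet_inter _ _).trans
      ((LowerMeasurable.toSet_ofOpen _).inter (ae_eq_refl _)))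
  simp only [h]
  rfl

/-- If `G` lay in `V` while all `F n` with `n ≥ N` missed `V` on a set of positive measure, that
measure would be lost from the lower limit in the definition of convergence. -/
theorem ConvergesTo.ae_frequently (h : ConvergesTo F G) (V : Opens X) :
    ∀ᵐ ω ∂coin, ω ∈ G.event V → ∃ᶠ m in atTop, ω ∈ (F m).preimage V := by
  have hN : ∀ N, coin (G.event V ∩ ⋂ n ≥ N, ((F n).preimage V : Set Cantor)ᶜ) = 0 := by
    intro N
    set B := G.event V ∩ ⋂ n ≥ N, ((F n).preimage V : Set Cantor)ᶜ with hB
    have h1 : ∀ᶠ n in atTop, coin ((F n).preimage V ∩ G.event V) ≤ coin (G.event V) - coin B := by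
      filter_upwards [eventually_ge_atTop N] with n hn
      refine ENNReal.le_sub_of_add_le_right (measure_ne_top _ _) ?_
      rw [← measure_inter_add_sdiff (G.event V) ((F n).preimage V).isOpen.measurableSet]
      refine add_le_add (measure_mono fun ω hω => ⟨hω.2, hω.1⟩) (measure_mono fun ω hω => ?_)
      exact ⟨hω.1, Set.mem_iInter₂.1 hω.2 n hn⟩
    have h2 := (convergesTo_iff.1 h V).trans (liminf_le_liminf h1)
    rw [liminf_const] at h2
    by_contra hne
    exact (ENNReal.sub_lt_self (measure_ne_top _ _) (fun h0 => hne (le_antisymm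
      ((measure_mono Set.inter_subset_left).trans h0.le) bot_le)) hne).not_ge h2
  filter_upwards [ae_all_iff.2 fun N => measure_eq_zero_iff_ae_notMem.1 (hN N)] with ω hω hV
  refine frequently_atTop.2 fun N => ?_
  by_contra! hc
  exact hω N ⟨hV, Set.mem_iInter₂.2 fun n hn => hc n hn⟩

/-- A cover of `U` is refined to the sets `inner (V j) l`. If `G` lies in one of them, the sequence
visits it infinitely often, and slow variation keeps it in `V j` from some index on. -/
theorem ConvergesTo.isLimitEvent [Nonempty X] (hδ : IsContinuousNaming δ) (hF : FastCauchy F)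
    (h : ConvergesTo F G) : IsLimitEvent F G.event := by
  have hb : ∀ (U : Opens X) (V : ℕ → Opens X), (∀ x ∈ U, ∃ j, x ∈ V j) →
      ∀ᵐ ω ∂coin, ω ∈ G.event U → ∃ j, ω ∈ eventually F (V j) := by
    intro U V hV
    have hcov : ∀ x ∈ U, ∃ z : ℕ × ℕ, x ∈ inner (V z.1) z.2 := fun x hx => by
      obtain ⟨j, hj⟩ := hV x hx
      obtain ⟨l, hl⟩ := exists_mem_inner hj
      exact ⟨(j, l), hl⟩
    filter_upwards [G.event_le_iUnion hδ hcov, ae_mem_dom F, ae_exists_notMem_badEvent hF,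
      ae_all_iff.2 fun z : ℕ × ℕ => h.ae_frequently (inner (V z.1) z.2)] with ω h1 hdom hbad h2 hU
    obtain ⟨n, hn⟩ := hbad
    obtain ⟨z, hz⟩ := Set.mem_iUnion.1 (h1 hU)
    exact ⟨z.1, exists_mem_eventually_of_frequently hdom hn (h2 z hz)⟩
  refine ⟨fun U l => ?_, hb⟩
  -- `U` and `V` cover the space, so `G` lies almost surely in one of them. By `hb`, lying in `V`
  -- would force the sequence eventually into `V`, which is disjoint from `inner U l`.
  let V : Opens X := ⟨(closure (inner U l : Set X))ᶜ, isClosed_closure.isOpen_compl⟩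
  have hUV : U ⊔ V = ⊤ := by
    refine eq_top_iff.2 fun x _ => ?_
    by_cases hx : x ∈ closure (inner U l : Set X)
    · refine Or.inl (by_contra fun hxU => ?_)
      have h1 : closure (inner U l : Set X) ⊆
          {x | ENNReal.ofReal (2⁻¹ ^ l) ≤ Metric.infEDist x (U : Set X)ᶜ} :=
        closure_minimal (fun y hy => le_of_lt (mem_inner.1 hy))
          (isClosed_le continuous_const Metric.continuous_infEDist)
      have h2 : ENNReal.ofReal (2⁻¹ ^ l) ≤ Metric.infEDist x (U : Set X)ᶜ := h1 hx
      rw [Metric.infEDist_zero_of_mem (show x ∈ (U : Set X)ᶜ from hxU), nonpos_iff_eq_zero,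
        ENNReal.ofReal_eq_zero] at h2
      have : (0 : ℝ) < 2⁻¹ ^ l := by positivity
      linarith
    · exact Or.inr hx
  have h1 := G.event_union U V
  rw [hUV] at h1
  filter_upwards [h1.mem_iff, G.event_top.mem_iff, hb V (fun _ => V) fun x hx => ⟨0, hx⟩]
    with ω h1 h2 h3 hin
  refine (h1.1 (h2.2 trivial)).resolve_right fun hV => ?_
  obtain ⟨-, hj⟩ := h3 hV
  obtain ⟨m, hm1, hm2⟩ := (Eventually.and hin hj).exists
  exact ((mem_preimage _).1 hm2).2 (subset_closure ((mem_preimage _).1 hm1).2)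

/-- In a complete space the limit of a fast Cauchy sequence exists almost surely. -/
theorem isLimitEvent_tendsto [Nonempty X] [CompleteSpace X] (hF : FastCauchy F) :
    IsLimitEvent F fun U => {ω | ∃ x ∈ U, Tendsto (fun m => (F m).eval ω) atTop (nhds x)} where
  of_eventually_inner U l := by
    filter_upwards [ae_mem_dom F, ae_exists_notMem_badEvent hF] with ω hdom ⟨n, hn⟩ h
    obtain ⟨x, hx⟩ := cauchySeq_tendsto_of_complete (cauchySeq_eval hdom hn)
    refine ⟨x, by_contra fun hxU => ?_, hx⟩
    have h1 : ENNReal.ofReal (2⁻¹ ^ l) ≤ Metric.infEDist x (U : Set X)ᶜ :=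
      ge_of_tendsto ((Metric.continuous_infEDist.tendsto x).comp hx)
        (Eventually.mono h fun m hm => le_of_lt (mem_inner.1 ((mem_preimage _).1 hm).2))
    rw [Metric.infEDist_zero_of_mem (show x ∈ (U : Set X)ᶜ from hxU), nonpos_iff_eq_zero,
      ENNReal.ofReal_eq_zero] at h1
    have : (0 : ℝ) < 2⁻¹ ^ l := by positivity
    linarith
  exists_eventually U V hV := by
    filter_upwards [ae_mem_dom F] with ω hdom
    rintro ⟨x, hx, hlim⟩
    obtain ⟨j, hj⟩ := hV x hx
    exact ⟨j, Eventually.mono (hlim.eventually ((V j).isOpen.mem_nhds hj))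
      fun m hm => (mem_preimage _).2 ⟨hdom m, hm⟩⟩

/-- With `U` itself as a constant cover, almost every point of `G.event U` has its sequence
eventually in `U`; continuity of the measure from below then gives the lower limit. -/
theorem convergesTo_of_isLimitEvent [Nonempty X] {E : Opens X → Set Cantor}
    (hE : IsLimitEvent F E) (hG : ∀ U, G.event U =ᵐ[coin] E U) : ConvergesTo F G := by
  refine convergesTo_iff.2 fun U => ?_
  let A : ℕ → Set Cantor := fun N => (⋂ n ≥ N, ((F n).preimage U : Set Cantor)) ∩ G.event U
  have hA : Monotone A := fun M N hMN ω hω =>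
    ⟨Set.mem_iInter₂.2 fun n hn => Set.mem_iInter₂.1 hω.1 n (hMN.trans hn), hω.2⟩
  have h1 : G.event U ≤ᵐ[coin] (⋃ N, A N : Set Cantor) := by
    filter_upwards [(hG U).mem_iff, hE.exists_eventually U (fun _ => U) fun x hx => ⟨0, hx⟩]
      with ω h1 h2 h3
    obtain ⟨-, hev⟩ := h2 (h1.1 h3)
    obtain ⟨N, hN⟩ := eventually_atTop.1 hev
    exact Set.mem_iUnion.2 ⟨N, Set.mem_iInter₂.2 fun n hn => hN n hn, h3⟩
  refine (measure_mono_ae h1).trans ?_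
  rw [hA.measure_iUnion]
  refine iSup_le fun N => le_liminf_of_le (by isBoundedDefault) ?_
  filter_upwards [eventually_ge_atTop N] with n hn
  exact measure_mono fun ω hω => ⟨Set.mem_iInter₂.1 hω.1 n hn, hω.2⟩

/-! ### Names of simple random variables -/

theorem IsSimple.isOpen_fiber {F : PiecewiseContinuous X} (hF : F.IsSimple) (x : X) :
    IsOpen (F.toFun ⁻¹' {x}) := by
  have h : IsClosed (Set.range F.toFun \ {x}) := (Set.Finite.sdiff hF).isClosed
  have h' := (h.preimage F.continuous_toFun).isOpen_compl
  convert h' using 1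
  ext ω
  simp

/-- A simple variable is locally constant on its domain: the realizer waits until the word read
determines the value, then copies a fixed name of it. No computability is needed, only that the
sequence in the completeness statement has some name. -/
theorem IsSimple.exists_realizer {F : PiecewiseContinuous X} (hF : F.IsSimple)
    (hδ : ∀ x, ∃ q, δ q x) :
    ∃ e, Realizes (fun q (ω : F.dom) => cantorNaming q ω) δ e F.toFun := by
  classical
  choose nm hnm using hδ
  let C : List ℕ → X → Prop := fun w x =>
    (∃ ω : F.dom, pre (cantorName ω) w.length = w) ∧
      ∀ ω : F.dom, pre (cantorName ω) w.length = w → F.toFun ω = x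
  let e : Name := fun m =>
    if h : ∃ x, C ((Encodable.decode m.unpair.2).getD []) x then nm h.choose m.unpair.1 + 1 else 0
  refine ⟨e, fun q ω hq => ?_⟩
  obtain rfl := cantorNaming_iff.1 hq
  have hC : ∃ k, ∃ x, C (pre (cantorName ω) k) x := by
    have hopen := F.dom.isOpen.isOpenMap_subtype_val _ (hF.isOpen_fiber (F.toFun ω))
    obtain ⟨k, hk⟩ := exists_cylinder_subset (U := ⟨_, hopen⟩) (ω := ω) ⟨ω, rfl, rfl⟩
    refine ⟨k, F.toFun ω, ⟨ω, by simp⟩, fun ω' hω' => ?_⟩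
    rw [length_pre] at hω'
    obtain ⟨ω'', h1, h2⟩ := hk ω' (pre_cantorName_eq.1 hω')
    rwa [Subtype.ext h2] at h1
  have he : ∀ n k, e (Nat.pair n (wordCode (cantorName ω) k)) =
      if ∃ x, C (pre (cantorName ω) k) x then nm (F.toFun ω) n + 1 else 0 := by
    intro n k
    simp only [e, wordCode_eq, Nat.unpair_pair, Encodable.encodek, Option.getD_some]
    split_ifs with h
    · rw [← h.choose_spec.2 ω (by simp)]
    · rfl
  refine ⟨nm (F.toFun ω), fun n => ⟨Nat.find hC, ?_, fun j hj => ?_⟩, hnm _⟩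
  · rw [he, if_pos (Nat.find_spec hC)]
  · rw [he, if_neg (Nat.find_min hC hj)]

theorem IsSimple.exists_name {F : PiecewiseContinuous X} (hF : F.IsSimple)
    (hδ : ∀ x, ∃ q, δ q x) : ∃ p, PiecewiseContinuous.naming δ p F := by
  obtain ⟨u, hu⟩ := exists_openName isContinuousNaming_cantor F.dom
  obtain ⟨e, he⟩ := hF.exists_realizer hδ
  exact ⟨joinName u e, by simpa using hu, by simpa using he⟩

end PiecewiseContinuous

/-! ### Existence and uniqueness of limits -/

open PiecewiseContinuous

theorem exists_sequence_name {X : Type*} {δ : Naming X} {F : ℕ → X} (h : ∀ n, ∃ p, δ p (F n)) :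
    ∃ p, ∀ n, δ (seqName p n) (F n) := by
  choose p hp using h
  refine ⟨fun m => p m.unpair.1 m.unpair.2, fun n => ?_⟩
  have : seqName (fun m => p m.unpair.1 m.unpair.2) n = p n := by
    funext k
    simp [seqName]
  rw [this]
  exact hp n

theorem LowerMeasurable.ext_toSet {W W' : LowerMeasurable} (h : W.toSet =ᵐ[coin] W'.toSet) :
    W = W' := by
  exact (mk_out W).symm.trans (mk_eq_iff.2 h)

/-- The random variable is the almost sure pointwise limit. Fed with any name of the sequence,
`exists_limit_machine` yields both the lower-measurability of its events and the required continuous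
realizer. -/
theorem exists_limit_of_complete {X : Type*} [MetricSpace X] [Nonempty X] [CompleteSpace X]
    {δ : Naming X} (hX : IsComputableMetricSpace δ) {F : ℕ → PiecewiseContinuous X}
    (hs : ∀ n, (F n).IsSimple) (hF : FastCauchy F) :
    ∃ G : RandomVariable δ, ConvergesTo F G := by
  obtain ⟨e, -, he⟩ := exists_limit_machine hX
  obtain ⟨p, hp⟩ := exists_sequence_name fun n => (hs n).exists_name hX.isRepresentation.surjective
  obtain ⟨r, -, hr⟩ := he p F hp hF
  let E : Opens X → Set Cantor := fun U =>
    {ω | ∃ x ∈ U, Tendsto (fun m => (F m).eval ω) atTop (nhds x)}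
  have hE : IsLimitEvent F E := isLimitEvent_tendsto hF
  have hr := hr E hE
  have hS : ∀ U, ∃ S : LowerSeq, S.lim =ᵐ[coin] E U := fun U => by
    obtain ⟨u, hu⟩ := exists_openName (isContinuousNaming_of_dist hX.dist_computable) U
    obtain ⟨-, -, S, hS, -⟩ := hr u U hu
    exact ⟨S, hS⟩
  choose S hS using hS
  let W : Opens X → LowerMeasurable := fun U => Quotient.mk _ (S U)
  have hW : ∀ U, (W U).toSet =ᵐ[coin] E U := fun U => (LowerMeasurable.toSet_mk _).trans (hS U)
  have hEU : ∀ U V, E (U ⊔ V) = E U ∪ E V := fun U V => by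
    ext ω
    constructor
    · rintro ⟨x, hx | hx, h⟩
      · exact Or.inl ⟨x, hx, h⟩
      · exact Or.inr ⟨x, hx, h⟩
    · rintro (⟨x, hx, h⟩ | ⟨x, hx, h⟩)
      · exact ⟨x, Or.inl hx, h⟩
      · exact ⟨x, Or.inr hx, h⟩
  have hEI : ∀ U V, E (U ⊓ V) = E U ∩ E V := fun U V => by
    ext ω
    constructor
    · rintro ⟨x, hx, h⟩
      exact ⟨⟨x, hx.1, h⟩, ⟨x, hx.2, h⟩⟩
    · rintro ⟨⟨x, hx, h⟩, ⟨y, hy, h'⟩⟩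
      rw [tendsto_nhds_unique h' h] at hy
      exact ⟨x, ⟨hx, hy⟩, h⟩
  refine ⟨⟨W, ⟨r, fun u U hu => ?_⟩, ?_, ?_, fun U V => ?_, fun U V => ?_⟩, ?_⟩
  · obtain ⟨s, h1, S', h2, h3⟩ := hr u U hu
    exact ⟨s, h1, S', LowerMeasurable.mk_eq_mk.2 (h2.trans (hS U).symm), h3⟩
  · refine LowerMeasurable.ext_toSet ((hW ⊥).trans ?_)
    refine EventuallyEq.trans (Eventually.of_forall fun ω => ?_)
      (LowerMeasurable.toSet_ofOpen ⊥).symm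
    exact propext ⟨fun ⟨_, hx, _⟩ => hx, fun h => h.elim⟩
  · refine LowerMeasurable.ext_toSet ((hW ⊤).trans ?_)
    refine EventuallyEq.trans ?_ (LowerMeasurable.toSet_ofOpen ⊤).symm
    filter_upwards [ae_mem_dom F, ae_exists_notMem_badEvent hF] with ω hdom ⟨n, hn⟩
    obtain ⟨x, hx⟩ := cauchySeq_tendsto_of_complete (cauchySeq_eval hdom hn)
    exact propext ⟨fun _ => trivial, fun _ => ⟨x, trivial, hx⟩⟩
  · refine LowerMeasurable.ext_toSet ((hW _).trans ?_)
    rw [hEI]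
    exact ((hW U).inter (hW V)).symm.trans (LowerMeasurable.toSet_inter _ _).symm
  · refine LowerMeasurable.ext_toSet ((hW _).trans ?_)
    rw [hEU]
    exact ((hW U).union (hW V)).symm.trans (LowerMeasurable.toSet_union _ _).symm
  · exact convergesTo_of_isLimitEvent hE hW

theorem exists_preimage_machine {X : Type*} [MetricSpace X] [Nonempty X] {δ : Naming X}
    (hX : IsComputableMetricSpace δ) :
    ∃ e : Name, Computable e ∧ ∀ C : Set (PiecewiseContinuous X),
      Realizes (limitNaming δ C) (preimageNaming δ) e id := by
  obtain ⟨e, he, hlim⟩ := exists_limit_machine hX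
  refine ⟨e, he, fun C p G => ?_⟩
  rintro ⟨F, -, hF, hG, hp⟩
  obtain ⟨r, h1, h2⟩ := hlim p F hp hF
  refine ⟨r, h1, fun u U hu => ?_⟩
  obtain ⟨s, h3, S, h4, h5⟩ := h2 G.event
    (hG.isLimitEvent (isContinuousNaming_of_dist hX.dist_computable) hF) u U hu
  exact ⟨s, h3, S, LowerMeasurable.mk_eq_iff.2 h4, h5⟩

/-- The machine turns `p` into a single name of both preimage maps, and such a name determines the
random variable. -/
theorem limitNaming_functional {X : Type*} [MetricSpace X] [Nonempty X] {δ : Naming X}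
    (hX : IsComputableMetricSpace δ) {C : Set (PiecewiseContinuous X)} {p : Name}
    {G G' : RandomVariable δ} (h : limitNaming δ C p G) (h' : limitNaming δ C p G') : G = G' := by
  obtain ⟨e, -, he⟩ := exists_preimage_machine hX
  obtain ⟨r, h1, h2⟩ := he C p G h
  obtain ⟨r', h3, h4⟩ := he C p G' h'
  rw [h3.unique h1] at h4
  exact (isRepresentation_preimageNaming
    (isContinuousNaming_of_dist hX.dist_computable)).functional r G G' h2 h4

/-! ### Cylinders of the base space -/

/-- The number whose binary digits are the first `N` symbols of `ω`. -/
def idx (N : ℕ) (ω : Cantor) : ℕ := Nat.ofBits fun i : Fin N => ω i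

theorem idx_lt (N : ℕ) (ω : Cantor) : idx N ω < 2 ^ N := Nat.ofBits_lt_two_pow _

theorem testBit_idx {N i : ℕ} (h : i < N) (ω : Cantor) : (idx N ω).testBit i = ω i :=
  Nat.testBit_ofBits_lt _ i h

theorem idx_eq_iff {N a : ℕ} (ha : a < 2 ^ N) {ω : Cantor} :
    idx N ω = a ↔ ∀ i < N, ω i = a.testBit i := by
  constructor
  · rintro rfl i hi
    exact (testBit_idx hi ω).symm
  · intro h
    refine Nat.eq_of_testBit_eq fun i => ?_
    rcases lt_or_ge i N with hi | hi
    · rw [testBit_idx hi, h i hi]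
    · rw [Nat.testBit_lt_two_pow ((idx_lt N ω).trans_le (Nat.pow_le_pow_right (by norm_num) hi)),
        Nat.testBit_lt_two_pow (ha.trans_le (Nat.pow_le_pow_right (by norm_num) hi))]

theorem idx_eq_idx {N : ℕ} {ω ω' : Cantor} : idx N ω' = idx N ω ↔ ∀ i < N, ω' i = ω i := by
  rw [idx_eq_iff (idx_lt N ω)]
  exact forall₂_congr fun i hi => by rw [testBit_idx hi]

/-- The first symbol is the least significant digit, so truncating a word is reduction modulo a
power of two. -/
theorem idx_mod {N M : ℕ} (h : N ≤ M) (ω : Cantor) : idx M ω % 2 ^ N = idx N ω := by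
  refine ((idx_eq_iff (Nat.mod_lt _ (by positivity))).2 fun i hi => ?_).symm
  rw [Nat.testBit_mod_two_pow, testBit_idx (hi.trans_le h)]
  simp [hi]

/-- The binary word of length `M` with number `a`. -/
def binWord (a M : ℕ) : List ℕ := (List.range M).map fun i => a / 2 ^ i % 2

theorem primrec_binWord : Primrec fun x : ℕ × ℕ => binWord x.1 x.2 :=
  Primrec.list_map (by fun_prop)
    (show Primrec fun z : (ℕ × ℕ) × ℕ => z.1.1 / 2 ^ z.2 % 2 by fun_prop)

theorem binWord_idx (M : ℕ) (ω : Cantor) : binWord (idx M ω) M = pre (cantorName ω) M := by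
  refine List.map_congr_left fun i hi => ?_
  rw [← Nat.toNat_testBit, testBit_idx (List.mem_range.1 hi)]
  rfl

/-- The number of a binary word. -/
def wordIdx (w : List ℕ) : ℕ := w.foldr (fun b a => 2 * a + b) 0

theorem primrec_wordIdx : Primrec wordIdx :=
  Primrec.list_foldr (f := fun w : List ℕ => w) (g := fun _ => 0)
    (h := fun _ (x : ℕ × ℕ) => 2 * x.2 + x.1) (by fun_prop) (by fun_prop)
    (show Primrec fun z : List ℕ × ℕ × ℕ => 2 * z.2.2 + z.2.1 by fun_prop)

theorem wordIdx_pre (N : ℕ) (ω : Cantor) : wordIdx (pre (cantorName ω) N) = idx N ω := by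
  induction N generalizing ω with
  | zero => rfl
  | succ N ih =>
    have h1 : pre (cantorName ω) (N + 1) =
        (ω 0).toNat :: pre (cantorName fun i => ω (i + 1)) N := by
      simp only [pre, List.range_succ_eq_map, List.map_cons, List.map_map]
      rfl
    have h2 := ih fun i => ω (i + 1)
    rw [h1, idx, Nat.ofBits_succ]
    simp only [wordIdx, List.foldr_cons] at h2 ⊢
    rw [h2]
    rfl

theorem continuous_idx (N : ℕ) : Continuous (idx N) :=
  (continuous_of_discreteTopology (f := fun f : Fin N → Bool => Nat.ofBits f)).comp
    (continuous_pi fun i => continuous_apply (i : ℕ))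

theorem measurable_idx (N : ℕ) : Measurable (idx N) := (continuous_idx N).measurable

theorem coin_idx_eq {N a : ℕ} (ha : a < 2 ^ N) : coin {ω | idx N ω = a} = 2⁻¹ ^ N := by
  have h : {ω : Cantor | idx N ω = a} =
      ((Finset.range N : Finset ℕ) : Set ℕ).pi fun i => {a.testBit i} := by
    ext ω
    simp only [Set.mem_pi, Finset.coe_range, Set.mem_Iio, Set.mem_singleton_iff]
    exact idx_eq_iff ha
  rw [h, coin, Measure.infinitePi_pi _ fun i _ => MeasurableSet.singleton _]
  simp

theorem coin_real_idx_mem {N : ℕ} {A : Finset ℕ} (hA : ∀ a ∈ A, a < 2 ^ N) :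
    coin.real {ω | idx N ω ∈ A} = A.card * 2⁻¹ ^ N := by
  have h : {ω : Cantor | idx N ω ∈ A} = ⋃ a ∈ A, {ω | idx N ω = a} := by
    ext ω; simp
  rw [h, measureReal_biUnion_finset]
  · rw [Finset.sum_congr rfl fun a ha => by rw [measureReal_def, coin_idx_eq (hA a ha)]]
    simp
  · intro a _ b _ hab
    exact Set.disjoint_left.2 fun ω h1 h2 => hab (h1.symm.trans h2)
  · exact fun a _ => measurable_idx N (MeasurableSet.singleton a)

/-! ### Approximation by simple functions -/

theorem exists_lt_coin_real_of_iUnion {A : ℕ → Set Cantor} (hA : Monotone A) {c : ℝ}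
    (h : c < coin.real (⋃ n, A n)) (m : ℕ) : ∃ n ≥ m, c < coin.real (A n) := by
  rcases lt_or_ge c 0 with hc | hc
  · exact ⟨m, le_rfl, hc.trans_le measureReal_nonneg⟩
  rw [measureReal_def, ← ENNReal.ofReal_lt_iff_lt_toReal hc (measure_ne_top _ _),
    hA.measure_iUnion, lt_iSup_iff] at h
  obtain ⟨n, hn⟩ := h
  refine ⟨max m n, le_max_left _ _, ?_⟩
  rw [measureReal_def, ← ENNReal.ofReal_lt_iff_lt_toReal hc (measure_ne_top _ _)]
  exact hn.trans_le (measure_mono (hA (le_max_right _ _)))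

theorem LowerSeq.coin_real_sdiff_le (S : LowerSeq) (n : ℕ) :
    coin.real (S.set n \ S.lim) ≤ 2⁻¹ ^ n := by
  have h1 : coin (S.set n \ S.lim) ≤ 2⁻¹ ^ n := by
    rw [measure_sdiff (S.lim_subset n) S.measurableSet_lim.nullMeasurableSet (measure_ne_top _ _)]
    exact tsub_le_iff_left.2 (S.coin_set_le n)
  have h2 := ENNReal.toReal_mono (by finiteness) h1
  simpa [measureReal_def] using h2

/-- The limit is close in measure to a late stage, and an open stage is the increasing union of the
cylinders of length `N` contained in it. -/
theorem LowerSeq.exists_clopen_approx (S : LowerSeq) {η : ℝ} (hη : 0 < η) :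
    ∃ (N : ℕ) (c : ℕ → Prop), coin.real ({ω | c (idx N ω) ∧ ω ∉ S.lim} ∪
      {ω | ¬ c (idx N ω) ∧ ω ∈ S.lim}) < η := by
  obtain ⟨n, hn⟩ := exists_pow_lt_of_lt_one (half_pos hη) (by norm_num : (2⁻¹ : ℝ) < 1)
  let A : ℕ → Set Cantor := fun N => {ω | ∀ ω', idx N ω' = idx N ω → ω' ∈ S.set n}
  have hA : Monotone A := fun M N hMN ω hω ω' h => hω ω'
    (idx_eq_idx.2 fun i hi => idx_eq_idx.1 h i (hi.trans_le hMN))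
  have hU : ⋃ N, A N = (S.set n : Set Cantor) := by
    ext ω
    rw [Set.mem_iUnion]
    constructor
    · rintro ⟨N, hN⟩
      exact hN ω rfl
    · intro hω
      obtain ⟨N, hN⟩ := exists_cylinder_subset hω
      exact ⟨N, fun ω' h => hN ω' (idx_eq_idx.1 h)⟩
  obtain ⟨N, -, hN⟩ := exists_lt_coin_real_of_iUnion hA
    (sub_lt_self (coin.real (⋃ N, A N)) (half_pos hη)) 0
  rw [hU] at hN
  have hAm : MeasurableSet (A N) := measurable_idx N
    (show MeasurableSet {a | ∀ ω', idx N ω' = a → ω' ∈ S.set n} from trivial)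
  have hsub : A N ⊆ S.set n := hU ▸ Set.subset_iUnion A N
  refine ⟨N, fun a => ∀ ω', idx N ω' = a → ω' ∈ S.set n, ?_⟩
  have h1 : ({ω | (∀ ω', idx N ω' = idx N ω → ω' ∈ S.set n) ∧ ω ∉ S.lim} ∪
      {ω | ¬ (∀ ω', idx N ω' = idx N ω → ω' ∈ S.set n) ∧ ω ∈ S.lim} : Set Cantor) ⊆
      (S.set n \ S.lim) ∪ (S.set n \ A N) := by
    rintro ω (⟨h1, h2⟩ | ⟨h1, h2⟩)
    · exact Or.inl ⟨h1 ω rfl, h2⟩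
    · exact Or.inr ⟨S.lim_subset n h2, h1⟩
  have h2 := (measureReal_mono (μ := coin) h1).trans (measureReal_union_le _ _)
  rw [measureReal_sdiff (s₁ := (S.set n : Set Cantor)) hsub hAm] at h2
  have h3 := S.coin_real_sdiff_le n
  linarith

/-- Finitely many symbols almost suffice to select a set containing `ω`. In the induction, index `m`
is selected on a clopen approximation of `(S m).lim`, and the earlier choice is kept elsewhere; each
costs `η / 2`. -/
theorem exists_simple_approx (S : ℕ → LowerSeq) (m : ℕ) {η : ℝ} (hη : 0 < η) :
    ∃ (N : ℕ) (h : ℕ → ℕ),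
      coin.real {ω | (∃ i < m, ω ∈ (S i).lim) ∧ ω ∉ (S (h (idx N ω))).lim} < η := by
  classical
  induction m generalizing η with
  | zero => exact ⟨0, id, by simpa using hη⟩
  | succ m ih =>
    obtain ⟨N, h, hN⟩ := ih (half_pos hη)
    obtain ⟨N', c, hc⟩ := (S m).exists_clopen_approx (half_pos hη)
    refine ⟨max N N', fun a => if c (a % 2 ^ N') then m else h (a % 2 ^ N), ?_⟩
    have hsub : {ω | (∃ i < m + 1, ω ∈ (S i).lim) ∧ ω ∉ (S (if c (idx (max N N') ω % 2 ^ N') then m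
        else h (idx (max N N') ω % 2 ^ N))).lim} ⊆
        {ω | (∃ i < m, ω ∈ (S i).lim) ∧ ω ∉ (S (h (idx N ω))).lim} ∪
        ({ω | c (idx N' ω) ∧ ω ∉ (S m).lim} ∪ {ω | ¬ c (idx N' ω) ∧ ω ∈ (S m).lim}) := by
      rintro ω ⟨⟨i, hi, hωi⟩, h2⟩
      rw [idx_mod (le_max_left _ _), idx_mod (le_max_right _ _)] at h2
      split_ifs at h2 with hcω
      · exact Or.inr (Or.inl ⟨hcω, h2⟩)
      · by_cases hm : ω ∈ (S m).lim
        · exact Or.inr (Or.inr ⟨hcω, hm⟩)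
        · refine Or.inl ⟨⟨i, lt_of_le_of_ne (Nat.le_of_lt_succ hi) ?_, hωi⟩, h2⟩
          rintro rfl
          exact hm hωi
    exact ((measureReal_mono hsub).trans (measureReal_union_le _ _)).trans_lt (by linarith)

/-! ### Convergence of simple approximations -/

/-- The open ball of radius `2⁻ᴷ`. -/
def dyadicBall {X : Type*} [MetricSpace X] (x : X) (K : ℕ) : Opens X :=
  ⟨Metric.ball x (2⁻¹ ^ K), Metric.isOpen_ball⟩

theorem mem_dyadicBall {X : Type*} [MetricSpace X] {x y : X} {K : ℕ} :
    y ∈ dyadicBall x K ↔ dist y x < 2⁻¹ ^ K := Iff.rfl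

/-- If two values are further apart than the sum of their radii, `G` cannot lie in both balls, so
one of the two approximations is bad; this bounds the Fan distance by half of `2⁻¹ ^ min m n`. For
convergence, `U` is exhausted by `inner U l`, and for `n ≥ l` a ball of radius `2⁻¹ ^ (n + 2)`
centred outside `U` misses `inner U l`. -/
theorem convergesTo_of_good {X : Type*} [MetricSpace X] [Nonempty X] {δ : Naming X}
    (hδ : IsContinuousNaming δ) {G : RandomVariable δ} {F : ℕ → PiecewiseContinuous X}
    {ξ : ℕ → X} {g : ℕ → Cantor → ℕ} (hdom : ∀ k, (F k).dom = ⊤)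
    (hg : ∀ k ω, (F k).eval ω = ξ (g k ω))
    (hgood : ∀ k, coin {ω | ω ∉ G.event (dyadicBall (ξ (g k ω)) (k + 2))} ≤ 2⁻¹ ^ (k + 2)) :
    PiecewiseContinuous.FastCauchy F ∧ PiecewiseContinuous.ConvergesTo F G := by
  have hdisj : ∀ U V : Opens X, Disjoint (U : Set X) V →
      ∀ᵐ ω ∂coin, ω ∈ G.event U → ω ∉ G.event V := by
    intro U V hUV
    have h : U ⊓ V = ⊥ := Opens.ext (Set.disjoint_iff_inter_eq_empty.1 hUV)
    have h1 := G.event_inter U V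
    rw [h] at h1
    filter_upwards [h1.mem_iff, G.event_bot.mem_iff] with ω h1 h2 h3 h4
    exact h2.1 (h1.2 ⟨h3, h4⟩)
  have hpow : ∀ k : ℕ, ENNReal.ofReal (2⁻¹ ^ k) = 2⁻¹ ^ k := fun k => by
    rw [ENNReal.ofReal_pow (by norm_num), ENNReal.ofReal_inv_of_pos (by norm_num),
      ENNReal.ofReal_ofNat]
  constructor
  · intro m n
    have hpos : ∀ k : ℕ, (0 : ℝ) < 2⁻¹ ^ k := fun k => by positivity
    refine lt_of_le_of_lt (PiecewiseContinuous.fanDist_le (a := 2⁻¹ ^ (m + 2) + 2⁻¹ ^ (n + 2))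
      (by positivity) ?_) ?_
    · rw [ENNReal.ofReal_add (by positivity) (by positivity), hpow, hpow]
      refine le_trans (measure_mono_ae ?_) ((measure_union_le _ _).trans
        (add_le_add (hgood m) (hgood n)))
      -- The centres depend on `ω`, while disjoint balls have disjoint events only up to null sets;
      -- countably many pairs of centres leave one null set.
      have hae : ∀ᵐ ω ∂coin, ∀ i j, 2⁻¹ ^ (m + 2) + 2⁻¹ ^ (n + 2) ≤ dist (ξ i) (ξ j) →
          ω ∈ G.event (dyadicBall (ξ i) (m + 2)) → ω ∉ G.event (dyadicBall (ξ j) (n + 2)) := by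
        refine ae_all_iff.2 fun i => ae_all_iff.2 fun j => ?_
        by_cases h : 2⁻¹ ^ (m + 2) + 2⁻¹ ^ (n + 2) ≤ dist (ξ i) (ξ j)
        · filter_upwards [hdisj (dyadicBall (ξ i) (m + 2)) (dyadicBall (ξ j) (n + 2))
            (Metric.ball_disjoint_ball h)] with ω hω _ using hω
        · exact Eventually.of_forall fun ω h' => absurd h' h
      filter_upwards [hae] with ω hω hlt
      by_cases h1 : ω ∈ G.event (dyadicBall (ξ (g m ω)) (m + 2))
      · refine Or.inr (hω _ _ ?_ h1)
        have hlt' : 2⁻¹ ^ (m + 2) + 2⁻¹ ^ (n + 2) < dist ((F m).eval ω) ((F n).eval ω) := hlt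
        rw [hg, hg] at hlt'
        exact hlt'.le
      · exact Or.inl h1
    · have h1 := pow_le_pow_of_le_one (by norm_num : (0 : ℝ) ≤ 2⁻¹) (by norm_num)
        (min_le_left m n)
      have h2 := pow_le_pow_of_le_one (by norm_num : (0 : ℝ) ≤ 2⁻¹) (by norm_num)
        (min_le_right m n)
      have h3 := hpos (min m n)
      have h4 : ∀ k : ℕ, (2⁻¹ : ℝ) ^ (k + 2) = 2⁻¹ ^ k / 4 := fun k => by rw [pow_add]; ring
      rw [h4, h4]
      linarith
  · refine PiecewiseContinuous.convergesTo_iff.2 fun U => ?_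
    have hmono : Monotone (inner U) := fun l l' hll x hx => by
      rw [mem_inner] at hx ⊢
      exact hx.trans_le' (ENNReal.ofReal_le_ofReal
        (pow_le_pow_of_le_one (by norm_num) (by norm_num) hll))
    have hsup : ⨆ l, inner U l = U :=
      le_antisymm (iSup_le (inner_le U)) fun x hx => Opens.mem_iSup.2 (exists_mem_inner hx)
    have hle := G.coin_event_iSup_le hδ hmono
    rw [hsup] at hle
    refine hle.trans (iSup_le fun l => ?_)
    have hlim : Tendsto (fun n : ℕ => coin (G.event (inner U l)) - (2⁻¹ : ℝ≥0∞) ^ (n + 2)) atTop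
        (nhds (coin (G.event (inner U l)))) := by
      have h := ENNReal.Tendsto.sub (tendsto_const_nhds (x := coin (G.event (inner U l))))
        ((tendsto_add_atTop_iff_nat 2).2 LowerSeq.tendsto_pow) (Or.inl (measure_ne_top _ _))
      rwa [tsub_zero] at h
    rw [← hlim.liminf_eq]
    refine liminf_le_liminf ?_
    filter_upwards [eventually_ge_atTop l] with n hn
    rw [tsub_le_iff_right]
    refine (measure_mono_ae ?_).trans ((measure_union_le _ _).trans
      (add_le_add le_rfl (hgood n)))
    have hae : ∀ᵐ ω ∂coin, ∀ i, ξ i ∉ U → ω ∈ G.event (dyadicBall (ξ i) (n + 2)) →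
        ω ∉ G.event (inner U l) := by
      refine ae_all_iff.2 fun i => ?_
      by_cases hi : ξ i ∈ U
      · exact Eventually.of_forall fun ω h => absurd hi h
      · have hd : Disjoint (dyadicBall (ξ i) (n + 2) : Set X) (inner U l) := by
          refine Set.disjoint_left.2 fun y hy hy' => ?_
          have h1 := (mem_inner.1 hy').trans_le
            (Metric.infEDist_le_edist_of_mem (show ξ i ∈ (U : Set X)ᶜ from hi))
          rw [edist_dist, ENNReal.ofReal_lt_ofReal_iff_of_nonneg (by positivity)] at h1
          have h2 : dist y (ξ i) < 2⁻¹ ^ (n + 2) := hy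
          have h3 := pow_le_pow_of_le_one (by norm_num : (0 : ℝ) ≤ 2⁻¹) (by norm_num)
            (show l ≤ n + 2 by omega)
          linarith
        filter_upwards [hdisj _ _ hd] with ω hω _ using hω
    filter_upwards [hae, G.event_mono (inner_le U l)] with ω hω hωU hin
    by_cases h1 : ω ∈ G.event (dyadicBall (ξ (g n ω)) (n + 2))
    · refine Or.inl ⟨(PiecewiseContinuous.mem_preimage _).2 ⟨by rw [hdom]; trivial, ?_⟩, hωU hin⟩
      rw [hg]
      by_contra hc
      exact hω _ hc h1 hin
    · exact Or.inr h1

/-! ### A semidecidable criterion for good simple approximations -/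

theorem SemiDec.accepts {α : Type*} [Primcodable α] {U : Name → α → ℕ → ℕ → Prop}
    (hU : SemiDec fun p (x : α × ℕ × ℕ) => U p x.1 x.2.1 x.2.2) {n : α → ℕ} (hn : Primrec n)
    {w : α → List ℕ} (hw : Primrec w) :
    SemiDec fun p a => Accepts p (U p a) (n a) (wordRel (w a)) := by
  have h1 := SemiDec.app (E := fun p (_ : α) => graph p) (Q := U)
    (SemiDec.oracle (f := fun x : α × ℕ × ℕ => x.2.1) (by fun_prop) (by fun_prop)) hU
  have h2 := SemiDec.app
    (E := fun p (a : α) i v => App (graph p) (U p a) (Nat.pair (n a) i) v)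
    (Q := fun _ (a : α) => wordRel (w a))
    (h1.comp (g := fun x : α × ℕ × ℕ => (x.1, Nat.pair (n x.1) x.2.1, x.2.2)) (by fun_prop))
    (SemiDec.word hw)
  exact SemiDec.exists_nat (SemiDec.exists_nat (h2.comp
    (g := fun x : (α × ℕ) × ℕ => (x.1.1, x.1.2, x.2 + 1)) (by fun_prop)))

/-- Being in an open ball around `ξ i` is semidecidable by the distance test, uniformly in `i` and
`K`. The ball named is the same for every oracle `p`. -/
theorem exists_ball_names {X : Type*} [MetricSpace X] {δ : Naming X}
    (h : ComputableMap (prodNaming δ δ) realNaming (fun z => dist z.1 z.2)) {ξ : ℕ → X}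
    {t : ℕ → Name} (ht : ∀ i, δ (t i) (ξ i))
    (ht' : SemiDec fun _ (x : ℕ × ℕ × ℕ) => graph (t x.1) x.2.1 x.2.2) :
    ∃ B : Name → ℕ × ℕ → Name,
      (SemiDec fun p (x : (ℕ × ℕ) × ℕ × ℕ) => B p x.1 x.2.1 = x.2.2) ∧
      ∀ p i K, openNaming δ (B p (i, K)) (dyadicBall (ξ i) K) := by
  obtain ⟨D, hD, hDd⟩ := exists_dist_test h ht ht'
  have hg : SemiDec fun O (x : Unit × ℕ × ℕ) => graph O x.2.1 x.2.2 :=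
    SemiDec.oracle (by fun_prop) (by fun_prop)
  have hP : SemiDec fun O (x : ℕ × ℕ) => ∃ m, D (graph (sndName O)) x.1 x.2 m :=
    SemiDec.exists_nat ((hD Unit (fun O _ => graph (sndName O)) hg.snd).comp
      (g := fun z : (ℕ × ℕ) × ℕ => ((), z.1.1, z.1.2, z.2)) (by fun_prop))
  obtain ⟨B, hB, hB'⟩ := exists_sierpinski hP
  refine ⟨B, hB, fun p i K q x hq => ?_⟩
  obtain ⟨r, h1, h2⟩ := hB' p (i, K) q
  refine ⟨r, h1, Iff.symm (h2.trans ?_)⟩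
  simp only [sndName_join, hDd q x _ _ _ hq, mem_dyadicBall]
  constructor
  · rintro ⟨m, hm⟩
    exact hm.trans_le' (le_add_of_nonneg_right (by positivity))
  · intro h
    obtain ⟨m, hm⟩ := exists_pow_lt_of_lt_one (half_pos (sub_pos.2 h))
      (by norm_num : (2⁻¹ : ℝ) < 1)
    exact ⟨m, by linarith⟩

/-- Finite evidence that the simple function taking the value with index `I[idx N ω]` at `ω` is
`2⁻ᴷ`-close to the random variable with preimage map `p` with probability above `1 - 2⁻ᴷ`:
sufficiently many words `A` of length `M` are accepted. -/
def GoodCode (B : Name → ℕ × ℕ → Name) (p : Name) (K N : ℕ) (I : List ℕ) : Prop :=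
  ∃ (n M : ℕ) (A : List ℕ),
    (N ≤ M ∧ (∀ i < A.length, A.getD i 0 < 2 ^ M ∧ ∀ j < i, A.getD j 0 ≠ A.getD i 0) ∧
      2 ^ M * 2 ^ K * 2 ^ n + 2 ^ N * 2 ^ M * 2 ^ K < A.length * 2 ^ K * 2 ^ n + 2 ^ M * 2 ^ n) ∧
    ∀ i < A.length, Accepts p (graph (B p (I.getD (A.getD i 0 % 2 ^ N) 0, K))) n
      (wordRel (binWord (A.getD i 0) M))

theorem semiDec_goodCode {B : Name → ℕ × ℕ → Name}
    (hB : SemiDec fun p (x : (ℕ × ℕ) × ℕ × ℕ) => B p x.1 x.2.1 = x.2.2) :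
    SemiDec fun p (x : ℕ × ℕ × List ℕ) => GoodCode B p x.1 x.2.1 x.2.2 := by
  refine SemiDec.exists_nat (SemiDec.exists_nat (SemiDec.ex (SemiDec.and (SemiDec.of_primrec
    (PrimrecPred.and (PrimrecPred.le_apply (by fun_prop) (by fun_prop)) (PrimrecPred.and ?_
      (PrimrecPred.lt_apply (by fun_prop) (by fun_prop))))) (SemiDec.forall_lt
        (P := fun p (y : (((ℕ × ℕ × List ℕ) × ℕ) × ℕ) × List ℕ) i =>
          Accepts p (graph (B p (y.1.1.1.2.2.getD (y.2.getD i 0 % 2 ^ y.1.1.1.2.1) 0, y.1.1.1.1)))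
            y.1.1.2 (wordRel (binWord (y.2.getD i 0) y.1.2))) ?_ (by fun_prop)))))
  · refine PrimrecPred.forall_lt_apply (P := fun z : ((((ℕ × ℕ × List ℕ) × ℕ) × ℕ) × List ℕ) × ℕ =>
      z.1.2.getD z.2 0 < 2 ^ z.1.1.2 ∧ ∀ j < z.2, z.1.2.getD j 0 ≠ z.1.2.getD z.2 0)
      (PrimrecPred.and (PrimrecPred.lt_apply (by fun_prop) (by fun_prop)) ?_) (by fun_prop)
    exact PrimrecPred.forall_lt_apply
      (P := fun u : (((((ℕ × ℕ × List ℕ) × ℕ) × ℕ) × List ℕ) × ℕ) × ℕ =>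
        u.1.1.2.getD u.2 0 ≠ u.1.1.2.getD u.1.2 0)
      (PrimrecPred.eq_apply (by fun_prop) (by fun_prop)).not (by fun_prop)
  · refine SemiDec.accepts (U := fun p (z : ((((ℕ × ℕ × List ℕ) × ℕ) × ℕ) × List ℕ) × ℕ) =>
      graph (B p (z.1.1.1.1.2.2.getD (z.1.2.getD z.2 0 % 2 ^ z.1.1.1.1.2.1) 0, z.1.1.1.1.1)))
      (hB.comp (g := fun u : (((((ℕ × ℕ × List ℕ) × ℕ) × ℕ) × List ℕ) × ℕ) × ℕ × ℕ =>
        ((u.1.1.1.1.1.2.2.getD (u.1.1.2.getD u.1.2 0 % 2 ^ u.1.1.1.1.1.2.1) 0, u.1.1.1.1.1.1),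
          u.2)) (by fun_prop)) (by fun_prop) ?_
    exact primrec_binWord.comp (g := fun z : ((((ℕ × ℕ × List ℕ) × ℕ) × ℕ) × List ℕ) × ℕ =>
      (z.1.2.getD z.2 0, z.1.1.2)) (by fun_prop)

/-- Dividing by `2 ^ M * 2 ^ K * 2 ^ n` shows the meaning of the count: the accepted measure `a *
2⁻¹ ^ M` exceeds `1 - 2⁻¹ ^ K` by more than `2 ^ N * 2⁻¹ ^ n`. -/
theorem card_inequality_iff {a M K n N : ℕ} :
    2 ^ M * 2 ^ K * 2 ^ n + 2 ^ N * 2 ^ M * 2 ^ K < a * 2 ^ K * 2 ^ n + 2 ^ M * 2 ^ n ↔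
      (1 : ℝ) + 2 ^ N * 2⁻¹ ^ n < a * 2⁻¹ ^ M + 2⁻¹ ^ K := by
  rw [← Nat.cast_lt (α := ℝ)]
  push_cast
  simp only [inv_pow]
  have hM : (0 : ℝ) < 2 ^ M := by positivity
  have hK : (0 : ℝ) < 2 ^ K := by positivity
  have hn : (0 : ℝ) < 2 ^ n := by positivity
  generalize (2 : ℝ) ^ M = M' at *
  generalize (2 : ℝ) ^ K = K' at *
  generalize (2 : ℝ) ^ n = n' at *
  generalize (2 : ℝ) ^ N = N' at *
  have e1 : M' * K' * n' + N' * M' * K' = (1 + N' * n'⁻¹) * (M' * K' * n') := by field_simp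
  have e2 : (a : ℝ) * K' * n' + M' * n' = (a * M'⁻¹ + K'⁻¹) * (M' * K' * n') := by field_simp
  rw [e1, e2, mul_lt_mul_iff_left₀ (by positivity)]

theorem measurableSet_choice {S : ℕ → LowerSeq} {N : ℕ} {h : ℕ → ℕ} :
    MeasurableSet {ω | ω ∈ (S (h (idx N ω))).lim} := by
  have : {ω | ω ∈ (S (h (idx N ω))).lim} = ⋃ a, {ω | idx N ω = a} ∩ (S (h a)).lim := by
    ext ω; simp
  rw [this]
  exact MeasurableSet.iUnion fun a =>
    (measurable_idx N (MeasurableSet.singleton a)).inter (LowerSeq.measurableSet_lim _)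

/-- Accepted cylinders lie in the `n`-th stages rather than in the events themselves. At most `2 ^
N` stages occur, one for each value of `idx N`, and each exceeds its limit by at most `2⁻¹ ^ n`; the
count in `GoodCode` absorbs this error. -/
theorem GoodCode.coin_le {X : Type*} [MetricSpace X] {δ : Naming X} {G : RandomVariable δ}
    {ξ : ℕ → X} {B : Name → ℕ × ℕ → Name}
    (hB : ∀ p i K, openNaming δ (B p (i, K)) (dyadicBall (ξ i) K)) {p : Name}
    (hp : preimageNaming δ p G) {K N : ℕ} {I : List ℕ} (hI : GoodCode B p K N I) :
    coin {ω | ω ∉ G.event (dyadicBall (ξ (I.getD (idx N ω) 0)) K)} ≤ 2⁻¹ ^ K := by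
  obtain ⟨n, M, A, ⟨hNM, hA, hcard⟩, hacc⟩ := hI
  rw [card_inequality_iff] at hcard
  choose S hS hS' using fun i => RandomVariable.exists_lowerSeq hp (hB p i K)
  let h : ℕ → ℕ := fun a => I.getD a 0
  let L : Set Cantor := {ω | ω ∈ (S (h (idx N ω))).lim}
  have hnodup : A.Nodup := by
    refine List.nodup_iff_injective_getElem.2 fun i j hij => ?_
    have hne : ∀ i j : Fin A.length, j < i → A[(j : ℕ)] ≠ A[(i : ℕ)] := fun i j hji => by
      have := (hA i i.2).2 j hji
      rwa [List.getD_eq_getElem _ _ i.2, List.getD_eq_getElem _ _ j.2] at this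
    by_contra hc
    rcases lt_or_gt_of_ne hc with h1 | h1
    · exact hne _ _ h1 hij
    · exact hne _ _ h1 hij.symm
  have hmem : ∀ a ∈ A.toFinset, a < 2 ^ M ∧
      Accepts p (graph (B p (h (a % 2 ^ N), K))) n (wordRel (binWord a M)) := by
    intro a ha
    obtain ⟨i, hi, rfl⟩ := List.mem_iff_getElem.1 (List.mem_toFinset.1 ha)
    have h1 := (hA i hi).1
    have h2 := hacc i hi
    rw [List.getD_eq_getElem _ _ hi] at h1 h2
    exact ⟨h1, h2⟩
  have hcov : {ω | idx M ω ∈ A.toFinset} ⊆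
      L ∪ ⋃ a ∈ Finset.range (2 ^ N), ((S (h a)).set n \ (S (h a)).lim : Set Cantor) := by
    intro ω hω
    have h1 := (hmem _ hω).2
    rw [idx_mod hNM, binWord_idx] at h1
    have h2 := (hS' (h (idx N ω)) n ω).2
      (h1.mono (fun _ _ h => h) fun _ _ h => (wordRel_pre.1 h).2)
    by_cases hL : ω ∈ L
    · exact Or.inl hL
    · exact Or.inr (Set.mem_iUnion₂.2 ⟨idx N ω, Finset.mem_range.2 (idx_lt N ω), h2, hL⟩)
  have h1 : coin.real {ω | idx M ω ∈ A.toFinset} = A.length * 2⁻¹ ^ M := by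
    rw [coin_real_idx_mem fun a ha => (hmem a ha).1, List.toFinset_card_of_nodup hnodup]
  have h2 : coin.real (⋃ a ∈ Finset.range (2 ^ N),
      ((S (h a)).set n \ (S (h a)).lim : Set Cantor)) ≤ 2 ^ N * 2⁻¹ ^ n := by
    refine (measureReal_biUnion_finset_le _ _).trans
      ((Finset.sum_le_sum fun a _ => (S (h a)).coin_real_sdiff_le n).trans ?_)
    simp
  have h3 := (measureReal_mono (μ := coin) hcov).trans (measureReal_union_le _ _)
  have h4 : coin.real Lᶜ = 1 - coin.real L := probReal_compl_eq_one_sub measurableSet_choice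
  have h5 : coin.real Lᶜ ≤ 2⁻¹ ^ K := by linarith
  have h6 : coin Lᶜ ≤ 2⁻¹ ^ K := by
    rw [← ofReal_measureReal]
    refine (ENNReal.ofReal_le_ofReal h5).trans_eq ?_
    rw [ENNReal.ofReal_pow (by norm_num), ENNReal.ofReal_inv_of_pos (by norm_num),
      ENNReal.ofReal_ofNat]
  refine (measure_mono_ae ?_).trans h6
  filter_upwards [ae_all_iff.2 fun i => (hS i).mem_iff] with ω hω h7 h8
  exact h7 ((hω _).1 h8)

/-- Finitely many balls capture `G` up to less than `2⁻¹ ^ K / 2`, and selecting one of them from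
finitely many symbols loses less than the same amount. The strict inequality leaves room for the
stage error once `n` is large, and long words then exhaust the accepted points. -/
theorem exists_goodCode {X : Type*} [MetricSpace X] {δ : Naming X} (hδ : IsContinuousNaming δ)
    {G : RandomVariable δ} {ξ : ℕ → X} (hξ : DenseRange ξ) {B : Name → ℕ × ℕ → Name}
    (hB : ∀ p i K, openNaming δ (B p (i, K)) (dyadicBall (ξ i) K)) {p : Name}
    (hp : preimageNaming δ p G) (K : ℕ) : ∃ N I, GoodCode B p K N I := by
  classical
  choose S hS hS' using fun i => RandomVariable.exists_lowerSeq hp (hB p i K)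
  have hpos : (0 : ℝ) < 2⁻¹ ^ K := by positivity
  have hae : (⋃ m, {ω | ∃ i < m, ω ∈ (S i).lim} : Set Cantor) =ᵐ[coin] Set.univ := by
    have h1 := G.event_le_iUnion hδ (U := ⊤) (V := fun i => dyadicBall (ξ i) K) fun x _ =>
      hξ.exists_dist_lt x hpos
    filter_upwards [h1, G.event_top.mem_iff, ae_all_iff.2 fun i => (hS i).mem_iff] with ω h2 h3 h4
    refine propext ⟨fun _ => trivial, fun _ => ?_⟩
    obtain ⟨i, hi⟩ := Set.mem_iUnion.1 (h2 (h3.2 trivial))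
    exact Set.mem_iUnion.2 ⟨i + 1, i, Nat.lt_succ_self i, (h4 i).2 hi⟩
  obtain ⟨m, -, hm⟩ := exists_lt_coin_real_of_iUnion (A := fun m => {ω | ∃ i < m, ω ∈ (S i).lim})
    (fun m m' hmm ω ⟨i, hi, h⟩ => ⟨i, hi.trans_le hmm, h⟩) (c := 1 - 2⁻¹ ^ K / 2) (by
      rw [measureReal_congr hae, probReal_univ]; linarith) 0
  obtain ⟨N, h, hN⟩ := exists_simple_approx S m (half_pos hpos)
  let L : Set Cantor := {ω | ω ∈ (S (h (idx N ω))).lim}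
  have hL : 1 - 2⁻¹ ^ K < coin.real L := by
    have h1 : {ω | ∃ i < m, ω ∈ (S i).lim} ⊆
        {ω | (∃ i < m, ω ∈ (S i).lim) ∧ ω ∉ (S (h (idx N ω))).lim} ∪ L := fun ω hω => by
      by_cases hωL : ω ∈ L
      · exact Or.inr hωL
      · exact Or.inl ⟨hω, hωL⟩
    have h2 := (measureReal_mono (μ := coin) h1).trans (measureReal_union_le _ _)
    linarith
  obtain ⟨n, hn⟩ := exists_pow_lt_of_lt_one
    (show 0 < (coin.real L - (1 - 2⁻¹ ^ K)) / 2 ^ N from div_pos (by linarith) (by positivity))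
    (by norm_num : (2⁻¹ : ℝ) < 1)
  rw [lt_div_iff₀ (by positivity)] at hn
  let C : ℕ → Set Cantor := fun M => {ω | Accepts p (graph (B p (h (idx N ω), K))) n
    (wordRel (pre (cantorName ω) M))}
  have hC : Monotone C := fun M M' hMM ω hω =>
    Accepts.mono (fun _ _ h => h) (fun _ _ h => wordRel_pre_mono hMM h) hω
  have hLC : L ⊆ ⋃ M, C M := fun ω hω => by
    obtain ⟨M, hM⟩ := ((hS' (h (idx N ω)) n ω).1 (LowerSeq.lim_subset _ n hω)).exists_pre
    exact Set.mem_iUnion.2 ⟨M, hM.mono (fun _ _ h => (wordRel_pre.1 h).2) fun _ _ h => h⟩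
  -- The threshold is the one in `card_inequality_iff`; below, the measure of `C M` becomes the
  -- number of accepted words times `2⁻¹ ^ M`.
  obtain ⟨M, hNM, hM⟩ := exists_lt_coin_real_of_iUnion hC
    (c := 1 + 2 ^ N * 2⁻¹ ^ n - 2⁻¹ ^ K) (by
      have := measureReal_mono (μ := coin) hLC
      linarith) N
  let I : List ℕ := (List.range (2 ^ N)).map h
  have hI : ∀ a < 2 ^ N, I.getD a 0 = h a := fun a ha => by
    simp [I, List.getD, List.getElem?_range ha]
  let A : List ℕ := (List.range (2 ^ M)).filter fun a => decide (Accepts p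
    (graph (B p (h (a % 2 ^ N), K))) n (wordRel (binWord a M)))
  have hAm : ∀ a, a ∈ A ↔ a < 2 ^ M ∧ Accepts p (graph (B p (h (a % 2 ^ N), K))) n
      (wordRel (binWord a M)) := fun a => by simp [A]
  have hAnd : A.Nodup := List.nodup_range.filter _
  have hCA : C M = {ω | idx M ω ∈ A.toFinset} := by
    ext ω
    change _ ↔ idx M ω ∈ A.toFinset
    rw [List.mem_toFinset, hAm, idx_mod hNM, binWord_idx]
    exact ⟨fun h => ⟨idx_lt M ω, h⟩, fun h => h.2⟩
  rw [hCA, coin_real_idx_mem fun a ha => ((hAm a).1 (List.mem_toFinset.1 ha)).1,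
    List.toFinset_card_of_nodup hAnd] at hM
  refine ⟨N, I, n, M, A, ⟨hNM, fun i hi => ⟨?_, fun j hj => ?_⟩,
    card_inequality_iff.2 (by linarith)⟩, fun i hi => ?_⟩
  · rw [List.getD_eq_getElem _ _ hi]
    exact ((hAm _).1 (List.getElem_mem hi)).1
  · rw [List.getD_eq_getElem _ _ hi, List.getD_eq_getElem _ _ (hj.trans hi)]
    exact fun h => hj.ne ((hAnd.getElem_inj_iff).1 h)
  · rw [List.getD_eq_getElem _ _ hi, hI _ (Nat.mod_lt _ (by positivity))]
    exact ((hAm _).1 (List.getElem_mem hi)).2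

/-! ### Names of simple continuous random variables -/

/-- The simple continuous random variable with value `ξ (I[idx N ω])` at `ω`. -/
def simpleVar {X : Type*} [MetricSpace X] (ξ : ℕ → X) (N : ℕ) (I : List ℕ) :
    PiecewiseContinuous X where
  dom := ⊤
  coin_dom := measure_univ
  toFun ω := ξ (I.getD (idx N ω) 0)
  continuous_toFun := (continuous_of_discreteTopology (f := fun a => ξ (I.getD a 0))).comp
    ((continuous_idx N).comp continuous_subtype_val)

theorem simpleVar_isSimple {X : Type*} [MetricSpace X] (ξ : ℕ → X) (N : ℕ) (I : List ℕ) :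
    (simpleVar ξ N I).IsSimple := by
  refine ((Set.finite_Iio (2 ^ N)).image fun a => ξ (I.getD a 0)).subset ?_
  rintro _ ⟨ω, rfl⟩
  exact ⟨idx N ω, idx_lt N ω, rfl⟩

/-- Names of a sequence of simple random variables are computed from finite descriptions. -/
theorem exists_simpleVar_machine {X : Type*} [MetricSpace X] {δ : Naming X} {ξ : ℕ → X}
    {t : ℕ → Name} (ht : ∀ i, δ (t i) (ξ i))
    (ht' : SemiDec fun _ (x : ℕ × ℕ × ℕ) => graph (t x.1) x.2.1 x.2.2) :
    ∃ e : Name, Computable e ∧ ∀ d : Name, ∃ r, Applies e d r ∧ ∀ k (y : ℕ × List ℕ),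
      d k = Encodable.encode y → PiecewiseContinuous.naming δ (seqName r k) (simpleVar ξ y.1 y.2) := by
  let y : ℕ → ℕ × List ℕ := fun c => (Encodable.decode c).getD (0, [])
  let w : ℕ → List ℕ := fun j => (Encodable.decode j.unpair.2).getD []
  -- Even positions code the domain: the value `2` writes `1` before any input is read, so every
  -- point is accepted. Odd positions code the realizer: it waits for the number of symbols
  -- prescribed by the description, looks up the index they select, and copies the name of that
  -- point.
  let H : Name → Name := fun d m =>
    if m.unpair.2 % 2 = 0 then 2
    else if (w (m.unpair.2 / 2)).length < (y (d m.unpair.1)).1 then 0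
    else t ((y (d m.unpair.1)).2.getD
      (wordIdx ((w (m.unpair.2 / 2)).take (y (d m.unpair.1)).1)) 0)
      (m.unpair.2 / 2).unpair.1 + 1
  have hy : Primrec y := by fun_prop
  have hw : Primrec w := by fun_prop
  have hH : SemiDec fun d (x : ℕ × ℕ) => H d x.1 = x.2 := by
    have key : SemiDec fun d (x : ℕ × ℕ) => ∃ c, d x.1.unpair.1 = c ∧
        ((x.1.unpair.2 % 2 = 0 ∧ 2 = x.2) ∨ ((x.1.unpair.2 % 2 = 1 ∧
          (w (x.1.unpair.2 / 2)).length < (y c).1 ∧ 0 = x.2) ∨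
          ((x.1.unpair.2 % 2 = 1 ∧ (y c).1 ≤ (w (x.1.unpair.2 / 2)).length) ∧
          ∃ v, graph (t ((y c).2.getD (wordIdx ((w (x.1.unpair.2 / 2)).take (y c).1)) 0))
            (x.1.unpair.2 / 2).unpair.1 v ∧ v + 1 = x.2))) := by
      refine SemiDec.exists_nat (SemiDec.and (SemiDec.oracle (by fun_prop) (by fun_prop))
        (SemiDec.or (SemiDec.of_primrec (PrimrecPred.and ?_ ?_)) (SemiDec.or
          (SemiDec.of_primrec (PrimrecPred.and ?_ (PrimrecPred.and
            (PrimrecPred.lt_apply ?_ ?_) ?_)))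
          (SemiDec.and (SemiDec.of_primrec (PrimrecPred.and ?_ (PrimrecPred.le_apply ?_ ?_)))
            (SemiDec.exists_nat (SemiDec.and ?_ (SemiDec.of_primrec ?_))))))) <;>
        try first | fun_prop | exact PrimrecPred.eq_apply (by fun_prop) (by fun_prop)
      have h1 : Primrec fun z : ((ℕ × ℕ) × ℕ) × ℕ =>
          wordIdx ((w (z.1.1.1.unpair.2 / 2)).take (y z.1.2).1) :=
        primrec_wordIdx.comp (g := fun z : ((ℕ × ℕ) × ℕ) × ℕ =>
          (w (z.1.1.1.unpair.2 / 2)).take (y z.1.2).1) (by fun_prop)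
      exact ht'.comp (g := fun z : ((ℕ × ℕ) × ℕ) × ℕ => ((y z.1.2).2.getD
        (wordIdx ((w (z.1.1.1.unpair.2 / 2)).take (y z.1.2).1)) 0,
        (z.1.1.1.unpair.2 / 2).unpair.1, z.2)) (by fun_prop)
    refine key.of_iff fun d x => ?_
    simp only [H, graph]
    rcases Nat.mod_two_eq_zero_or_one x.1.unpair.2 with h | h
    · simp [h]
    · rcases lt_or_ge (w (x.1.unpair.2 / 2)).length (y (d x.1.unpair.1)).1 with h' | h'
      · simp [h, h', h'.not_ge]
      · simp [h, h', h'.not_gt]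
  obtain ⟨e, he, heH⟩ := exists_machine_of_total hH
  refine ⟨e, he, fun d => ⟨H d, heH d, fun k z hz => ⟨fun q ω hq => ?_, fun q ω hq => ?_⟩⟩⟩
  · refine ⟨fun _ => 1, fun n => ⟨0, ?_, by simp⟩, ?_⟩
    · simp [seqName, fstName, H]
    · exact ⟨fun _ => ⟨0, one_ne_zero⟩, fun _ => trivial⟩
  · obtain rfl := cantorNaming_iff.1 hq
    have hval : ∀ n j, sndName (seqName (H d) k) (Nat.pair n (wordCode (cantorName ω) j)) =
        if j < z.1 then 0 else
          t (z.2.getD (wordIdx (pre (cantorName ω) (min z.1 j))) 0) n + 1 := by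
      intro n j
      have h1 : ∀ m, (2 * m + 1) % 2 = 1 := fun m => by omega
      have h2 : ∀ m, (2 * m + 1) / 2 = m := fun m => by omega
      simp only [sndName, seqName, H, y, w, Nat.unpair_pair, hz, Encodable.encodek,
        Option.getD_some, h1, h2, wordCode_eq, length_pre, take_pre, one_ne_zero, if_false]
    refine ⟨t (z.2.getD (idx z.1 ω) 0), fun n => ⟨z.1, ?_, fun j hj => ?_⟩, ht _⟩
    · rw [hval, if_neg (lt_irrefl _), min_self, wordIdx_pre]
    · rw [hval, if_pos hj]

/-- From the preimage map of a random variable a machine computes a fast Cauchy sequence of simple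
continuous random variables converging to it. -/
theorem exists_approximation_machine {X : Type*} [MetricSpace X] {δ : Naming X}
    (hX : IsComputableMetricSpace δ) (hsep : IsEffectivelySeparable δ) :
    ∃ e : Name, Computable e ∧ ∀ (p : Name) (G : RandomVariable δ), preimageNaming δ p G →
      ∃ (r : Name) (F : ℕ → PiecewiseContinuous X), Applies e p r ∧
        (∀ n, PiecewiseContinuous.naming δ (seqName r n) (F n)) ∧
        (∀ n, (F n).IsSimple ∧ (F n).IsContinuous) ∧
        PiecewiseContinuous.FastCauchy F ∧ PiecewiseContinuous.ConvergesTo F G := by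
  obtain ⟨ξ, hξ, eξ, heξ, hξe⟩ := hsep
  have : Nonempty X := ⟨ξ 0⟩
  have hδ := isContinuousNaming_of_dist hX.dist_computable
  obtain ⟨t, ht, ht'⟩ := exists_names heξ fun i => hξe (fun _ => i) i rfl
  obtain ⟨B, hB, hB'⟩ := exists_ball_names hX.dist_computable ht ht'
  -- The precision `k + 2` is the one required by `convergesTo_of_good`. Any description with valid
  -- evidence will do, so the approximations may depend on the name `p`.
  have hR : SemiDec fun p (x : ℕ × ℕ) => ∃ y : ℕ × List ℕ,
      x.2 = Encodable.encode y ∧ GoodCode B p (x.1 + 2) y.1 y.2 :=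
    SemiDec.ex (SemiDec.and (SemiDec.of_primrec
      (PrimrecPred.eq_apply (by fun_prop) (by fun_prop)))
      ((semiDec_goodCode hB).comp (g := fun z : (ℕ × ℕ) × ℕ × List ℕ => (z.1.1 + 2, z.2))
        (by fun_prop)))
  obtain ⟨e₁, he₁, h₁⟩ := exists_machine hR
  obtain ⟨e₂, he₂, h₂⟩ := exists_simpleVar_machine ht ht'
  obtain ⟨e, he, hcomp⟩ := exists_comp he₁ he₂
  refine ⟨e, he, fun p G hp => ?_⟩
  obtain ⟨d, hd, hd'⟩ := h₁ p fun k => by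
    obtain ⟨N, I, h⟩ := exists_goodCode hδ hξ hB' hp (k + 2)
    exact ⟨_, (N, I), rfl, h⟩
  choose y hy hgood using hd'
  obtain ⟨r, hr, hr'⟩ := h₂ d
  refine ⟨r, fun k => simpleVar ξ (y k).1 (y k).2, hcomp p d r hd hr,
    fun k => hr' k (y k) (hy k), fun k => ⟨simpleVar_isSimple _ _ _, rfl⟩, ?_⟩
  exact convergesTo_of_good hδ (g := fun k ω => (y k).2.getD (idx (y k).1 ω) 0) (fun k => rfl)
    (fun k ω => PiecewiseContinuous.eval_eq (simpleVar ξ (y k).1 (y k).2)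
      (show ω ∈ (simpleVar ξ (y k).1 (y k).2).dom from trivial)) fun k => (hgood k).coin_le hB' hp

end TTE

end

theorem mainTheorem4 {X : Type*} [MetricSpace X] (δ : TTE.Naming X)
    (hX : TTE.IsComputableMetricSpace δ) (hsep : TTE.IsEffectivelySeparable δ) :
    (∃ e : TTE.Name, Computable e ∧ ∀ (p : TTE.Name) (G : TTE.RandomVariable δ),
      TTE.preimageNaming δ p G → ∃ (r : TTE.Name) (F : ℕ → TTE.PiecewiseContinuous X),
        TTE.Applies e p r ∧ (∀ n, TTE.PiecewiseContinuous.naming δ (TTE.seqName r n) (F n)) ∧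
        (∀ n, (F n).IsSimple ∧ (F n).IsContinuous) ∧
        TTE.PiecewiseContinuous.FastCauchy F ∧ TTE.PiecewiseContinuous.ConvergesTo F G) ∧
    (TTE.IsRepresentation (TTE.preimageNaming δ) ∧
      TTE.IsRepresentation (TTE.limitNaming δ (TTE.simpleContinuous X)) ∧
      TTE.IsRepresentation (TTE.limitNaming δ (TTE.simplePiecewise X))) ∧
    TTE.Equivalent (TTE.preimageNaming δ) (TTE.limitNaming δ (TTE.simpleContinuous X)) ∧
    TTE.Equivalent (TTE.preimageNaming δ) (TTE.limitNaming δ (TTE.simplePiecewise X)) ∧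
    (CompleteSpace X → ∀ F : ℕ → TTE.PiecewiseContinuous X, (∀ n, (F n).IsSimple) →
      TTE.PiecewiseContinuous.FastCauchy F →
        ∃ G : TTE.RandomVariable δ, TTE.PiecewiseContinuous.ConvergesTo F G) := by
  have hne : Nonempty X := let ⟨ξ, _⟩ := hsep; ⟨ξ 0⟩
  obtain ⟨e, he, h⟩ := TTE.exists_approximation_machine hX hsep
  obtain ⟨e', he', h'⟩ := TTE.exists_preimage_machine hX
  have hc : TTE.Realizes (TTE.preimageNaming δ) (TTE.limitNaming δ (TTE.simpleContinuous X)) e id :=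
    fun p G hp => by
      obtain ⟨r, F, h1, h2, h3, h4, h5⟩ := h p G hp
      exact ⟨r, h1, F, h3, h4, h5, h2⟩
  -- The same machine serves here, since its approximations are in particular simple
  -- piecewise-continuous.
  have hpw : TTE.Realizes (TTE.preimageNaming δ) (TTE.limitNaming δ (TTE.simplePiecewise X)) e id :=
    fun p G hp => by
      obtain ⟨r, F, h1, h2, h3, h4, h5⟩ := h p G hp
      exact ⟨r, h1, F, fun n => (h3 n).1, h4, h5, h2⟩
  have hrep := TTE.isRepresentation_preimageNaming
    (TTE.isContinuousNaming_of_dist hX.dist_computable)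
  refine ⟨⟨e, he, h⟩, ⟨hrep, ⟨fun _ _ _ => TTE.limitNaming_functional hX, fun G => ?_⟩,
    ⟨fun _ _ _ => TTE.limitNaming_functional hX, fun G => ?_⟩⟩, ⟨⟨e, he, hc⟩, ⟨e', he', h' _⟩⟩,
    ⟨⟨e, he, hpw⟩, ⟨e', he', h' _⟩⟩, fun _ F hs hF => TTE.exists_limit_of_complete hX hs hF⟩
  · obtain ⟨p, hp⟩ := hrep.surjective G
    obtain ⟨r, -, hr⟩ := hc p G hp
    exact ⟨r, hr⟩
  · obtain ⟨p, hp⟩ := hrep.surjective G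
    obtain ⟨r, -, hr⟩ := hpw p G hp
    exact ⟨r, hr⟩
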